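/- Let $F$ be a field and let $(A,\sigma,f)$ be an $F$-algebra with quadratic pair: $A$ is a central simple $F$-algebra of degree $n$, $\sigma$ is an $F$-linear involution on $A$ whose space of symmetric elements $\mathrm{Sym}(A,\sigma)$ has dimension $\frac{n(n+1)}{2}$, and $f:\mathrm{Sym}(A,\sigma)\to F$ is a semi-trace, i.e. an $F$-linear map with $f(x+\sigma(x))=\mathrm{Trd}_A(x)$ for all $x\in A$. Assume that $n=2m\ge 8$ with $m$ even, and that moreover $m\equiv 0 \bmod 4$ if $\operatorname{char}F\neq 2$. Let $\mathcal C=\mathcal C(A,\sigma,f)$ be the Clifford algebra, i.e. the quotient of the tensor algebra $T(A)$ of the $F$-vector space $A$ by the two-sided ideal generated by the elements $s-f(s)\cdot 1$ for $s\in\mathrm{Sym}(A,\sigma)$ and $u-\mathrm{Sand}(u)(\ell)$ for those $u\in A\otimes_F A$ with $\mathrm{Sand}(u)(\sigma(x))=\mathrm{Sand}(u)(x)$ for all $x\in A$. Here $\mathrm{Sand}(a\otimes b)(x)=axb$, and $\ell\in A$ is any element with $\ell+\sigma(\ell)=1$ and $f(s)=\mathrm{Trd}_A(\ell s)$ for all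 $s\in \mathrm{Sym}(A,\sigma)$ (the ideal does not depend on $\ell$). Let $c:A\to\mathcal C$ be the canonical map, let $\underline\sigma$ be the canonical involution of $\mathcal C$, determined by $\underline\sigma(c(a_1)\cdots c(a_r))=c(\sigma(a_r))\cdots c(\sigma(a_1))$, let $Z$ be the centre of $\mathcal C$ (a quadratic étale $F$-algebra), and let $\mathrm{Trd}_{\mathcal C}:\mathcal C\to Z$ be the reduced trace of $\mathcal C$ as a $Z$-algebra. Semi-traces and quadratic pairs on $\mathcal C$ are taken over $Z$: a semi-trace on $(\mathcal C,\underline\sigma)$ is a $Z$-linear map $g:\mathrm{Sym}(\mathcal C,\underline\sigma)\to Z$ with $g(x+\underline\sigma(x))=\mathrm{Trd}_{\mathcal C}(x)$ for all $x\in\mathcal C$. Then: 1. The involution $\underline\sigma$ is $Z$-linear. It is symplectic if $\operatorname{char}F=2$ and orthogonal if $\operatorname{char}F\ne 2$ (at every geometric point of $Z$, i.e. on each component when $Z\simeq F\times F$). 2. For every $\lambda\in A$ with $\mathrm{Trd}_A(\lambda)=1$, the element $c(\lambda)$ defines a semi-trace on $(\mathcal C,\underline\sigma)$: one has $c(\lambda)+\underline\sigma(c(\lambda))=1$,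 and $s\mapsto \mathrm{Trd}_{\mathcal C}(c(\lambda)s)$ is a semi-trace on $(\mathcal C,\underline\sigma)$. 3. This semi-trace does not depend on the choice of $\lambda$ with $\mathrm{Trd}_A(\lambda)=1$. 4. Consequently there is exactly one quadratic pair $(\underline\sigma,\underline f)$ on $\mathcal C$, of degree $2^{m-1}$ over $Z$, with $\underline f(s)=\mathrm{Trd}_{\mathcal C}(c(\lambda)s)$ for all $s\in\mathrm{Sym}(\mathcal C,\underline\sigma)$ and all $\lambda\in A$ with $\mathrm{Trd}_A(\lambda)=1$. It is called the canonical quadratic pair on $\mathcal C$. -/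

import Mathlib

open scoped TensorProduct

universe u v w

/-- An involution of the `Z`-algebra `B`: a `Z`-linear map of order two that reverses products. -/
@[ext]
structure AlgInvolution (Z : Type v) (B : Type w) [CommRing Z] [Ring B] [Algebra Z B] where
  /-- the underlying linear map -/
  toLin : B →ₗ[Z] B
  map_mul : ∀ x y : B, toLin (x * y) = toLin y * toLin x
  involutive : ∀ x : B, toLin (toLin x) = x

namespace AlgInvolution

variable {Z : Type v} {B : Type w} [CommRing Z] [Ring B] [Algebra Z B]

instance : CoeFun (AlgInvolution Z B) (fun _ => B → B) := ⟨fun σ => σ.toLin⟩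

/-- The `Z`-module `Sym(B, σ)` of symmetric elements. -/
def sym (σ : AlgInvolution Z B) : Submodule Z B where
  carrier := {x | σ x = x}
  add_mem' := by
    intro a b ha hb
    have ha' : σ a = a := ha
    have hb' : σ b = b := hb
    change σ (a + b) = a + b
    rw [map_add, ha', hb']
  zero_mem' := map_zero σ.toLin
  smul_mem' := by
    intro z a ha
    have ha' : σ a = a := ha
    change σ (z • a) = z • a
    rw [map_smul, ha']

theorem mem_sym (σ : AlgInvolution Z B) (x : B) : x ∈ σ.sym ↔ σ x = x := Iff.rfl

theorem add_self_mem_sym (σ : AlgInvolution Z B) (x : B) : x + σ x ∈ σ.sym := by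
  rw [mem_sym, map_add, σ.involutive, add_comm]

end AlgInvolution

section Geometric

variable (F : Type u) [Field F]
variable {Z : Type v} [CommRing Z] [Algebra F Z]

/-- Let `Z` be an `F`-algebra, `Ω` the algebraic closure of `F` and `χ : Z → Ω` a geometric point.
A splitting of the `Z`-algebra `B` at `χ`, of degree `n`, is an isomorphism of `Ω`-algebras from
`Ω ⊗ B` (the tensor product over `Z`, along `χ`) to `End_Ω(Ωⁿ)`. -/
structure Splitting (B : Type w) [Ring B] [Algebra Z B]
    (χ : Z →ₐ[F] AlgebraicClosure F) (n : ℕ) where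
  /-- the isomorphism -/
  toEquiv :
    letI : Algebra Z (AlgebraicClosure F) := χ.toRingHom.toAlgebra
    (AlgebraicClosure F ⊗[Z] B) ≃ₐ[AlgebraicClosure F]
      Module.End (AlgebraicClosure F) (Fin n → AlgebraicClosure F)

/-- The endomorphism of `Ωⁿ` that corresponds to `1 ⊗ b`. -/
noncomputable def Splitting.rep {F : Type u} [Field F] {Z : Type v} [CommRing Z] [Algebra F Z]
    {B : Type w} [Ring B] [Algebra Z B] {χ : Z →ₐ[F] AlgebraicClosure F} {n : ℕ}
    (φ : Splitting F B χ n) (b : B) :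
    Module.End (AlgebraicClosure F) (Fin n → AlgebraicClosure F) :=
  letI : Algebra Z (AlgebraicClosure F) := χ.toRingHom.toAlgebra
  φ.toEquiv ((1 : AlgebraicClosure F) ⊗ₜ[Z] b)

/-- `t : B → Z` is the reduced trace of the `Z`-algebra `B` if at every geometric point `χ` of `Z`
it becomes the trace of a matrix algebra. Here `Z` is étale over `F` (the field `F` itself, or the
centre of a Clifford algebra), so that its geometric points separate its elements. -/
def IsReducedTrace (Z : Type v) [CommRing Z] [Algebra F Z] (B : Type w) [Ring B] [Algebra Z B]
    (t : B →ₗ[Z] Z) : Prop :=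
  ∀ χ : Z →ₐ[F] AlgebraicClosure F, ∃ (n : ℕ) (φ : Splitting F B χ n), ∀ b : B,
    χ (t b) = LinearMap.trace (AlgebraicClosure F) (Fin n → AlgebraicClosure F) (φ.rep b)

open Classical in
/-- The reduced trace `Trd_B : B → Z` (zero if there is none, which does not happen for an algebra
that is central simple of constant degree over an étale algebra `Z`). -/
noncomputable def reducedTrace (Z : Type v) [CommRing Z] [Algebra F Z] (B : Type w) [Ring B]
    [Algebra Z B] : B →ₗ[Z] Z :=
  if h : ∃ t : B →ₗ[Z] Z, IsReducedTrace F Z B t then h.choose else 0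

namespace AlgInvolution

variable {B : Type w} [Ring B] [Algebra Z B]

/-- `σ` is symplectic: at every geometric point of `Z` it is the adjoint involution of a
nondegenerate alternating bilinear form. -/
def IsSymplectic (σ : AlgInvolution Z B) : Prop :=
  ∀ χ : Z →ₐ[F] AlgebraicClosure F, ∃ (n : ℕ) (φ : Splitting F B χ n)
    (b : LinearMap.BilinForm (AlgebraicClosure F) (Fin n → AlgebraicClosure F)),
    b.Nondegenerate ∧ b.IsAlt ∧ ∀ (x : B) (v w : Fin n → AlgebraicClosure F),
      b (φ.rep x v) w = b v (φ.rep (σ x) w)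

/-- `σ` is orthogonal: at every geometric point of `Z` it is the adjoint involution of a
nondegenerate symmetric bilinear form that is not alternating. -/
def IsOrthogonal (σ : AlgInvolution Z B) : Prop :=
  ∀ χ : Z →ₐ[F] AlgebraicClosure F, ∃ (n : ℕ) (φ : Splitting F B χ n)
    (b : LinearMap.BilinForm (AlgebraicClosure F) (Fin n → AlgebraicClosure F)),
    b.Nondegenerate ∧ b.IsSymm ∧ ¬ b.IsAlt ∧ ∀ (x : B) (v w : Fin n → AlgebraicClosure F),
      b (φ.rep x v) w = b v (φ.rep (σ x) w)

/-- The `Z`-linear form `s ↦ Trd_B(l s)` on `Sym(B, σ)`. -/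
noncomputable def traceForm (σ : AlgInvolution Z B) (l : B) : σ.sym →ₗ[Z] Z :=
  (reducedTrace F Z B).comp ((LinearMap.mulLeft Z l).comp σ.sym.subtype)

/-- A semi-trace on `(B, σ)`: a `Z`-linear form on `Sym(B, σ)` with `f(x + σ(x)) = Trd_B(x)`. -/
def IsSemitrace (σ : AlgInvolution Z B) (f : σ.sym →ₗ[Z] Z) : Prop :=
  ∀ x : B, f ⟨x + σ x, σ.add_self_mem_sym x⟩ = reducedTrace F Z B x

/-- The element `l` determines (or defines) the linear form `f` on `Sym(B, σ)`. -/
def Determines (σ : AlgInvolution Z B) (l : B) (f : σ.sym →ₗ[Z] Z) : Prop :=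
  l + σ l = 1 ∧ f = σ.traceForm F l

end AlgInvolution

/-- A quadratic pair `(σ, f)` on an algebra `B` of degree `n` over `Z`. For `Z = F` the first two
conditions say that `B` has dimension `n²` and that `Sym(B, σ)` has dimension `n(n+1)/2`. For `Z`
étale over `F` and `B` central simple of constant degree `n` over `Z` they say the same of ranks
over `Z`: the rank of `Sym(B, σ)` at a point of `Z` never exceeds `n(n+1)/2`. -/
@[ext]
structure QuadraticPair (Z : Type v) [CommRing Z] [Algebra F Z] (B : Type w) [Ring B]
    [Algebra F B] [Algebra Z B] [IsScalarTower F Z B] (n : ℕ) where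
  /-- the involution -/
  σ : AlgInvolution Z B
  /-- the semi-trace -/
  f : σ.sym →ₗ[Z] Z
  finrank_eq : Module.finrank F B = Module.finrank F Z * n ^ 2
  finrank_sym : Module.finrank F σ.sym = Module.finrank F Z * (n * (n + 1) / 2)
  isSemitrace : σ.IsSemitrace F f

end Geometric

section Sandwich

variable {F : Type u} [Field F] {A : Type v} [Ring A] [Algebra F A]

/-- The sandwich map `Sand : A ⊗ A → End_F(A)`, `Sand(a ⊗ b)(x) = a x b`. -/
noncomputable def sand : A ⊗[F] A →ₗ[F] (A →ₗ[F] A) :=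
  TensorProduct.lift
    (LinearMap.mk₂ F (fun a b => (LinearMap.mulLeft F a).comp (LinearMap.mulRight F b))
      (by intros; ext; simp [add_mul]) (by intros; ext; simp)
      (by intros; ext; simp [mul_add]) (by intros; ext; simp))

@[simp]
theorem sand_tmul (a b x : A) : sand (F := F) (a ⊗ₜ b) x = a * (x * b) := by
  simp [sand]

/-- For a linear map `i` from `A` to an algebra `T`, the map `A ⊗ A → T`, `a ⊗ b ↦ i(a) i(b)`. For
`T = T(A)` this is the inclusion of `A ⊗ A` as the component of degree two. -/
noncomputable def mulMap₂ {T : Type w} [Ring T] [Algebra F T] (i : A →ₗ[F] T) :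
    A ⊗[F] A →ₗ[F] T :=
  (LinearMap.mul' F T).comp (TensorProduct.map i i)

@[simp]
theorem mulMap₂_tmul {T : Type w} [Ring T] [Algebra F T] (i : A →ₗ[F] T) (a b : A) :
    mulMap₂ i (a ⊗ₜ b) = i a * i b := by
  simp [mulMap₂]

/-- `a ⊗ b ↦ σ(b) ⊗ σ(a)` -/
noncomputable def swapInv (σ : AlgInvolution F A) : A ⊗[F] A →ₗ[F] A ⊗[F] A :=
  (TensorProduct.map σ.toLin σ.toLin).comp (TensorProduct.comm F A A).toLinearMap

theorem sand_swapInv (σ : AlgInvolution F A) (u : A ⊗[F] A) (x : A) :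
    sand (swapInv σ u) x = σ (sand u (σ x)) := by
  induction u using TensorProduct.induction_on with
  | zero => simp
  | tmul a b => simp [swapInv, σ.map_mul, σ.involutive, mul_assoc]
  | add u v hu hv => simp only [map_add, LinearMap.add_apply, hu, hv]

end Sandwich

namespace QuadraticPair

variable {F : Type u} [Field F] {A : Type v} [Ring A] [Algebra F A] {n : ℕ}

/-- The relations of the Clifford algebra. The second one is over the `u` with `σ₂(u) = u`, that is
`Sand(u)(σ(x)) = Sand(u)(x)` for all `x`. It is imposed for every `l` that determines the
semi-trace; two such `l` differ by an element `x - σ(x)`, so that one of them would be enough. -/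
inductive CliffordRel (Q : QuadraticPair F F A n) : TensorAlgebra F A → TensorAlgebra F A → Prop
  | sym (s : Q.σ.sym) :
      CliffordRel Q (TensorAlgebra.ι F (s : A)) (algebraMap F _ (Q.f s))
  | sand (u : A ⊗[F] A) (hu : ∀ x : A, _root_.sand u (Q.σ x) = _root_.sand u x)
      (l : A) (hl : Q.σ.Determines F l Q.f) :
      CliffordRel Q (mulMap₂ (TensorAlgebra.ι F) u) (TensorAlgebra.ι F (_root_.sand u l))

/-- The Clifford algebra `C(A, σ, f)`, the quotient of the tensor algebra `T(A)` by the two-sided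
ideal that the relations generate. -/
def Clifford (Q : QuadraticPair F F A n) : Type (max u v) := RingQuot Q.CliffordRel

instance (Q : QuadraticPair F F A n) : Ring Q.Clifford :=
  inferInstanceAs (Ring (RingQuot Q.CliffordRel))

instance (Q : QuadraticPair F F A n) : Algebra F Q.Clifford :=
  inferInstanceAs (Algebra F (RingQuot Q.CliffordRel))

/-- The projection `T(A) → C(A, σ, f)`. -/
noncomputable def cliffordProj (Q : QuadraticPair F F A n) : TensorAlgebra F A →ₐ[F] Q.Clifford :=
  RingQuot.mkAlgHom F Q.CliffordRel

/-- The canonical map `c : A → C(A, σ, f)`. -/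
noncomputable def c (Q : QuadraticPair F F A n) : A →ₗ[F] Q.Clifford :=
  Q.cliffordProj.toLinearMap.comp (TensorAlgebra.ι F)

theorem c_sym (Q : QuadraticPair F F A n) (s : Q.σ.sym) :
    Q.c (s : A) = algebraMap F _ (Q.f s) := by
  have h := RingQuot.mkAlgHom_rel F (CliffordRel.sym (Q := Q) s)
  rw [AlgHom.commutes] at h
  exact h

theorem cliffordProj_mulMap₂ (Q : QuadraticPair F F A n) (u : A ⊗[F] A) :
    Q.cliffordProj (mulMap₂ (TensorAlgebra.ι F) u) = mulMap₂ Q.c u := by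
  induction u using TensorProduct.induction_on with
  | zero => simp
  | tmul a b => simp [c]
  | add u v hu hv => simp only [map_add, hu, hv]

theorem c_sand (Q : QuadraticPair F F A n) (u : A ⊗[F] A)
    (hu : ∀ x : A, sand u (Q.σ x) = sand u x) (l : A) (hl : Q.σ.Determines F l Q.f) :
    mulMap₂ Q.c u = Q.c (sand u l) := by
  rw [← cliffordProj_mulMap₂]
  exact RingQuot.mkAlgHom_rel F (CliffordRel.sand (Q := Q) u hu l hl)

/-- `T(A) → C(A, σ, f)ᵒᵖ`, `a₁ ⊗ ⋯ ⊗ aᵣ ↦ c(σ(aᵣ)) ⋯ c(σ(a₁))` -/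
noncomputable def preInvolution (Q : QuadraticPair F F A n) :
    TensorAlgebra F A →ₐ[F] Q.Cliffordᵐᵒᵖ :=
  TensorAlgebra.lift F
    ((MulOpposite.opLinearEquiv F).toLinearMap.comp (Q.c.comp Q.σ.toLin))

theorem preInvolution_ι (Q : QuadraticPair F F A n) (a : A) :
    Q.preInvolution (TensorAlgebra.ι F a) = MulOpposite.op (Q.c (Q.σ a)) := by
  simp [preInvolution]

theorem preInvolution_mulMap₂ (Q : QuadraticPair F F A n) (u : A ⊗[F] A) :
    Q.preInvolution (mulMap₂ (TensorAlgebra.ι F) u) =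
      MulOpposite.op (mulMap₂ Q.c (swapInv Q.σ u)) := by
  induction u using TensorProduct.induction_on with
  | zero => simp
  | tmul a b => simp [preInvolution_ι, swapInv]
  | add u v hu hv => simp only [map_add, hu, hv, MulOpposite.op_add]

theorem preInvolution_rel (Q : QuadraticPair F F A n) ⦃x y : TensorAlgebra F A⦄
    (h : Q.CliffordRel x y) : Q.preInvolution x = Q.preInvolution y := by
  cases h with
  | sym s =>
    have hs : Q.σ (s : A) = s := s.2
    rw [preInvolution_ι, hs, c_sym, AlgHom.commutes]
    rfl
  | sand u hu l hl =>
    rw [preInvolution_mulMap₂, preInvolution_ι, c_sand Q _ _ l hl, sand_swapInv, hu]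
    intro x
    rw [sand_swapInv, sand_swapInv, hu]

/-- `C(A, σ, f) → C(A, σ, f)ᵒᵖ`, induced by the previous map -/
noncomputable def opInvolution (Q : QuadraticPair F F A n) : Q.Clifford →ₐ[F] Q.Cliffordᵐᵒᵖ :=
  RingQuot.liftAlgHom F ⟨Q.preInvolution, Q.preInvolution_rel⟩

theorem opInvolution_proj (Q : QuadraticPair F F A n) (x : TensorAlgebra F A) :
    Q.opInvolution (Q.cliffordProj x) = Q.preInvolution x :=
  RingQuot.liftAlgHom_mkAlgHom_apply F Q.preInvolution Q.preInvolution_rel x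

theorem cliffordProj_surjective (Q : QuadraticPair F F A n) :
    Function.Surjective Q.cliffordProj :=
  RingQuot.mkAlgHom_surjective F Q.CliffordRel

theorem unop_opInvolution_twice (Q : QuadraticPair F F A n) (x : Q.Clifford) :
    (Q.opInvolution (Q.opInvolution x).unop).unop = x := by
  obtain ⟨x, rfl⟩ := Q.cliffordProj_surjective x
  induction x using TensorAlgebra.induction with
  | algebraMap r =>
    rw [AlgHom.commutes, AlgHom.commutes, MulOpposite.algebraMap_apply, MulOpposite.unop_op,
      AlgHom.commutes, MulOpposite.algebraMap_apply, MulOpposite.unop_op]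
  | ι a =>
    have hc : ∀ b : A, Q.cliffordProj (TensorAlgebra.ι F b) = Q.c b := fun _ => rfl
    have ho : ∀ b : A, Q.opInvolution (Q.c b) = MulOpposite.op (Q.c (Q.σ b)) := fun b => by
      rw [← hc, opInvolution_proj, preInvolution_ι]
    rw [hc, ho, MulOpposite.unop_op, ho, MulOpposite.unop_op, Q.σ.involutive]
  | mul x y hx hy =>
    simp only [map_mul, MulOpposite.unop_mul, hx, hy]
  | add x y hx hy =>
    simp only [map_add, MulOpposite.unop_add, hx, hy]

/-- The canonical involution of the Clifford algebra, as an `F`-linear involution: it maps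
`c(a₁) ⋯ c(aᵣ)` to `c(σ(aᵣ)) ⋯ c(σ(a₁))`. -/
noncomputable def canonicalInvolution (Q : QuadraticPair F F A n) : AlgInvolution F Q.Clifford where
  toLin := (MulOpposite.opLinearEquiv F).symm.toLinearMap.comp Q.opInvolution.toLinearMap
  map_mul := by intro x y; simp
  involutive := Q.unop_opInvolution_twice

theorem canonicalInvolution_c (Q : QuadraticPair F F A n) (a : A) :
    Q.canonicalInvolution (Q.c a) = Q.c (Q.σ a) := by
  change (Q.opInvolution (Q.cliffordProj (TensorAlgebra.ι F a))).unop = _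
  rw [opInvolution_proj, preInvolution_ι, MulOpposite.unop_op]

/-- The centre of the Clifford algebra. -/
abbrev cliffordCenter (Q : QuadraticPair F F A n) : Subalgebra F Q.Clifford :=
  Subalgebra.center F Q.Clifford

/-- The Clifford algebra as an algebra over its centre, with multiplication as the action. -/
instance (Q : QuadraticPair F F A n) : Algebra Q.cliffordCenter Q.Clifford where
  algebraMap := Q.cliffordCenter.val.toRingHom
  commutes' := fun z x => (Subalgebra.mem_center_iff.mp z.2 x).symm
  smul_def' := fun _ _ => rfl

end QuadraticPair

/-! Everything is checked over an algebraic closure `K` of `F`. There `A` becomes the matrix algebra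
of a space `V`, and `σ` the adjoint involution of a symmetric bilinear form `b` with Gram matrix
`J`. Identify `V ⊗ V` with `End V`, where `v ⊗ w` is the dyad `x ↦ v b(w, x)`. Then `σ` is the flip,
and the semi-trace of `v ⊗ v` is `q(v) = b(v, ℓ v)`, a quadratic form with polar form `b`. The
relations of the Clifford algebra become the relations `vv = q(v)` and `(uv)(vw) = q(v) uw` of the
even Clifford algebra of `q` (`exists_clifford_lift`, `exists_evenHom`).

The half-spin modules of `q`, built one hyperbolic plane at a time (`IsSpinRep.extend`), map `K ⊗ C`
onto two matrix algebras of degree `2^(m-1)`, and a bound on the dimension makes this map bijective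
(`exists_clifford_split`). The modules carry invariant bilinear forms. For even `m` each module is
paired with itself, and the form has the symmetry sign `(-1)^(m(m+1)/2)`, which is `1` if `4 ∣ m` or
if the characteristic is two. Hence the canonical involution is adjoint to a symmetric form on each
factor. In particular it is linear over the centre, and orthogonal in characteristic different from
two.

If `Trd(λ) = 1`, then `c(λ)` plus its conjugate is `c(λ + σ(λ)) = f(λ + σ(λ)) = 1`. This yields the
semi-trace property, and in characteristic two it makes the invariant forms alternating.

Independence of `λ` means that `Trd(c(a) s) = 0` if `Trd(a) = 0` and `s` is symmetric. Matrices of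
trace zero are spanned by dyads `v ⊗ w` with `b(v, w) = 0`. As `dim V ≥ 5`, there are `x`, `y`
orthogonal to `v` and `w` with `b(x, y) = 1`. Then `vw = G - G'` with `G = (xy)(vw)` and `G'` its
conjugate, and `G s`, `G' s` have the same trace (`trace_evenHom_mul_eq_zero`).

The reduced trace, which is given by its values at geometric points, is shown to exist over the
centre by means of the trace of `x ↦ b σ(x)` (`trace_mul_involution`, `exists_center_trace`). -/

namespace CliffordQP

/-! ### Linear algebra under extension of the base field -/

section BaseChange

variable {F K X Xh Y Yh : Type*} [Field F] [Field K] [Algebra F K]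
  [AddCommGroup X] [Module F X] [AddCommMonoid Xh] [Module F Xh] [Module K Xh]
  [IsScalarTower F K Xh]
  [AddCommGroup Y] [Module F Y] [AddCommMonoid Yh] [Module F Yh] [Module K Yh]
  [IsScalarTower F K Yh]

theorem span_range_eq_top_of_isBaseChange {i : X →ₗ[F] Xh} (hi : IsBaseChange K i) :
    Submodule.span K (Set.range i) = ⊤ := by
  rw [eq_top_iff]
  intro x _
  refine hi.inductionOn x _ (Submodule.zero_mem _) ?_ ?_ ?_
  · intro m
    exact Submodule.subset_span ⟨m, rfl⟩
  · intro s n hn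
    exact Submodule.smul_mem _ _ hn
  · intro a b ha hb
    exact Submodule.add_mem _ ha hb

/-- The common kernel of linear maps defined over `F` commutes with extension of scalars. -/
theorem mem_span_of_forall_eq_zero {i : X →ₗ[F] Xh} (hi : IsBaseChange K i)
    {j : Y →ₗ[F] Yh} (hj : IsBaseChange K j) {T : Type*} (φ : T → X →ₗ[F] Y)
    (φh : T → Xh →ₗ[K] Yh) (comm : ∀ t x, φh t (i x) = j (φ t x))
    {x : Xh} (hx : ∀ t, φh t x = 0) :
    x ∈ Submodule.span K (i '' {x | ∀ t, φ t x = 0}) := by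
  have ω := Module.Basis.ofVectorSpace F K
  obtain ⟨c, hc⟩ := TensorProduct.eq_repr_basis_left ω (hi.equiv.symm x)
  have hx' : x = c.sum fun k n => ω k • i n := by
    rw [← hi.equiv.apply_symm_apply x, ← hc, Finsupp.sum, Finsupp.sum, map_sum]
    simp [IsBaseChange.equiv_tmul]
  -- A basis of `K` over `F` splits every equation into equations over `F`, one for each
  -- coefficient. The coefficients do not depend on `t`, so an infinite family of equations does no
  -- harm.
  have key : ∀ t k, φ t (c k) = 0 := by
    intro t k
    have h0 : ((c.mapRange (φ t) (map_zero _)).sum fun k n => ω k ⊗ₜ[F] n) = 0 := by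
      rw [Finsupp.sum_mapRange_index (by simp)]
      apply hj.equiv.injective
      have := hx t
      rw [hx', Finsupp.sum, map_sum] at this
      rw [Finsupp.sum, map_sum, map_zero, ← this]
      refine Finset.sum_congr rfl fun k _ => ?_
      rw [IsBaseChange.equiv_tmul, map_smul, comm]
    have h1 := TensorProduct.sum_tmul_basis_left_eq_zero ω _ h0
    simpa using DFunLike.congr_fun h1 k
  rw [hx']
  refine Submodule.sum_mem _ fun k _ => Submodule.smul_mem _ _ (Submodule.subset_span ?_)
  exact ⟨c k, fun t => key t k, rfl⟩

theorem linearIndependent_of_isBaseChange {i : X →ₗ[F] Xh} (hi : IsBaseChange K i)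
    {ι : Type*} {v : ι → X} (hv : LinearIndependent F v) : LinearIndependent K (i ∘ v) := by
  have hr := hv.linearIndepOn_id
  have h := (hi.basis (Module.Basis.extend hr)).linearIndependent
  let g : ι → hr.extend (Set.subset_univ _) :=
    fun k => ⟨v k, hr.subset_extend _ ⟨k, rfl⟩⟩
  have hg : Function.Injective g := fun a b hab => hv.injective (congrArg Subtype.val hab)
  have e : i ∘ v = hi.basis (Module.Basis.extend hr) ∘ g := by
    funext k
    simp [g, IsBaseChange.basis_apply]
  rw [e]
  exact h.comp g hg

theorem finrank_span_image_of_isBaseChange {i : X →ₗ[F] Xh} (hi : IsBaseChange K i)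
    (S : Submodule F X) :
    Module.finrank K (Submodule.span K (i '' (S : Set X))) = Module.finrank F S := by
  have b := Module.Basis.ofVectorSpace F S
  have hv : LinearIndependent F (fun k => (b k : X)) :=
    b.linearIndependent.map' S.subtype (by simp)
  have hv' := linearIndependent_of_isBaseChange hi hv
  have hspan : Submodule.span K (i '' (S : Set X)) =
      Submodule.span K (Set.range (i ∘ fun k => (b k : X))) := by
    apply le_antisymm
    · rw [Submodule.span_le]
      rintro _ ⟨s, hs, rfl⟩
      have h1 := b.mem_span (⟨s, hs⟩ : S)
      have h2 : (⟨s, hs⟩ : S) ∈ ((Submodule.span K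
          (Set.range (i ∘ fun k => (b k : X)))).restrictScalars F).comap (i ∘ₗ S.subtype) := by
        refine Submodule.span_le.mpr ?_ h1
        rintro _ ⟨k, rfl⟩
        exact Submodule.subset_span ⟨k, rfl⟩
      exact h2
    · rw [Submodule.span_le]
      rintro _ ⟨k, rfl⟩
      exact Submodule.subset_span ⟨_, (b k).2, rfl⟩
  rw [hspan, Module.finrank_eq_nat_card_basis b,
    Module.finrank_eq_nat_card_basis (Module.Basis.span hv')]

theorem injective_of_isBaseChange {i : X →ₗ[F] Xh} (hi : IsBaseChange K i) :
    Function.Injective i := by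
  rw [injective_iff_map_eq_zero]
  intro x hx
  by_contra h0
  have h1 : LinearIndependent F (fun _ : Unit => x) := LinearIndependent.of_subsingleton () h0
  exact (linearIndependent_of_isBaseChange hi h1).ne_zero () hx

end BaseChange

/-! ### Dimensions of spaces of symmetric and skew-symmetric matrices -/

section SymmetricMatrices

variable (K : Type*) [Field K] (n : ℕ)

/-- The space of matrices with `Mᵀ = d • M`. -/
def symMatrix (d : K) : Submodule K (Matrix (Fin n) (Fin n) K) where
  carrier := {M | M.transpose = d • M}
  add_mem' := by
    intro a b ha hb
    simp only [Set.mem_ofPred_eq, Matrix.transpose_add, smul_add] at *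
    rw [ha, hb]
  zero_mem' := by simp
  smul_mem' := by
    intro c a ha
    simp only [Set.mem_ofPred_eq, Matrix.transpose_smul] at *
    rw [ha, smul_comm]

variable {K n}

theorem mem_symMatrix {d : K} {M : Matrix (Fin n) (Fin n) K} :
    M ∈ symMatrix K n d ↔ M.transpose = d • M := Iff.rfl

variable (K n)

/-- Symmetric matrices are functions on unordered pairs of indices. -/
def symMatrixEquiv : symMatrix K n 1 ≃ₗ[K] (Sym2 (Fin n) → K) where
  toFun M := Sym2.lift ⟨fun i j => M.1 i j, fun i j => by
    have h := mem_symMatrix.mp M.2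
    rw [one_smul] at h
    exact congrFun (congrFun h j) i⟩
  map_add' M M' := by
    ext s
    induction s using Sym2.ind
    simp
  map_smul' c M := by
    ext s
    induction s using Sym2.ind
    simp
  invFun f := ⟨Matrix.of fun i j => f s(i, j), by
    rw [mem_symMatrix, one_smul]
    ext i j
    simp [Sym2.eq_swap]⟩
  left_inv M := by
    ext i j
    simp
  right_inv f := by
    ext s
    induction s using Sym2.ind
    simp

theorem finrank_symMatrix_one : Module.finrank K (symMatrix K n 1) = n * (n + 1) / 2 := by
  rw [(symMatrixEquiv K n).finrank_eq, Module.finrank_fintype_fun_eq_card, Sym2.card,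
    Fintype.card_fin, Nat.choose_two_right, Nat.add_sub_cancel, mul_comm]

/-- Rank and nullity of `M ↦ M - Mᵀ`: the kernel consists of the symmetric matrices, and the image
is all skew-symmetric ones because `2` is invertible. -/
theorem finrank_symMatrix_neg_one (h2 : (2 : K) ≠ 0) :
    Module.finrank K (symMatrix K n (-1)) + n * (n + 1) / 2 = n * n := by
  let φ : Matrix (Fin n) (Fin n) K →ₗ[K] Matrix (Fin n) (Fin n) K :=
    LinearMap.id - (Matrix.transposeLinearEquiv (Fin n) (Fin n) K K).toLinearMap
  have hφ : ∀ M, φ M = M - M.transpose := fun M => rfl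
  have h := LinearMap.finrank_range_add_finrank_ker φ
  have hk : LinearMap.ker φ = symMatrix K n 1 := by
    ext M
    rw [LinearMap.mem_ker, hφ, sub_eq_zero, mem_symMatrix, one_smul, eq_comm]
  have hr : LinearMap.range φ = symMatrix K n (-1) := by
    ext M
    rw [LinearMap.mem_range, mem_symMatrix, neg_one_smul]
    constructor
    · rintro ⟨M, rfl⟩
      rw [hφ]
      simp
    · intro hM
      refine ⟨(2 : K)⁻¹ • M, ?_⟩
      rw [hφ, Matrix.transpose_smul, hM, smul_neg, sub_neg_eq_add, ← add_smul]
      have : (2 : K)⁻¹ + 2⁻¹ = 1 := by field_simp; norm_num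
      rw [this, one_smul]
  rw [hk, hr, finrank_symMatrix_one, Module.finrank_matrix] at h
  simpa using h

end SymmetricMatrices

/-- The sum of the products of the entries of a symmetric and of an alternating matrix. -/
theorem sum_smul_eq_zero_of_symm_of_alt {ι R M : Type*} [Fintype ι] [CommRing R]
    [AddCommGroup M] [Module R M] (s : ι → ι → R) (x : ι → ι → M)
    (hs : ∀ i j, s i j = s j i) (hx : ∀ i, x i i = 0) (hx' : ∀ i j, x i j + x j i = 0) :
    ∑ i, ∑ j, s i j • x i j = 0 := by
  classical
  rw [← Fintype.sum_prod_type']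
  refine Finset.sum_involution (fun p _ => (p.2, p.1)) ?_ ?_ ?_ ?_
  · rintro ⟨i, j⟩ _
    simp only
    rw [hs j i, ← smul_add, hx', smul_zero]
  · rintro ⟨i, j⟩ _ h heq
    simp only [Prod.mk.injEq] at heq
    rw [heq.1] at h
    simp [hx] at h
  · simp
  · simp

/-! ### Algebras that become products of matrix algebras, and their centres -/

section SplitRep

variable {F K B I : Type*} [Field F] [Field K] [Algebra F K] [Ring B] [Algebra F B]
  {N : ℕ}

/-- The representations of `B` that a splitting of `K ⊗ B` into matrix algebras defines. -/
noncomputable def splitRep (e : K ⊗[F] B ≃ₐ[K] (I → Matrix (Fin N) (Fin N) K)) :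
    B →ₐ[F] (I → Matrix (Fin N) (Fin N) K) :=
  (e.toAlgHom.restrictScalars F).comp Algebra.TensorProduct.includeRight

variable (e : K ⊗[F] B ≃ₐ[K] (I → Matrix (Fin N) (Fin N) K))

theorem isBaseChange_splitRep : IsBaseChange K (splitRep e).toLinearMap :=
  IsBaseChange.of_equiv e.toLinearEquiv fun _ => rfl

theorem span_splitRep : Submodule.span K (Set.range (splitRep e)) =
    (⊤ : Submodule K (I → Matrix (Fin N) (Fin N) K)) := by
  have h := span_range_eq_top_of_isBaseChange (isBaseChange_splitRep e)
  exact h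

theorem splitRep_injective : Function.Injective (splitRep e) :=
  injective_of_isBaseChange (isBaseChange_splitRep e)

theorem splitRep_induction {p : (I → Matrix (Fin N) (Fin N) K) → Prop}
    (x : I → Matrix (Fin N) (Fin N) K) (h : ∀ b, p (splitRep e b))
    (hadd : ∀ x y, p x → p y → p (x + y)) (hsmul : ∀ (k : K) x, p x → p (k • x)) : p x := by
  have hx : x ∈ Submodule.span K (Set.range (splitRep e)) := by
    rw [span_splitRep]; exact Submodule.mem_top
  induction hx using Submodule.span_induction with
  | mem x hx => obtain ⟨b, rfl⟩ := hx; exact h b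
  | zero => simpa using hsmul 0 _ (h 0)
  | add x y _ _ hx hy => exact hadd x y hx hy
  | smul k x _ hx => exact hsmul k x hx

theorem finrank_splitRep [Fintype I] (e : K ⊗[F] B ≃ₐ[K] (I → Matrix (Fin N) (Fin N) K)) :
    Module.finrank F B = Fintype.card I * N ^ 2 := by
  have h1 := (IsBaseChange.equiv (isBaseChange_splitRep e)).finrank_eq
  rw [Module.finrank_baseChange] at h1
  rw [h1, Module.finrank_pi_fintype]
  simp [Module.finrank_matrix, sq]

include e in
theorem finite_splitRep [Finite I] : Module.Finite F B := by
  have := Fintype.ofFinite I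
  let b := Module.Basis.ofVectorSpace F B
  have h : Module.Finite K (I → Matrix (Fin N) (Fin N) K) := inferInstance
  have := Module.Finite.finite_basis ((isBaseChange_splitRep e).basis b)
  exact Module.Finite.of_basis b

theorem eq_scalar_of_central {x : I → Matrix (Fin N) (Fin N) K} (i : I) (i₀ : Fin N)
    (hx : ∀ b, splitRep e b * x = x * splitRep e b) :
    x i = algebraMap K _ (x i i₀ i₀) := by
  classical
  have h : ∀ y, y * x = x * y := by
    intro y
    refine splitRep_induction e (p := fun y => y * x = x * y) y hx ?_ ?_
    · intro a b ha hb
      rw [add_mul, mul_add, ha, hb]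
    · intro k a ha
      rw [smul_mul_assoc, mul_smul_comm, ha]
  have h2 : x i ∈ Set.range (Matrix.scalar (Fin N)) := by
    refine Matrix.mem_range_scalar_of_commute_single fun a b _ => ?_
    have := congrFun (h (Pi.single i (Matrix.single a b 1))) i
    simpa [Commute, SemiconjBy] using this
  obtain ⟨c, hc⟩ := h2
  rw [← hc]
  ext a b
  simp [Matrix.algebraMap_matrix_apply, Matrix.diagonal_apply]

theorem mem_span_center {x : I → Matrix (Fin N) (Fin N) K} (hx : ∀ y, y * x = x * y) :
    x ∈ Submodule.span K (splitRep e '' {b | ∀ y, y * b = b * y}) := by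
  have h := mem_span_of_forall_eq_zero (isBaseChange_splitRep e) (isBaseChange_splitRep e)
    (T := B) (fun t => LinearMap.mulLeft F t - LinearMap.mulRight F t)
    (fun t => LinearMap.mulLeft K (splitRep e t) - LinearMap.mulRight K (splitRep e t))
    (by intro t x; simp) (x := x) (by intro t; simp [hx])
  simpa [sub_eq_zero] using h

variable {Z : Type*} [CommRing Z] [Algebra F Z] [Algebra Z B] [IsScalarTower F Z B]

/-- A central element acts on each factor by a scalar, which is read off from the entry at `(0, 0)`.
-/
theorem exists_characters [NeZero N] : ∃ χ : I → Z →ₐ[F] K, ∀ i z,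
    splitRep e (algebraMap Z B z) i = algebraMap K _ (χ i z) := by
  have key : ∀ i z, splitRep e (algebraMap Z B z) i =
      algebraMap K _ (splitRep e (algebraMap Z B z) i 0 0) := by
    intro i z
    refine eq_scalar_of_central e i 0 fun b => ?_
    rw [← map_mul, ← map_mul, Algebra.commutes]
  have hinj : Function.Injective (algebraMap K (Matrix (Fin N) (Fin N) K)) :=
    FaithfulSMul.algebraMap_injective _ _
  refine ⟨fun i => AlgHom.mk' (RingHom.mk' ⟨⟨fun z => splitRep e (algebraMap Z B z) i 0 0, ?_⟩, ?_⟩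
    ?_) ?_, key⟩
  · simp
  · intro z z'
    apply hinj
    rw [map_mul, ← key, ← key, ← key, map_mul, map_mul, Pi.mul_apply]
  · intro z z'
    simp
  · intro c z
    change splitRep e (algebraMap Z B (c • z)) i 0 0 = c • splitRep e (algebraMap Z B z) i 0 0
    rw [Algebra.algebraMap_eq_smul_one, smul_assoc, map_smul, ← Algebra.algebraMap_eq_smul_one]
    rfl

variable {χ : I → Z →ₐ[F] K}
  (hχ : ∀ i z, splitRep e (algebraMap Z B z) i = algebraMap K _ (χ i z))

include hχ

omit [IsScalarTower F Z B] in
theorem splitRep_smul (i : I) (z : Z) (b : B) :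
    splitRep e (z • b) i = χ i z • splitRep e b i := by
  rw [Algebra.smul_def, map_mul, Pi.mul_apply, hχ, ← Algebra.smul_def]

omit [IsScalarTower F Z B] in
theorem characters_separate [NeZero N] (hinj : Function.Injective (algebraMap Z B)) {z z' : Z}
    (h : ∀ i, χ i z = χ i z') : z = z' := by
  apply hinj
  apply splitRep_injective e
  funext i
  rw [hχ, hχ, h]

variable (hZ : ∀ x : B, (∀ y, y * x = x * y) → ∃ z, algebraMap Z B z = x)
include hZ

omit [IsScalarTower F Z B] in
-- Forming the centre commutes with extension of scalars, and the centre of the product of matrix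
-- algebras is `K^I`.
theorem span_characters [NeZero N] :
    Submodule.span K (Set.range fun z i => χ i z) = (⊤ : Submodule K (I → K)) := by
  rw [eq_top_iff]
  intro x _
  have hx : ∀ y, y * (fun i => algebraMap K (Matrix (Fin N) (Fin N) K) (x i)) =
      (fun i => algebraMap K (Matrix (Fin N) (Fin N) K) (x i)) * y := by
    intro y
    funext i
    exact (Algebra.commutes _ _).symm
  let π : (I → Matrix (Fin N) (Fin N) K) →ₗ[K] (I → K) :=
    LinearMap.pi fun i => (LinearMap.proj (R := K) (φ := fun _ : Fin N => K) 0 ∘ₗ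
      LinearMap.proj (R := K) (φ := fun _ : Fin N => Fin N → K) 0) ∘ₗ
      LinearMap.proj (R := K) (φ := fun _ : I => Matrix (Fin N) (Fin N) K) i
  have h := Submodule.mem_map_of_mem (f := π) (mem_span_center e hx)
  rw [Submodule.map_span] at h
  have hx' : π (fun i => algebraMap K (Matrix (Fin N) (Fin N) K) (x i)) = x := by
    funext i
    change algebraMap K (Matrix (Fin N) (Fin N) K) (x i) 0 0 = x i
    simp [Matrix.algebraMap_matrix_apply]
  rw [hx'] at h
  refine Submodule.span_mono ?_ h
  rintro _ ⟨_, ⟨b, hb, rfl⟩, rfl⟩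
  obtain ⟨z, rfl⟩ := hZ b hb
  refine ⟨z, ?_⟩
  funext i
  change χ i z = splitRep e (algebraMap Z B z) i 0 0
  simp [hχ, Matrix.algebraMap_matrix_apply]

theorem isBaseChange_characters [NeZero N] [Fintype I]
    (hinj : Function.Injective (algebraMap Z B)) :
    IsBaseChange K (LinearMap.pi fun i => (χ i).toLinearMap : Z →ₗ[F] (I → K)) := by
  let f : Z →ₗ[F] (I → K) := LinearMap.pi fun i => (χ i).toLinearMap
  let g : (I → K) →ₗ[K] (I → Matrix (Fin N) (Fin N) K) :=
    LinearMap.pi fun i => Algebra.linearMap K _ ∘ₗ LinearMap.proj i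
  have hg : Function.Injective g := by
    intro x y h
    funext i
    exact FaithfulSMul.algebraMap_injective K (Matrix (Fin N) (Fin N) K) (congrFun h i)
  have hgf : ∀ z, g (f z) = splitRep e (algebraMap Z B z) := by
    intro z
    funext i
    exact (hχ i z).symm
  have b := Module.Basis.ofVectorSpace F Z
  have hb : LinearIndependent K (g ∘ (f ∘ b)) := by
    have h1 : LinearIndependent F (fun k => algebraMap Z B (b k)) :=
      b.linearIndependent.map' (IsScalarTower.toAlgHom F Z B).toLinearMap
        (LinearMap.ker_eq_bot.mpr hinj)
    have h2 := linearIndependent_of_isBaseChange (isBaseChange_splitRep e) h1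
    have h3 : g ∘ (f ∘ b) = (splitRep e).toLinearMap ∘ fun k => algebraMap Z B (b k) :=
      funext fun k => hgf (b k)
    rw [h3]
    exact h2
  have hb' : LinearIndependent K (f ∘ b) := LinearIndependent.of_comp g hb
  have htop : ⊤ ≤ Submodule.span K (Set.range (f ∘ b)) := by
    rw [← span_characters e hχ hZ, Submodule.span_le]
    rintro _ ⟨z, rfl⟩
    have h2 : z ∈ ((Submodule.span K
        (Set.range (f ∘ b))).restrictScalars F).comap f := by
      refine Submodule.span_le.mpr ?_ (b.mem_span z)
      rintro _ ⟨k, rfl⟩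
      exact Submodule.subset_span ⟨k, rfl⟩
    exact h2
  let b' := Module.Basis.mk hb' htop
  refine IsBaseChange.of_equiv ((Algebra.TensorProduct.basis K b).equiv b' (Equiv.refl _)) ?_
  intro z
  have h3 : (((Algebra.TensorProduct.basis K b).equiv b' (Equiv.refl _)).toLinearMap.restrictScalars
      F) ∘ₗ ((TensorProduct.mk F K Z 1)) = f := by
    refine b.ext fun k => ?_
    change ((Algebra.TensorProduct.basis K b).equiv b' (Equiv.refl _)) (1 ⊗ₜ b k) = f (b k)
    rw [← Algebra.TensorProduct.basis_apply, Module.Basis.equiv_apply]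
    simp [b']
  exact LinearMap.congr_fun h3 z

theorem finrank_center [NeZero N] [Fintype I] (hinj : Function.Injective (algebraMap Z B)) :
    Module.finrank F Z = Fintype.card I := by
  have h1 := (IsBaseChange.equiv (isBaseChange_characters e hχ hZ hinj)).finrank_eq
  rw [Module.finrank_baseChange] at h1
  simpa using h1

omit hχ hZ in
include e in
theorem finite_center [Fintype I] (hinj : Function.Injective (algebraMap Z B)) :
    Module.Finite F Z := by
  have := finite_splitRep e
  exact Module.Finite.of_injective (IsScalarTower.toAlgHom F Z B).toLinearMap hinj

/-- The `χ i` are distinct since they span `K^I`, and there are `dim Z` of them, the largest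
possible number of homomorphisms to `K`. So it is enough to check conditions on geometric points
factor by factor. -/
theorem exists_eq_character [NeZero N] [Fintype I] (hinj : Function.Injective (algebraMap Z B))
    (ψ : Z →ₐ[F] K) : ∃ i, ψ = χ i := by
  have := finite_center e hinj
  have hinjχ : Function.Injective χ := by
    classical
    intro i j hij
    by_contra hne
    have h1 : Submodule.span K (Set.range fun z i => χ i z) ≤
        LinearMap.ker (LinearMap.proj (R := K) (φ := fun _ : I => K) i - LinearMap.proj j) := by
      rw [Submodule.span_le]
      rintro _ ⟨z, rfl⟩
      simp [hij]
    rw [span_characters e hχ hZ] at h1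
    have h2 := h1 (x := Pi.single i 1) trivial
    simp [Ne.symm hne] at h2
  have hfin : Finite (Z →ₐ[F] K) := inferInstance
  have := Fintype.ofFinite (Z →ₐ[F] K)
  have hcard : Fintype.card (Z →ₐ[F] K) ≤ Fintype.card I := by
    rw [← finrank_center e hχ hZ hinj, ← Nat.card_eq_fintype_card]
    exact card_algHom_le_finrank F Z K
  have hb := (Fintype.bijective_iff_injective_and_card χ).mpr
    ⟨hinjχ, le_antisymm (Fintype.card_le_of_injective χ hinjχ) hcard⟩
  obtain ⟨i, hi⟩ := hb.2 ψ
  exact ⟨i, hi.symm⟩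

end SplitRep

/-! ### Splittings at the geometric points of the centre -/

section Splittings

variable {F : Type u} [Field F] {Z : Type v} [CommRing Z] [Algebra F Z]
  {B : Type w} [Ring B] [Algebra Z B]

/-- Isomorphisms between endomorphism algebras are conjugations. This frees the reduced trace from
the choices in its definition. -/
theorem splitting_trace_eq {χ : Z →ₐ[F] AlgebraicClosure F} {n n' : ℕ}
    (φ : Splitting F B χ n) (φ' : Splitting F B χ n') (b : B) :
    LinearMap.trace (AlgebraicClosure F) _ (φ.rep b) =
      LinearMap.trace (AlgebraicClosure F) _ (φ'.rep b) := by
  let _ : Algebra Z (AlgebraicClosure F) := χ.toRingHom.toAlgebra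
  obtain ⟨T, hT⟩ := AlgEquiv.eq_linearEquivConjAlgEquiv (φ.toEquiv.symm.trans φ'.toEquiv)
  have h : φ'.rep b = T.conjAlgEquiv (AlgebraicClosure F) (φ.rep b) := by
    rw [← hT]
    change φ'.toEquiv _ = φ'.toEquiv (φ.toEquiv.symm (φ.toEquiv _))
    rw [AlgEquiv.symm_apply_apply]
  rw [h]
  exact (LinearMap.trace_conj' (φ.rep b) T).symm

variable [Algebra F B] [IsScalarTower F Z B] {I : Type*} {N : ℕ} [NeZero N]
  (e : AlgebraicClosure F ⊗[F] B ≃ₐ[AlgebraicClosure F]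
    (I → Matrix (Fin N) (Fin N) (AlgebraicClosure F)))
  {χ : I → Z →ₐ[F] AlgebraicClosure F}
  (hχ : ∀ i z, splitRep e (algebraMap Z B z) i = algebraMap (AlgebraicClosure F) _ (χ i z))
  (hZ : ∀ x : B, (∀ y, y * x = x * y) → ∃ z, algebraMap Z B z = x)

include hχ hZ in
theorem exists_splitting (i : I) : ∃ φ : Splitting F B (χ i) N,
    ∀ b, φ.rep b = Matrix.toLin' (splitRep e b i) := by
  classical
  let _ : Algebra Z (AlgebraicClosure F) := (χ i).toRingHom.toAlgebra
  have hal : ∀ z, algebraMap Z (AlgebraicClosure F) z = χ i z := fun _ => rfl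
  have : IsScalarTower F Z (AlgebraicClosure F) :=
    IsScalarTower.of_algebraMap_eq fun r => ((χ i).commutes r).symm
  let K := AlgebraicClosure F
  let ρi : B →ₐ[Z] Matrix (Fin N) (Fin N) K :=
    { toRingHom := (Pi.evalRingHom _ i).comp (splitRep e).toRingHom
      commutes' := fun z => by
        change splitRep e (algebraMap Z B z) i = _
        rw [hχ, ← hal]
        exact (IsScalarTower.algebraMap_apply Z K (Matrix (Fin N) (Fin N) K) z).symm }
  have hρi : ∀ b, ρi b = splitRep e b i := fun _ => rfl
  let f : K ⊗[Z] B →ₐ[K] Matrix (Fin N) (Fin N) K :=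
    Algebra.TensorProduct.lift (Algebra.ofId K _) ρi fun k b => (Algebra.commutes k (ρi b))
  have hf : ∀ b, f (1 ⊗ₜ b) = splitRep e b i := fun b => by
    refine (Algebra.TensorProduct.lift_tmul _ _ _ _ _).trans ?_
    rw [map_one, one_mul, hρi]
  let g : B →ₗ[F] K ⊗[Z] B :=
    (Algebra.TensorProduct.includeRight : B →ₐ[Z] K ⊗[Z] B).toLinearMap.restrictScalars F
  have hg : ∀ b, g b = 1 ⊗ₜ b := fun _ => rfl
  -- This is the projection of `K ⊗ B` over `F` to the tensor product over `Z`. Composed with `f` it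
  -- is evaluation at `i`. It sends a central tuple to its entry at `i`, so it kills the other
  -- factors, and `f` is injective.
  let L : (I → Matrix (Fin N) (Fin N) K) →ₗ[K] K ⊗[Z] B := (isBaseChange_splitRep e).lift g
  have hL : ∀ b, L (splitRep e b) = 1 ⊗ₜ b := fun b =>
    (isBaseChange_splitRep e).lift_eq g b
  have hfL : ∀ X, f (L X) = X i := by
    intro X
    refine splitRep_induction e (p := fun X => f (L X) = X i) X ?_ ?_ ?_
    · intro b
      rw [hL, hf]
    · intro x y hx hy
      rw [map_add, map_add, hx, hy, Pi.add_apply]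
    · intro k x hx
      rw [map_smul, map_smul, hx, Pi.smul_apply]
  have hmul : ∀ X Y, L (X * Y) = L X * L Y := by
    intro X Y
    refine splitRep_induction e (p := fun X => L (X * Y) = L X * L Y) X ?_ ?_ ?_
    · intro b
      refine splitRep_induction e (p := fun Y => L (splitRep e b * Y) = L (splitRep e b) * L Y)
        Y ?_ ?_ ?_
      · intro b'
        rw [← map_mul, hL, hL, hL, Algebra.TensorProduct.tmul_mul_tmul, one_mul]
      · intro x y hx hy
        rw [mul_add, map_add, hx, hy, map_add, mul_add]
      · intro k x hx
        rw [mul_smul_comm, map_smul, hx, map_smul, mul_smul_comm]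
    · intro x y hx hy
      rw [add_mul, map_add, hx, hy, map_add, add_mul]
    · intro k x hx
      rw [smul_mul_assoc, map_smul, hx, map_smul, smul_mul_assoc]
  let sc : (I → K) →ₗ[K] (I → Matrix (Fin N) (Fin N) K) :=
    LinearMap.pi fun i => Algebra.linearMap K _ ∘ₗ LinearMap.proj i
  have hsc : ∀ x j, sc x j = algebraMap K _ (x j) := fun _ _ => rfl
  have hLsc : ∀ x, L (sc x) = x i • (1 : K ⊗[Z] B) := by
    intro x
    have hx : x ∈ Submodule.span K (Set.range fun z i => χ i z) := by
      rw [span_characters e hχ hZ]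
      exact Submodule.mem_top
    induction hx using Submodule.span_induction with
    | mem x hx =>
      obtain ⟨z, rfl⟩ := hx
      have h1 : sc (fun i => χ i z) = splitRep e (algebraMap Z B z) := by
        funext j
        rw [hsc, hχ]
      change _ = χ i z • _
      rw [h1, hL, ← hal, algebraMap_smul, Algebra.TensorProduct.one_def, ← TensorProduct.tmul_smul,
        Algebra.algebraMap_eq_smul_one]
    | zero => simp
    | add x y _ _ hx hy => rw [map_add, map_add, hx, hy, Pi.add_apply, add_smul]
    | smul k x _ hx => rw [map_smul, map_smul, hx, Pi.smul_apply, smul_assoc]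
  have hLsurj : Function.Surjective L := by
    intro y
    induction y using TensorProduct.induction_on with
    | zero => exact ⟨0, map_zero _⟩
    | tmul k b =>
      refine ⟨k • splitRep e b, ?_⟩
      rw [map_smul, hL, TensorProduct.smul_tmul', smul_eq_mul, mul_one]
    | add x y hx hy =>
      obtain ⟨a, rfl⟩ := hx
      obtain ⟨b, rfl⟩ := hy
      exact ⟨a + b, map_add _ _ _⟩
  have hbij : Function.Bijective f := by
    constructor
    · rw [injective_iff_map_eq_zero]
      intro y hy
      obtain ⟨X, rfl⟩ := hLsurj y
      rw [hfL] at hy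
      have hX : X = sc (1 - Pi.single i 1) * X := by
        funext j
        rw [Pi.mul_apply, hsc]
        by_cases hj : j = i
        · subst hj
          rw [hy, mul_zero]
        · simp [hj]
      rw [hX, hmul, hLsc]
      simp
    · intro M
      exact ⟨L (Pi.single i M), by rw [hfL, Pi.single_eq_same]⟩
  exact ⟨⟨(AlgEquiv.ofBijective f hbij).trans Matrix.toLinAlgEquiv'⟩, fun b => by
    change Matrix.toLinAlgEquiv' (f (1 ⊗ₜ b)) = _
    rw [hf]
    rfl⟩

end Splittings

theorem trace_of_isBaseChange {F K X Xh : Type*} [Field F] [Field K] [Algebra F K]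
    [AddCommGroup X] [Module F X] [AddCommGroup Xh] [Module F Xh] [Module K Xh]
    [IsScalarTower F K Xh] [Module.Finite F X] {i : X →ₗ[F] Xh} (hi : IsBaseChange K i)
    (f : X →ₗ[F] X) (fh : Xh →ₗ[K] Xh) (h : ∀ x, fh (i x) = i (f x)) :
    LinearMap.trace K Xh fh = algebraMap F K (LinearMap.trace F X f) := by
  rw [← LinearMap.trace_baseChange, ← LinearMap.trace_conj' _ hi.equiv]
  congr 1
  refine hi.algHom_ext _ _ fun x => ?_
  rw [h, LinearEquiv.conj_apply_apply, IsBaseChange.equiv_symm_apply, LinearMap.baseChange_tmul,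
    IsBaseChange.equiv_tmul, one_smul]

/-! ### Adjoint involutions on products of matrix algebras -/

section Adjoint

variable {K I : Type*} [Field K] {N : ℕ}

/-- The adjoint involutions of the bilinear forms with Gram matrices `J i`. -/
noncomputable def adjointMap (J : I → Matrix (Fin N) (Fin N) K) :
    (I → Matrix (Fin N) (Fin N) K) →ₗ[K] (I → Matrix (Fin N) (Fin N) K) :=
  LinearMap.pi fun i => LinearMap.mulLeft K (J i)⁻¹ ∘ₗ LinearMap.mulRight K (J i) ∘ₗ
    (Matrix.transposeLinearEquiv (Fin N) (Fin N) K K).toLinearMap ∘ₗ LinearMap.proj i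

theorem adjointMap_apply (J : I → Matrix (Fin N) (Fin N) K) (X : I → Matrix (Fin N) (Fin N) K)
    (i : I) : adjointMap J X i = (J i)⁻¹ * ((X i).transpose * J i) := rfl

theorem adjointMap_eq_iff {J : I → Matrix (Fin N) (Fin N) K} (hJ : ∀ i, IsUnit (J i).det)
    (X Y : I → Matrix (Fin N) (Fin N) K) :
    adjointMap J X = Y ↔ ∀ i, J i * Y i = (X i).transpose * J i := by
  rw [funext_iff]
  refine forall_congr' fun i => ?_
  rw [adjointMap_apply]
  constructor
  · intro h
    rw [← h, Matrix.mul_nonsing_inv_cancel_left _ _ (hJ i)]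
  · intro h
    rw [← h, Matrix.nonsing_inv_mul_cancel_left _ _ (hJ i)]

/-- On one factor the map is `X ↦ Y J⁻¹ Xᵀ J`, whose diagonal coefficient at the matrix unit `(k,
l)` is `(Y J⁻¹)ₖₗ Jₖₗ`. The sum of these is `tr(Y J⁻¹ Jᵀ) = tr(Y)`. -/
theorem trace_mul_adjointMap [Fintype I] [DecidableEq I] {J : I → Matrix (Fin N) (Fin N) K}
    (hJ : ∀ i, IsUnit (J i).det) (hs : ∀ i, (J i).transpose = J i)
    (Y : I → Matrix (Fin N) (Fin N) K) :
    LinearMap.trace K _ (LinearMap.mulLeft K Y ∘ₗ adjointMap J) = ∑ i, (Y i).trace := by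
  classical
  let b := Pi.basis fun _ : I => Matrix.stdBasis K (Fin N) (Fin N)
  have hb : ∀ p, b p = Pi.single p.1 (Matrix.single p.2.1 p.2.2 1) := by
    intro p
    rw [Pi.basis_apply, Matrix.stdBasis_eq_single]
  have hr : ∀ X p, b.repr X p = X p.1 p.2.1 p.2.2 := by
    intro X p
    rw [Pi.basis_repr]
    have h := Matrix.stdBasis_eq_single (R := K) (m := Fin N) (n := Fin N)
    have : X p.1 = ∑ i, ∑ j, X p.1 i j • Matrix.stdBasis K (Fin N) (Fin N) (i, j) := by
      conv_lhs => rw [Matrix.matrix_eq_sum_single (X p.1)]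
      simp [h, Matrix.smul_single]
    conv_lhs => rw [this]
    simp [Finsupp.single_apply, Prod.ext_iff, ite_and]
  rw [LinearMap.trace_eq_matrix_trace K b, Matrix.trace, Fintype.sum_sigma]
  refine Finset.sum_congr rfl fun i _ => ?_
  have hY : (Y i).trace = ∑ p : Fin N × Fin N, (Y i * (J i)⁻¹) p.1 p.2 * (J i) p.1 p.2 := by
    conv_lhs => rw [← Matrix.nonsing_inv_mul_cancel_right (J i) (Y i) (hJ i)]
    rw [Fintype.sum_prod_type, Matrix.trace]
    refine Finset.sum_congr rfl fun k _ => ?_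
    rw [Matrix.diag_apply, Matrix.mul_apply]
    refine Finset.sum_congr rfl fun l _ => ?_
    rw [← Matrix.transpose_apply (J i) k l, hs]
  rw [hY]
  refine Finset.sum_congr rfl fun p _ => ?_
  rw [Matrix.diag_apply, LinearMap.toMatrix_apply, hr, LinearMap.comp_apply,
    LinearMap.mulLeft_apply, Pi.mul_apply, adjointMap_apply, hb, Pi.single_eq_same,
    ← Matrix.mul_assoc, Matrix.transpose_single, Matrix.mul_apply, Finset.sum_eq_single p.2]
  · simp [Matrix.mul_apply, Matrix.single_apply]
  · intro x _ hx
    simp [Matrix.mul_apply, Ne.symm hx]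
  · simp

/-- Multiplication by `J i` turns fixed points of the involution into matrices with the same
symmetry as `J i`. -/
theorem finrank_ker_adjointMap_sub_one [Fintype I] {J : I → Matrix (Fin N) (Fin N) K}
    (hJ : ∀ i, IsUnit (J i).det) {d : K} (hd : d * d = 1)
    (hs : ∀ i, (J i).transpose = d • J i) :
    Module.finrank K (LinearMap.ker (adjointMap J - LinearMap.id)) =
      Fintype.card I * Module.finrank K (symMatrix K N d) := by
  have hmem : ∀ X, X ∈ LinearMap.ker (adjointMap J - LinearMap.id) ↔
      ∀ i, J i * X i ∈ symMatrix K N d := by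
    intro X
    rw [LinearMap.mem_ker, LinearMap.sub_apply, sub_eq_zero, LinearMap.id_apply,
      adjointMap_eq_iff hJ]
    refine forall_congr' fun i => ?_
    rw [mem_symMatrix, Matrix.transpose_mul, hs, Matrix.mul_smul]
    constructor
    · intro h
      rw [h]
    · intro h
      have := congrArg (d • ·) h
      simpa only [smul_smul, hd, one_smul] using this.symm
  let E : LinearMap.ker (adjointMap J - LinearMap.id) ≃ₗ[K] (I → symMatrix K N d) :=
    { toFun := fun X i => ⟨J i * X.1 i, (hmem X.1).mp X.2 i⟩
      map_add' := fun X Y => by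
        funext i
        exact Subtype.ext (Matrix.mul_add _ _ _)
      map_smul' := fun k X => by
        funext i
        exact Subtype.ext (Matrix.mul_smul (J i) k (X.1 i))
      invFun := fun Y => ⟨fun i => (J i)⁻¹ * (Y i).1, (hmem _).mpr fun i => by
        rw [Matrix.mul_nonsing_inv_cancel_left _ _ (hJ i)]
        exact (Y i).2⟩
      left_inv := fun X => by
        refine Subtype.ext (funext fun i => ?_)
        exact Matrix.nonsing_inv_mul_cancel_left _ _ (hJ i)
      right_inv := fun Y => by
        funext i
        exact Subtype.ext (Matrix.mul_nonsing_inv_cancel_left _ _ (hJ i)) }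
  rw [E.finrank_eq, Module.finrank_pi_fintype]
  simp

end Adjoint

/-! ### Descent of the reduced trace to the centre -/

section Involution

variable {F K B I : Type*} [Field F] [Field K] [Algebra F K] [Ring B] [Algebra F B]
  {N : ℕ} (e : K ⊗[F] B ≃ₐ[K] (I → Matrix (Fin N) (Fin N) K))
  {σ : AlgInvolution F B} {J : I → Matrix (Fin N) (Fin N) K} (hJ : ∀ i, IsUnit (J i).det)
  (hadj : ∀ i b, J i * splitRep e (σ b) i = (splitRep e b i).transpose * J i)

include hJ hadj

theorem adjointMap_splitRep (b : B) :
    adjointMap J (splitRep e b) = splitRep e (σ b) :=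
  (adjointMap_eq_iff hJ _ _).mpr fun i => hadj i b

theorem span_splitRep_sym : Submodule.span K (splitRep e '' (σ.sym : Set B)) =
    LinearMap.ker (adjointMap J - LinearMap.id) := by
  apply le_antisymm
  · rw [Submodule.span_le]
    rintro _ ⟨s, hs, rfl⟩
    have hs' : σ s = s := hs
    rw [SetLike.mem_coe, LinearMap.mem_ker, LinearMap.sub_apply, adjointMap_splitRep e hJ hadj,
      hs', LinearMap.id_apply, sub_self]
  · intro x hx
    have h := mem_span_of_forall_eq_zero (isBaseChange_splitRep e) (isBaseChange_splitRep e)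
      (T := Unit) (fun _ => σ.toLin - LinearMap.id) (fun _ => adjointMap J - LinearMap.id)
      (fun _ b => by
        change adjointMap J (splitRep e b) - splitRep e b = splitRep e (σ b - b)
        rw [map_sub, adjointMap_splitRep e hJ hadj]) (x := x) (fun _ => hx)
    refine Submodule.span_mono ?_ h
    rintro _ ⟨b, hb, rfl⟩
    exact ⟨b, sub_eq_zero.mp (hb ()), rfl⟩

theorem finrank_sym [Fintype I] {d : K} (hd : d * d = 1)
    (hs : ∀ i, (J i).transpose = d • J i) :
    Module.finrank F σ.sym = Fintype.card I * Module.finrank K (symMatrix K N d) := by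
  rw [← finrank_ker_adjointMap_sub_one hJ hd hs, ← span_splitRep_sym e hJ hadj]
  exact (finrank_span_image_of_isBaseChange (isBaseChange_splitRep e) σ.sym).symm

/-- The trace of left multiplication by `b` is `N` times this sum and may vanish in positive
characteristic. Composition with the involution removes the factor `N`, so that the sum of the
traces is seen to lie in `F`. -/
theorem trace_mul_involution [Fintype I] (hs : ∀ i, (J i).transpose = J i) (b : B) :
    algebraMap F K (LinearMap.trace F B (LinearMap.mulLeft F b ∘ₗ σ.toLin)) =
      ∑ i, (splitRep e b i).trace := by
  classical
  have := finite_splitRep e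
  rw [← trace_mul_adjointMap hJ hs]
  refine (trace_of_isBaseChange (isBaseChange_splitRep e) _ _ fun x => ?_).symm
  change splitRep e b * adjointMap J (splitRep e x) = splitRep e (b * σ x)
  rw [adjointMap_splitRep e hJ hadj, map_mul]

theorem trace_splitRep_involution (b : B) (i : I) :
    (splitRep e (σ b) i).trace = (splitRep e b i).trace := by
  rw [← adjointMap_splitRep e hJ hadj, adjointMap_apply, Matrix.trace_mul_comm, Matrix.mul_assoc,
    Matrix.mul_nonsing_inv _ (hJ i), Matrix.mul_one, Matrix.trace_transpose]

variable {Z : Type*} [CommRing Z] [Algebra F Z] [Algebra Z B] [IsScalarTower F Z B]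
  {χ : I → Z →ₐ[F] K}
  (hχ : ∀ i z, splitRep e (algebraMap Z B z) i = algebraMap K _ (χ i z))

include hχ

omit [IsScalarTower F Z B] in
theorem involution_smul (z : Z) (b : B) : σ (z • b) = z • σ b := by
  apply splitRep_injective e
  rw [← adjointMap_splitRep e hJ hadj, adjointMap_eq_iff hJ]
  intro i
  rw [splitRep_smul e hχ, splitRep_smul e hχ, Matrix.mul_smul, hadj, Matrix.transpose_smul,
    Matrix.smul_mul]

variable (hZ : ∀ x : B, (∀ y, y * x = x * y) → ∃ z, algebraMap Z B z = x)
  (hinj : Function.Injective (algebraMap Z B))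

include hZ hinj

omit hJ hadj in
theorem trace_center [Fintype I] [NeZero N] (z : Z) :
    algebraMap F K (Algebra.trace F Z z) = ∑ i, χ i z := by
  classical
  have := finite_center e hinj
  rw [Algebra.trace_apply]
  rw [← trace_of_isBaseChange (isBaseChange_characters e hχ hZ hinj) _
    (LinearMap.mulLeft K (fun i => χ i z)) (fun x => by funext i; simp),
    LinearMap.trace_eq_matrix_trace K (Pi.basisFun K I), Matrix.trace]
  refine Finset.sum_congr rfl fun i _ => ?_
  simp

/-- The form `z ↦ ∑ χᵢ(z) trᵢ(b)` takes values in `F`. As the trace form of `Z` is nondegenerate, it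
is `z ↦ Tr(z w)` for some `w` in `Z`, and comparison of coefficients gives `χᵢ(w) = trᵢ(b)`. -/
theorem exists_center_trace [Fintype I] [NeZero N] (hs : ∀ i, (J i).transpose = J i) (b : B) :
    ∃ w : Z, ∀ i, χ i w = (splitRep e b i).trace := by
  have := finite_center e hinj
  let trF : B →ₗ[F] F := LinearMap.trace F B ∘ₗ ((LinearMap.mul F B).compl₂ σ.toLin)
  have htrF : ∀ b, algebraMap F K (trF b) = ∑ i, (splitRep e b i).trace := fun b =>
    trace_mul_involution e hJ hadj hs b
  let lam : Z →ₗ[F] F := trF ∘ₗ (LinearMap.toSpanSingleton Z B b).restrictScalars F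
  have hlam : ∀ z, algebraMap F K (lam z) = ∑ i, χ i z * (splitRep e b i).trace := by
    intro z
    refine (htrF (z • b)).trans (Finset.sum_congr rfl fun i _ => ?_)
    rw [splitRep_smul e hχ, Matrix.trace_smul, smul_eq_mul]
  have hT : ∀ z w, algebraMap F K (Algebra.traceForm F Z w z) = ∑ i, χ i z * χ i w := by
    intro z w
    rw [Algebra.traceForm_apply, trace_center e hχ hZ hinj]
    refine Finset.sum_congr rfl fun i _ => ?_
    rw [map_mul, mul_comm]
  -- The characters span `K^I`. This serves twice: for the nondegeneracy of the trace form and for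
  -- the comparison of coefficients.
  have key : ∀ c : I → K, (∀ z, ∑ i, χ i z * c i = 0) → c = 0 := by
    classical
    intro c hc
    let L : (I → K) →ₗ[K] K := ∑ i, c i • LinearMap.proj i
    have hL : ∀ x, L x = ∑ i, x i * c i := by
      intro x
      simp [L, mul_comm]
    have h0 : Submodule.span K (Set.range fun z i => χ i z) ≤ LinearMap.ker L := by
      rw [Submodule.span_le]
      rintro _ ⟨z, rfl⟩
      rw [SetLike.mem_coe, LinearMap.mem_ker, hL]
      exact hc z
    rw [span_characters e hχ hZ] at h0
    funext i
    have h1 := h0 (x := Pi.single i 1) Submodule.mem_top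
    rw [LinearMap.mem_ker, hL] at h1
    simpa [Pi.single_apply] using h1
  have hTinj : Function.Injective (Algebra.traceForm F Z) := by
    rw [injective_iff_map_eq_zero]
    intro w hw
    refine characters_separate e hχ hinj fun i => ?_
    rw [map_zero]
    refine congrFun (key (fun i => χ i w) fun z => ?_) i
    rw [← hT, hw]
    simp
  have hTsurj : Function.Surjective (Algebra.traceForm F Z) :=
    (LinearMap.injective_iff_surjective_of_finrank_eq_finrank
      (Subspace.dual_finrank_eq (K := F) (V := Z)).symm).mp hTinj
  obtain ⟨w, hw⟩ := hTsurj lam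
  refine ⟨w, fun i => ?_⟩
  rw [← sub_eq_zero]
  refine congrFun (key (fun i => χ i w - (splitRep e b i).trace) fun z => ?_) i
  have h1 := hT z w
  rw [hw, hlam] at h1
  simp only [mul_sub, Finset.sum_sub_distrib, ← h1, sub_self]

theorem exists_center_trace_linear [Fintype I] [NeZero N] (hs : ∀ i, (J i).transpose = J i) :
    ∃ t : B →ₗ[Z] Z, ∀ i b, χ i (t b) = (splitRep e b i).trace := by
  choose w hw using exists_center_trace e hJ hadj hχ hZ hinj hs
  refine ⟨⟨⟨w, fun b b' => ?_⟩, fun z b => ?_⟩, fun i b => hw b i⟩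
  · refine characters_separate e hχ hinj fun i => ?_
    rw [map_add, hw, hw, hw, map_add, Pi.add_apply, Matrix.trace_add]
  · refine characters_separate e hχ hinj fun i => ?_
    rw [RingHom.id_apply, smul_eq_mul, map_mul, hw, hw, splitRep_smul e hχ, Matrix.trace_smul,
      smul_eq_mul]

end Involution

/-! ### Type of the involution over the centre, and its semi-traces -/

section CenterInvolution

variable {F : Type u} [Field F] {Z : Type v} [CommRing Z] [Algebra F Z]
  {B : Type w} [Ring B] [Algebra Z B] [Algebra F B] [IsScalarTower F Z B]
  {I : Type*} [Fintype I] {N : ℕ} [NeZero N]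
  (e : AlgebraicClosure F ⊗[F] B ≃ₐ[AlgebraicClosure F]
    (I → Matrix (Fin N) (Fin N) (AlgebraicClosure F)))
  {σ : AlgInvolution F B} {J : I → Matrix (Fin N) (Fin N) (AlgebraicClosure F)}
  (hJ : ∀ i, IsUnit (J i).det)
  (hadj : ∀ i b, J i * splitRep e (σ b) i = (splitRep e b i).transpose * J i)
  (hs : ∀ i, (J i).transpose = J i)
  {χ : I → Z →ₐ[F] AlgebraicClosure F}
  (hχ : ∀ i z, splitRep e (algebraMap Z B z) i = algebraMap (AlgebraicClosure F) _ (χ i z))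
  (hZ : ∀ x : B, (∀ y, y * x = x * y) → ∃ z, algebraMap Z B z = x)
  (hinj : Function.Injective (algebraMap Z B))

include hJ hadj hs hχ hZ hinj

/-- The map to the centre just descended shows that a reduced trace exists. Whichever one the
definition picks has the same values at each `χ i`, since these do not depend on the splitting. -/
theorem reducedTrace_spec : IsReducedTrace F Z B (reducedTrace F Z B) ∧
    ∀ i b, χ i (reducedTrace F Z B b) = (splitRep e b i).trace := by
  obtain ⟨t, ht⟩ := exists_center_trace_linear e hJ hadj hχ hZ hinj hs
  have hφ : ∀ i, ∃ φ : Splitting F B (χ i) N, ∀ b,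
      LinearMap.trace (AlgebraicClosure F) _ (φ.rep b) = (splitRep e b i).trace := by
    intro i
    obtain ⟨φ, hφ⟩ := exists_splitting e hχ hZ i
    exact ⟨φ, fun b => by rw [hφ, Matrix.trace_toLin'_eq]⟩
  have hex : ∃ t : B →ₗ[Z] Z, IsReducedTrace F Z B t := by
    refine ⟨t, fun ψ => ?_⟩
    obtain ⟨i, rfl⟩ := exists_eq_character e hχ hZ hinj ψ
    obtain ⟨φ, hφ⟩ := hφ i
    exact ⟨N, φ, fun b => by rw [ht, hφ]⟩
  have hred : IsReducedTrace F Z B (reducedTrace F Z B) := by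
    rw [reducedTrace, dif_pos hex]
    exact hex.choose_spec
  refine ⟨hred, fun i b => ?_⟩
  obtain ⟨n, φ', hφ'⟩ := hred (χ i)
  obtain ⟨φ, hφ⟩ := hφ i
  rw [hφ', ← hφ, splitting_trace_eq φ' φ]

omit hs hZ hinj [Fintype I] [NeZero N] [IsScalarTower F Z B] in
theorem exists_centerInvolution : ∃ τ : AlgInvolution Z B, ∀ x, τ x = σ x :=
  ⟨{ toLin :=
      { toFun := σ
        map_add' := map_add σ.toLin
        map_smul' := involution_smul e hJ hadj hχ }
     map_mul := σ.map_mul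
     involutive := σ.involutive }, fun _ => rfl⟩

variable {τ : AlgInvolution Z B} (hτ : ∀ x, τ x = σ x)
include hτ

omit hJ hs hχ hZ hinj [Fintype I] [NeZero N] [IsScalarTower F Z B] in
theorem toBilin_adjoint {i : I} {φ : Splitting F B (χ i) N}
    (hφ : ∀ b, φ.rep b = Matrix.toLin' (splitRep e b i)) (x : B)
    (v w : Fin N → AlgebraicClosure F) :
    Matrix.toBilin' (J i) (φ.rep x v) w = Matrix.toBilin' (J i) v (φ.rep (τ x) w) := by
  rw [hφ, hφ, Matrix.toBilin'_apply', Matrix.toBilin'_apply', Matrix.toLin'_apply,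
    Matrix.toLin'_apply, Matrix.mulVec_mulVec, hτ, hadj, ← Matrix.mulVec_mulVec,
    Matrix.dotProduct_mulVec _ (splitRep e x i).transpose, Matrix.vecMul_transpose]

/-- Writing `v = y v + σ(y) v` gives `b(v, v) = b(v, y v) + b(y v, v) = 2 b(v, y v) = 0`. -/
theorem isSymplectic_of_char_two (h2 : (2 : AlgebraicClosure F) = 0) {y : B}
    (hy : y + σ y = 1) : τ.IsSymplectic F := by
  intro ψ
  obtain ⟨i, rfl⟩ := exists_eq_character e hχ hZ hinj ψ
  obtain ⟨φ, hφ⟩ := exists_splitting e hχ hZ i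
  have hadj' := toBilin_adjoint e hadj hτ hφ
  refine ⟨N, φ, Matrix.toBilin' (J i),
    LinearMap.BilinForm.nondegenerate_toBilin'_of_det_ne_zero' _ (hJ i).ne_zero, ?_, hadj'⟩
  intro v
  have hsym : ∀ v w, Matrix.toBilin' (J i) v w = Matrix.toBilin' (J i) w v := by
    intro v w
    rw [Matrix.toBilin'_apply', Matrix.toBilin'_apply', Matrix.dotProduct_mulVec,
      ← Matrix.mulVec_transpose, hs, dotProduct_comm]
  have h1 : φ.rep y v + φ.rep (τ y) v = v := by
    rw [hφ, hφ, ← LinearMap.add_apply, ← map_add, ← Pi.add_apply, ← map_add, hτ, hy]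
    simp
  have h3 : Matrix.toBilin' (J i) v v =
      Matrix.toBilin' (J i) v (φ.rep y v) + Matrix.toBilin' (J i) v (φ.rep (τ y) v) := by
    rw [← map_add, h1]
  rw [h3, ← hadj', hsym v, ← two_mul, h2, zero_mul]

theorem isOrthogonal_of_char_ne_two (h2 : (2 : AlgebraicClosure F) ≠ 0) :
    τ.IsOrthogonal F := by
  intro ψ
  obtain ⟨i, rfl⟩ := exists_eq_character e hχ hZ hinj ψ
  obtain ⟨φ, hφ⟩ := exists_splitting e hχ hZ i
  have hsym : ∀ v w, Matrix.toBilin' (J i) v w = Matrix.toBilin' (J i) w v := by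
    intro v w
    rw [Matrix.toBilin'_apply', Matrix.toBilin'_apply', Matrix.dotProduct_mulVec,
      ← Matrix.mulVec_transpose, hs, dotProduct_comm]
  refine ⟨N, φ, Matrix.toBilin' (J i),
    LinearMap.BilinForm.nondegenerate_toBilin'_of_det_ne_zero' _ (hJ i).ne_zero, ⟨hsym⟩, ?_,
    toBilin_adjoint e hadj hτ hφ⟩
  intro halt
  have h0 : Matrix.toBilin' (J i) = 0 := by
    refine LinearMap.ext fun v => LinearMap.ext fun w => ?_
    have h1 := halt (v + w)
    rw [map_add, map_add, LinearMap.add_apply, LinearMap.add_apply, halt v, halt w, hsym w v,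
      zero_add, add_zero, ← two_mul] at h1
    exact (mul_eq_zero.mp h1).resolve_left h2
  have h3 : J i = 0 := by
    rw [← map_zero Matrix.toBilin'] at h0
    exact Matrix.toBilin'.injective h0
  have h4 := (hJ i).ne_zero
  rw [h3, Matrix.det_zero] at h4
  exact h4 rfl

omit hχ hZ hinj [NeZero N] in
theorem finrank_centerInvolution_sym :
    Module.finrank F τ.sym = Fintype.card I * (N * (N + 1) / 2) := by
  let E : τ.sym ≃ₗ[F] σ.sym :=
    { toFun := fun x => ⟨x.1, by rw [AlgInvolution.mem_sym, ← hτ]; exact x.2⟩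
      map_add' := fun _ _ => rfl
      map_smul' := fun _ _ => rfl
      invFun := fun x => ⟨x.1, by rw [AlgInvolution.mem_sym, hτ]; exact x.2⟩
      left_inv := fun _ => rfl
      right_inv := fun _ => rfl }
  rw [E.finrank_eq, finrank_sym e hJ hadj (d := 1) (one_mul 1) (fun i => by rw [hs, one_smul]),
    finrank_symMatrix_one]

/-- The reduced trace is invariant under `σ`, so `Trd(c σ(x)) = Trd(x σ(c)) = Trd(σ(c) x)`. Hence
`Trd(c (x + σ(x))) = Trd((c + σ(c)) x)`. -/
theorem isSemitrace_traceForm {c : B} (hc : c + σ c = 1) :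
    τ.IsSemitrace F (τ.traceForm F c) := by
  intro x
  change reducedTrace F Z B (c * (x + τ x)) = reducedTrace F Z B x
  have hT := (reducedTrace_spec e hJ hadj hs hχ hZ hinj).2
  refine characters_separate e hχ hinj fun i => ?_
  have hσ : σ (c * τ x) = x * σ c := by rw [hτ, σ.map_mul, σ.involutive]
  have h1 : (splitRep e (c * τ x) i).trace = (splitRep e (σ c * x) i).trace := by
    rw [← trace_splitRep_involution e hJ hadj, hσ, map_mul, Pi.mul_apply, Matrix.trace_mul_comm,
      ← Pi.mul_apply, ← map_mul]
  rw [mul_add, map_add, map_add, hT, hT, hT, h1, ← Matrix.trace_add, ← Pi.add_apply, ← map_add,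
    ← add_mul, hc, one_mul]

end CenterInvolution

/-! ### Hyperbolic planes in quadratic spaces -/

section Hyperbolic

variable {K V : Type*} [Field K] [AddCommGroup V] [Module K V]

/-- On a line `u + t w` with `q(w) ≠ 0` the form is a quadratic polynomial in `t`, which has a root.
The line avoids zero if `u` is not a multiple of `w`. -/
theorem exists_isotropic [IsAlgClosed K] [FiniteDimensional K V] (q : QuadraticForm K V)
    (hdim : 2 ≤ Module.finrank K V) : ∃ e : V, e ≠ 0 ∧ q e = 0 := by
  obtain ⟨w, hw⟩ : ∃ w : V, w ≠ 0 := by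
    have : Nontrivial V := Module.nontrivial_of_finrank_pos (R := K) (by omega)
    exact exists_ne 0
  by_cases hqw : q w = 0
  · exact ⟨w, hw, hqw⟩
  obtain ⟨u, hu⟩ : ∃ u : V, u ∉ Submodule.span K {w} := by
    by_contra! h
    have h1 : Submodule.span K {w} = ⊤ := eq_top_iff.mpr fun x _ => h x
    have h2 := finrank_span_singleton (K := K) hw
    rw [h1, finrank_top] at h2
    omega
  obtain ⟨t, ht⟩ := IsAlgClosed.exists_root
    (Polynomial.C (q w) * Polynomial.X ^ 2 + Polynomial.C (QuadraticMap.polar q u w) *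
      Polynomial.X + Polynomial.C (q u)) (by
      rw [Polynomial.degree_quadratic hqw]
      decide)
  refine ⟨u + t • w, ?_, ?_⟩
  · intro h0
    apply hu
    rw [add_eq_zero_iff_eq_neg, ← neg_smul] at h0
    rw [h0]
    exact Submodule.smul_mem _ _ (Submodule.mem_span_singleton_self w)
  · rw [QuadraticMap.map_add q, QuadraticMap.map_smul, QuadraticMap.polar_smul_right]
    simp only [Polynomial.IsRoot.def, Polynomial.eval_add, Polynomial.eval_mul, Polynomial.eval_C,
      Polynomial.eval_pow, Polynomial.eval_X] at ht
    rw [← ht]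
    simp only [smul_eq_mul]
    ring

theorem exists_hyperbolic_pair [IsAlgClosed K] [FiniteDimensional K V] (q : QuadraticForm K V)
    (hq : ∀ v, (∀ w, QuadraticMap.polar q v w = 0) → v = 0)
    (hdim : 2 ≤ Module.finrank K V) :
    ∃ e f : V, q e = 0 ∧ q f = 0 ∧ QuadraticMap.polar q e f = 1 := by
  obtain ⟨e, he, hqe⟩ := exists_isotropic q hdim
  obtain ⟨f, hf⟩ : ∃ f, QuadraticMap.polar q e f ≠ 0 := by
    by_contra! h
    exact he (hq e h)
  obtain ⟨g, hg⟩ : ∃ g, QuadraticMap.polar q e g = 1 := by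
    refine ⟨(QuadraticMap.polar q e f)⁻¹ • f, ?_⟩
    rw [QuadraticMap.polar_smul_right, smul_eq_mul, inv_mul_cancel₀ hf]
  have hee : QuadraticMap.polar q e e = 0 := by
    rw [QuadraticMap.polar_self, hqe, smul_zero]
  -- The multiple of `e` makes the second vector isotropic and leaves its product with `e`
  -- unchanged.
  refine ⟨e, g + (-(q g)) • e, hqe, ?_, ?_⟩
  · rw [QuadraticMap.map_add q, QuadraticMap.map_smul, hqe, QuadraticMap.polar_smul_right,
      QuadraticMap.polar_comm, hg]
    simp
  · rw [QuadraticMap.polar_add_right, QuadraticMap.polar_smul_right _ _ e e, hg, hee]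
    simp

/-- The orthogonal complement of a hyperbolic plane. -/
def planeComplement (q : QuadraticForm K V) (e f : V) : Submodule K V :=
  LinearMap.ker (q.polarBilin e) ⊓ LinearMap.ker (q.polarBilin f)

theorem mem_planeComplement {q : QuadraticForm K V} {e f v : V} :
    v ∈ planeComplement q e f ↔ QuadraticMap.polar q e v = 0 ∧ QuadraticMap.polar q f v = 0 :=
  Iff.rfl

variable {q : QuadraticForm K V} {e f : V} (he : q e = 0) (hf : q f = 0)
  (hef : QuadraticMap.polar q e f = 1)

include he hf hef

theorem sub_mem_planeComplement (v : V) :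
    v - QuadraticMap.polar q f v • e - QuadraticMap.polar q e v • f ∈ planeComplement q e f := by
  have hee : QuadraticMap.polar q e e = 0 := by
    rw [QuadraticMap.polar_self, he, smul_zero]
  have hff : QuadraticMap.polar q f f = 0 := by
    rw [QuadraticMap.polar_self, hf, smul_zero]
  have hfe : QuadraticMap.polar q f e = 1 := by rw [QuadraticMap.polar_comm, hef]
  rw [mem_planeComplement]
  simp only [QuadraticMap.polar_sub_right, QuadraticMap.polar_smul_right, hee, hff, hef, hfe,
    smul_eq_mul]
  constructor <;> ring

/-- The splitting of a quadratic space by a hyperbolic plane. -/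
noncomputable def planeEquiv : V ≃ₗ[K] planeComplement q e f × (K × K) where
  toFun v := (⟨_, sub_mem_planeComplement he hf hef v⟩,
    (QuadraticMap.polar q e v, QuadraticMap.polar q f v))
  map_add' v w := by
    refine Prod.ext (Subtype.ext ?_) (Prod.ext ?_ ?_)
    · simp only [QuadraticMap.polar_add_right, add_smul, Submodule.coe_add, Prod.fst_add]
      abel
    · exact QuadraticMap.polar_add_right _ _ _ _
    · exact QuadraticMap.polar_add_right _ _ _ _
  map_smul' c v := by
    refine Prod.ext (Subtype.ext ?_) (Prod.ext ?_ ?_)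
    · simp only [QuadraticMap.polar_smul_right, smul_sub, smul_eq_mul, mul_smul,
        RingHom.id_apply, Prod.smul_fst, Submodule.coe_smul]
    · exact QuadraticMap.polar_smul_right _ _ _ _
    · exact QuadraticMap.polar_smul_right _ _ _ _
  invFun p := p.1 + p.2.2 • e + p.2.1 • f
  left_inv v := by
    simp only
    abel
  right_inv p := by
    have hee : QuadraticMap.polar q e e = 0 := by
      rw [QuadraticMap.polar_self, he, smul_zero]
    have hff : QuadraticMap.polar q f f = 0 := by
      rw [QuadraticMap.polar_self, hf, smul_zero]
    have hfe : QuadraticMap.polar q f e = 1 := by rw [QuadraticMap.polar_comm, hef]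
    obtain ⟨⟨v, hv⟩, a, d⟩ := p
    have h1 : QuadraticMap.polar q e (v + d • e + a • f) = a := by
      simp only [QuadraticMap.polar_add_right, QuadraticMap.polar_smul_right, hee, hef,
        (mem_planeComplement.mp hv).1, smul_eq_mul]
      ring
    have h2 : QuadraticMap.polar q f (v + d • e + a • f) = d := by
      simp only [QuadraticMap.polar_add_right, QuadraticMap.polar_smul_right, hff, hfe,
        (mem_planeComplement.mp hv).2, smul_eq_mul]
      ring
    refine Prod.ext (Subtype.ext ?_) (Prod.ext h1 h2)
    simp only [h1, h2]
    abel

theorem map_eq_planeComplement (v : V) :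
    q v = q ((planeEquiv he hf hef v).1 : V) +
      QuadraticMap.polar q e v * QuadraticMap.polar q f v := by
  set v' := (planeEquiv he hf hef v).1 with hv'
  have hv : v = (v' : V) + (QuadraticMap.polar q f v • e + QuadraticMap.polar q e v • f) := by
    rw [← add_assoc]
    exact ((planeEquiv he hf hef).symm_apply_apply v).symm
  have h1 := mem_planeComplement.mp v'.2
  conv_lhs => rw [hv]
  rw [QuadraticMap.map_add q, QuadraticMap.map_add q (_ • e), QuadraticMap.map_smul,
    QuadraticMap.map_smul, he, hf, QuadraticMap.polar_add_right, QuadraticMap.polar_smul_right,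
    QuadraticMap.polar_smul_right, QuadraticMap.polar_smul_right, QuadraticMap.polar_smul_left,
    hef, QuadraticMap.polar_comm q v' e, QuadraticMap.polar_comm q v' f, h1.1, h1.2]
  simp only [smul_eq_mul]
  ring

theorem nondegenerate_planeComplement
    (hq : ∀ v, (∀ w, QuadraticMap.polar q v w = 0) → v = 0) (v : planeComplement q e f)
    (hv : ∀ w, QuadraticMap.polar (q.comp (planeComplement q e f).subtype) v w = 0) : v = 0 := by
  apply Subtype.ext
  refine hq v fun w => ?_
  have hw : w = ((planeEquiv he hf hef w).1 : V) +
      (QuadraticMap.polar q f w • e + QuadraticMap.polar q e w • f) := by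
    rw [← add_assoc]
    exact ((planeEquiv he hf hef).symm_apply_apply w).symm
  have h1 := mem_planeComplement.mp v.2
  have h2 : QuadraticMap.polar q v (planeEquiv he hf hef w).1 = 0 := hv _
  rw [hw, QuadraticMap.polar_add_right, h2, QuadraticMap.polar_add_right,
    QuadraticMap.polar_smul_right, QuadraticMap.polar_smul_right, QuadraticMap.polar_comm q v e,
    QuadraticMap.polar_comm q v f, h1.1, h1.2]
  simp

end Hyperbolic

/-! ### Half-spin modules and their invariant forms -/

section Spin

variable {K V ι : Type*} [Field K] [AddCommGroup V] [Module K V] [Fintype ι] [DecidableEq ι]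

/-- The two half-spin modules of a quadratic space of dimension `2 * k`: a vector acts by `sp` from
the even to the odd module and by `sm` in the other direction. The matrices `J` and `J'` are the
Gram matrices of the invariant bilinear forms, which pair each module with itself if `k` is even
and the two modules with one another if `k` is odd. -/
structure IsSpinRep (q : QuadraticForm K V) (k : ℕ) (sp sm : V →ₗ[K] Matrix ι ι K)
    (J J' : Matrix ι ι K) : Prop where
  sm_mul_sp : ∀ v, sm v * sp v = q v • (1 : Matrix ι ι K)
  sp_mul_sm : ∀ v, sp v * sm v = q v • (1 : Matrix ι ι K)
  adjoin_eq_top : Algebra.adjoin K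
    (Set.range fun p : V × V => (sm p.1 * sp p.2, sp p.1 * sm p.2)) = ⊤
  isUnit_left : IsUnit J
  isUnit_right : IsUnit J'
  even : Even k → (∀ v, J * sm v = (sp v).transpose * J') ∧
    (∀ v, J' * sp v = (sm v).transpose * J) ∧
    J.transpose = (-1 : K) ^ (k * (k + 1) / 2) • J ∧
    J'.transpose = (-1 : K) ^ (k * (k + 1) / 2) • J'
  odd : ¬ Even k → (∀ v, J * sm v = -((sm v).transpose * J')) ∧
    (∀ v, J' * sp v = -((sp v).transpose * J)) ∧
    J.transpose = (-1 : K) ^ (k * (k + 1) / 2) • J' ∧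
    J'.transpose = (-1 : K) ^ (k * (k + 1) / 2) • J

theorem IsSpinRep.reindex {κ : Type*} [Fintype κ] [DecidableEq κ] (ε : ι ≃ κ)
    {q : QuadraticForm K V} {k : ℕ} {sp sm : V →ₗ[K] Matrix ι ι K} {J J' : Matrix ι ι K}
    (h : IsSpinRep q k sp sm J J') :
    ∃ (sp sm : V →ₗ[K] Matrix κ κ K) (J J' : Matrix κ κ K), IsSpinRep q k sp sm J J' := by
  let E := Matrix.reindexAlgEquiv K K ε
  have hT : ∀ M, (E M).transpose = E M.transpose := fun _ => rfl
  refine ⟨E.toLinearMap ∘ₗ sp, E.toLinearMap ∘ₗ sm, E J, E J', ?_, ?_, ?_, ?_, ?_, ?_, ?_⟩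
  · intro v
    change E (sm v) * E (sp v) = _
    rw [← map_mul, h.sm_mul_sp, map_smul, map_one]
  · intro v
    change E (sp v) * E (sm v) = _
    rw [← map_mul, h.sp_mul_sm, map_smul, map_one]
  · have h1 := congrArg (Subalgebra.map (AlgEquiv.prodCongr E E).toAlgHom) h.adjoin_eq_top
    rw [AlgHom.map_adjoin, ← Set.range_comp, Algebra.map_top,
      (AlgHom.range_eq_top _).mpr (AlgEquiv.prodCongr E E).surjective] at h1
    rw [← h1]
    congr 2
    funext p
    exact (Prod.ext (map_mul E (sm p.1) (sp p.2)) (map_mul E (sp p.1) (sm p.2))).symm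
  · exact h.isUnit_left.map E
  · exact h.isUnit_right.map E
  · intro hk
    obtain ⟨h1, h2, h3, h4⟩ := h.even hk
    refine ⟨fun v => ?_, fun v => ?_, ?_, ?_⟩
    · change E J * E (sm v) = (E (sp v)).transpose * E J'
      rw [hT, ← map_mul, ← map_mul, h1]
    · change E J' * E (sp v) = (E (sm v)).transpose * E J
      rw [hT, ← map_mul, ← map_mul, h2]
    · rw [hT, h3, map_smul]
    · rw [hT, h4, map_smul]
  · intro hk
    obtain ⟨h1, h2, h3, h4⟩ := h.odd hk
    refine ⟨fun v => ?_, fun v => ?_, ?_, ?_⟩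
    · change E J * E (sm v) = -((E (sm v)).transpose * E J')
      rw [hT, ← map_mul, ← map_mul, h1, map_neg]
    · change E J' * E (sp v) = -((E (sp v)).transpose * E J)
      rw [hT, ← map_mul, ← map_mul, h2, map_neg]
    · rw [hT, h3, map_smul]
    · rw [hT, h4, map_smul]

/-- The action of `W ⊥ H` on the half-spin modules, for a hyperbolic plane `H`. -/
def spinExtend (π : V →ₗ[K] Matrix ι ι K) (π' : V →ₗ[K] Matrix ι ι K) (x y : V →ₗ[K] K) :
    V →ₗ[K] Matrix (ι ⊕ ι) (ι ⊕ ι) K where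
  toFun v := Matrix.fromBlocks (π v) (x v • 1) (y v • 1) (-(π' v))
  map_add' v w := by
    rw [Matrix.fromBlocks_add, map_add, map_add, map_add, map_add, add_smul, add_smul, neg_add]
  map_smul' c v := by
    rw [Matrix.fromBlocks_smul, map_smul, map_smul, map_smul, map_smul, RingHom.id_apply,
      smul_assoc, smul_assoc, smul_neg]

omit [Fintype ι] in
theorem spinExtend_apply (π π' : V →ₗ[K] Matrix ι ι K) (x y : V →ₗ[K] K) (v : V) :
    spinExtend π π' x y v = Matrix.fromBlocks (π v) (x v • 1) (y v • 1) (-(π' v)) := rfl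

theorem neg_one_pow_triangle (k : ℕ) :
    (-1 : K) ^ ((k + 1) * (k + 1 + 1) / 2) = (-1 : K) ^ (k * (k + 1) / 2) * (-1) ^ (k + 1) := by
  rw [← pow_add]
  congr 1
  have : (k + 1) * (k + 1 + 1) = k * (k + 1) + 2 * (k + 1) := by ring
  rw [this, Nat.add_mul_div_left _ _ (by norm_num)]

theorem fromBlocks_antidiag_isUnit {A B : Matrix ι ι K} (hA : IsUnit A) (hB : IsUnit B) :
    IsUnit (Matrix.fromBlocks 0 A B 0) := by
  obtain ⟨a, rfl⟩ := hA
  obtain ⟨b, rfl⟩ := hB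
  refine IsUnit.of_mul_eq_one (Matrix.fromBlocks 0 (↑b⁻¹ : Matrix ι ι K) (↑a⁻¹ : Matrix ι ι K) 0) ?_
  simp [Matrix.fromBlocks_multiply, Matrix.fromBlocks_one]

/-- The products `f e` and `e f` act as the two block projections, which cut the full algebra for
`W` out of the diagonal. The products of `w₀` with `e` and with `f` give invertible off-diagonal
blocks because `q' w₀ ≠ 0`. -/
theorem spinExtend_adjoin {q : QuadraticForm K V} {e f : V} (he : q e = 0) (hf : q f = 0)
    (hef : QuadraticMap.polar q e f = 1) {W : Type*} [AddCommGroup W] [Module K W]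
    {q' : QuadraticForm K W} (i : W →ₗ[K] V) (pr : V →ₗ[K] W)
    (hpi : ∀ w, pr (i w) = w) (hpe : pr e = 0) (hpf : pr f = 0)
    (hei : ∀ w, QuadraticMap.polar q e (i w) = 0) (hfi : ∀ w, QuadraticMap.polar q f (i w) = 0)
    {sp sm : W →ₗ[K] Matrix ι ι K}
    (h1 : ∀ w, sm w * sp w = q' w • (1 : Matrix ι ι K))
    (h2 : ∀ w, sp w * sm w = q' w • (1 : Matrix ι ι K))
    (h3 : Algebra.adjoin K
      (Set.range fun p : W × W => (sm p.1 * sp p.2, sp p.1 * sm p.2)) = ⊤)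
    {w₀ : W} (hw₀ : q' w₀ ≠ 0) :
    Algebra.adjoin K (Set.range fun p : V × V =>
      (spinExtend (sm ∘ₗ pr) (sp ∘ₗ pr) (q.polarBilin e) (q.polarBilin f) p.1 *
        spinExtend (sp ∘ₗ pr) (sm ∘ₗ pr) (q.polarBilin e) (q.polarBilin f) p.2,
       spinExtend (sp ∘ₗ pr) (sm ∘ₗ pr) (q.polarBilin e) (q.polarBilin f) p.1 *
        spinExtend (sm ∘ₗ pr) (sp ∘ₗ pr) (q.polarBilin e) (q.polarBilin f) p.2)) = ⊤ := by
  have hee : QuadraticMap.polar q e e = 0 := by rw [QuadraticMap.polar_self, he, smul_zero]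
  have hff : QuadraticMap.polar q f f = 0 := by rw [QuadraticMap.polar_self, hf, smul_zero]
  have hfe : QuadraticMap.polar q f e = 1 := by rw [QuadraticMap.polar_comm, hef]
  have ext_i : ∀ (a b : W →ₗ[K] Matrix ι ι K) (w : W),
      spinExtend (a ∘ₗ pr) (b ∘ₗ pr) (q.polarBilin e) (q.polarBilin f) (i w) =
        Matrix.fromBlocks (a w) 0 0 (-(b w)) := by
    intro a b w
    simp [spinExtend_apply, hpi, hei, hfi]
  have ext_e : ∀ (a b : W →ₗ[K] Matrix ι ι K),
      spinExtend (a ∘ₗ pr) (b ∘ₗ pr) (q.polarBilin e) (q.polarBilin f) e =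
        Matrix.fromBlocks 0 0 1 0 := by
    intro a b
    simp [spinExtend_apply, hpe, hee, hfe]
  have ext_f : ∀ (a b : W →ₗ[K] Matrix ι ι K),
      spinExtend (a ∘ₗ pr) (b ∘ₗ pr) (q.polarBilin e) (q.polarBilin f) f =
        Matrix.fromBlocks 0 1 0 0 := by
    intro a b
    simp [spinExtend_apply, hpf, hff, hef]
  set R := Algebra.adjoin K (Set.range fun p : V × V =>
      (spinExtend (sm ∘ₗ pr) (sp ∘ₗ pr) (q.polarBilin e) (q.polarBilin f) p.1 *
        spinExtend (sp ∘ₗ pr) (sm ∘ₗ pr) (q.polarBilin e) (q.polarBilin f) p.2,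
       spinExtend (sp ∘ₗ pr) (sm ∘ₗ pr) (q.polarBilin e) (q.polarBilin f) p.1 *
        spinExtend (sm ∘ₗ pr) (sp ∘ₗ pr) (q.polarBilin e) (q.polarBilin f) p.2)) with hR
  have gen := fun v w : V => Algebra.subset_adjoin (R := K) (s := Set.range fun p : V × V =>
      (spinExtend (sm ∘ₗ pr) (sp ∘ₗ pr) (q.polarBilin e) (q.polarBilin f) p.1 *
        spinExtend (sp ∘ₗ pr) (sm ∘ₗ pr) (q.polarBilin e) (q.polarBilin f) p.2,
       spinExtend (sp ∘ₗ pr) (sm ∘ₗ pr) (q.polarBilin e) (q.polarBilin f) p.1 *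
        spinExtend (sm ∘ₗ pr) (sp ∘ₗ pr) (q.polarBilin e) (q.polarBilin f) p.2))
      (Set.mem_range_self (v, w))
  rw [← hR] at gen
  have Pfe := gen f e
  have Pef := gen e f
  have Pii := fun w w' => gen (i w) (i w')
  have Pie := fun w => gen (i w) e
  have Pif := fun w => gen (i w) f
  simp only [ext_i, ext_e, ext_f, Matrix.fromBlocks_multiply, Matrix.mul_zero, Matrix.zero_mul,
    Matrix.mul_one, add_zero, zero_add, neg_mul_neg] at Pfe Pef Pii Pie Pif
  have diag₁ : ∀ X : Matrix ι ι K × Matrix ι ι K,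
      ((Matrix.fromBlocks X.1 0 0 0, Matrix.fromBlocks X.2 0 0 0) :
        Matrix (ι ⊕ ι) (ι ⊕ ι) K × Matrix (ι ⊕ ι) (ι ⊕ ι) K) ∈ R := by
    intro X
    have hX : X ∈ Algebra.adjoin K
        (Set.range fun p : W × W => (sm p.1 * sp p.2, sp p.1 * sm p.2)) := by
      rw [h3]
      exact Algebra.mem_top
    induction hX using Algebra.adjoin_induction with
    | mem X hX =>
      obtain ⟨p, rfl⟩ := hX
      have := R.mul_mem (Pii p.1 p.2) Pfe
      simpa [Matrix.fromBlocks_multiply] using this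
    | algebraMap c =>
      have := R.smul_mem Pfe c
      simpa [Matrix.fromBlocks_smul, Algebra.algebraMap_eq_smul_one] using this
    | add X Y _ _ hX hY =>
      have := R.add_mem hX hY
      simpa [Matrix.fromBlocks_add] using this
    | mul X Y _ _ hX hY =>
      have := R.mul_mem hX hY
      simpa [Matrix.fromBlocks_multiply] using this
  have diag₂ : ∀ X : Matrix ι ι K × Matrix ι ι K,
      ((Matrix.fromBlocks 0 0 0 X.2, Matrix.fromBlocks 0 0 0 X.1) :
        Matrix (ι ⊕ ι) (ι ⊕ ι) K × Matrix (ι ⊕ ι) (ι ⊕ ι) K) ∈ R := by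
    intro X
    have hX : X ∈ Algebra.adjoin K
        (Set.range fun p : W × W => (sm p.1 * sp p.2, sp p.1 * sm p.2)) := by
      rw [h3]
      exact Algebra.mem_top
    induction hX using Algebra.adjoin_induction with
    | mem X hX =>
      obtain ⟨p, rfl⟩ := hX
      have := R.mul_mem (Pii p.1 p.2) Pef
      simpa [Matrix.fromBlocks_multiply] using this
    | algebraMap c =>
      have := R.smul_mem Pef c
      simpa [Matrix.fromBlocks_smul, Algebra.algebraMap_eq_smul_one] using this
    | add X Y _ _ hX hY =>
      have := R.add_mem hX hY
      simpa [Matrix.fromBlocks_add] using this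
    | mul X Y _ _ hX hY =>
      have := R.mul_mem hX hY
      simpa [Matrix.fromBlocks_multiply] using this
  have low : ∀ X Y : Matrix ι ι K,
      ((Matrix.fromBlocks 0 0 X 0, Matrix.fromBlocks 0 0 Y 0) :
        Matrix (ι ⊕ ι) (ι ⊕ ι) K × Matrix (ι ⊕ ι) (ι ⊕ ι) K) ∈ R := by
    intro X Y
    have := R.mul_mem (diag₂ (-((q' w₀)⁻¹ • (Y * sp w₀)), -((q' w₀)⁻¹ • (X * sm w₀)))) (Pie w₀)
    simpa [Matrix.fromBlocks_multiply, Matrix.mul_assoc, h1, h2, hw₀] using this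
  have upp : ∀ X Y : Matrix ι ι K,
      ((Matrix.fromBlocks 0 X 0 0, Matrix.fromBlocks 0 Y 0 0) :
        Matrix (ι ⊕ ι) (ι ⊕ ι) K × Matrix (ι ⊕ ι) (ι ⊕ ι) K) ∈ R := by
    intro X Y
    have := R.mul_mem (diag₁ ((q' w₀)⁻¹ • (X * sp w₀), (q' w₀)⁻¹ • (Y * sm w₀))) (Pif w₀)
    simpa [Matrix.fromBlocks_multiply, Matrix.mul_assoc, h1, h2, hw₀] using this
  rw [eq_top_iff]
  rintro ⟨M, N⟩ _
  have := R.add_mem (R.add_mem (diag₁ (M.toBlocks₁₁, N.toBlocks₁₁))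
    (upp M.toBlocks₁₂ N.toBlocks₁₂)) (R.add_mem (low M.toBlocks₂₁ N.toBlocks₂₁)
    (diag₂ (N.toBlocks₂₂, M.toBlocks₂₂)))
  simpa [Matrix.fromBlocks_add, Matrix.fromBlocks_toBlocks] using this

/-- The induction starts with a plane. The even Clifford algebra of the zero space is `K`, which
cannot generate two factors. With `J = 1` the identities for odd `k` force `J' = -1`. -/
theorem exists_isSpinRep_one {q : QuadraticForm K V} {e f : V} (he : q e = 0) (hf : q f = 0)
    (hef : QuadraticMap.polar q e f = 1)
    (hq : ∀ v, q v = QuadraticMap.polar q e v * QuadraticMap.polar q f v) :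
    ∃ (sp sm : V →ₗ[K] Matrix Unit Unit K) (J J' : Matrix Unit Unit K),
      IsSpinRep q 1 sp sm J J' := by
  have hee : QuadraticMap.polar q e e = 0 := by rw [QuadraticMap.polar_self, he, smul_zero]
  have hff : QuadraticMap.polar q f f = 0 := by rw [QuadraticMap.polar_self, hf, smul_zero]
  have hfe : QuadraticMap.polar q f e = 1 := by rw [QuadraticMap.polar_comm, hef]
  let sp : V →ₗ[K] Matrix Unit Unit K := (q.polarBilin f).smulRight 1
  let sm : V →ₗ[K] Matrix Unit Unit K := (q.polarBilin e).smulRight 1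
  have hsp : ∀ v, sp v = QuadraticMap.polar q f v • (1 : Matrix Unit Unit K) := fun _ => rfl
  have hsm : ∀ v, sm v = QuadraticMap.polar q e v • (1 : Matrix Unit Unit K) := fun _ => rfl
  refine ⟨sp, sm, 1, -1, ?_, ?_, ?_, isUnit_one, isUnit_one.neg, ?_, ?_⟩
  · intro v
    rw [hsp, hsm, hq, smul_mul_smul_comm, one_mul]
  · intro v
    rw [hsp, hsm, hq, smul_mul_smul_comm, one_mul, mul_comm]
  · rw [eq_top_iff]
    rintro ⟨X, Y⟩ _
    have gen := fun v w : V => Algebra.subset_adjoin (R := K) (s := Set.range fun p : V × V =>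
      (sm p.1 * sp p.2, sp p.1 * sm p.2)) (Set.mem_range_self (v, w))
    have h := Subalgebra.add_mem _ (Subalgebra.smul_mem _ (gen f e) (X () ()))
      (Subalgebra.smul_mem _ (gen e f) (Y () ()))
    have hXY : X () () • (sm f * sp e, sp f * sm e) + Y () () • (sm e * sp f, sp e * sm f) =
        (X, Y) := by
      rw [hsp, hsp, hsm, hsm, hee, hff, hef, hfe]
      refine Prod.ext ?_ ?_ <;> ext <;> simp
    rw [← hXY]
    exact h
  · intro h
    simp at h
  · intro _
    refine ⟨fun v => ?_, fun v => ?_, ?_, ?_⟩ <;> simp [hsp, hsm]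

/-- An additional plane changes the parity of `k`, so the identities in the odd case give those in
the even case and conversely. The sign `(-1)^(k+1)` in the new Gram matrices is the quotient of
consecutive symmetry signs. -/
theorem IsSpinRep.extend {q : QuadraticForm K V} {e f : V} (he : q e = 0) (hf : q f = 0)
    (hef : QuadraticMap.polar q e f = 1) {W : Type*} [AddCommGroup W] [Module K W]
    {q' : QuadraticForm K W} (i : W →ₗ[K] V) (pr : V →ₗ[K] W)
    (hpi : ∀ w, pr (i w) = w) (hpe : pr e = 0) (hpf : pr f = 0)
    (hei : ∀ w, QuadraticMap.polar q e (i w) = 0) (hfi : ∀ w, QuadraticMap.polar q f (i w) = 0)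
    (hqp : ∀ v, q v = q' (pr v) + QuadraticMap.polar q e v * QuadraticMap.polar q f v)
    {k : ℕ} {sp sm : W →ₗ[K] Matrix ι ι K} {J J' : Matrix ι ι K}
    (h : IsSpinRep q' k sp sm J J') {w₀ : W} (hw₀ : q' w₀ ≠ 0) :
    IsSpinRep q (k + 1)
      (spinExtend (sp ∘ₗ pr) (sm ∘ₗ pr) (q.polarBilin e) (q.polarBilin f))
      (spinExtend (sm ∘ₗ pr) (sp ∘ₗ pr) (q.polarBilin e) (q.polarBilin f))
      (Matrix.fromBlocks 0 ((-1 : K) ^ (k + 1) • J') J 0)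
      (Matrix.fromBlocks 0 ((-1 : K) ^ (k + 1) • J) J' 0) := by
  have hu : IsUnit ((-1 : K) ^ (k + 1)) := isUnit_one.neg.pow _
  have hun : ∀ M : Matrix ι ι K, IsUnit M → IsUnit ((-1 : K) ^ (k + 1) • M) := by
    intro M hM
    rw [← hu.unit_spec]
    exact (isUnit_smul_iff hu.unit M).mpr hM
  refine ⟨?_, ?_, ?_, ?_, ?_, ?_, ?_⟩
  · intro v
    simp only [spinExtend_apply, Matrix.fromBlocks_multiply, LinearMap.comp_apply]
    rw [← Matrix.fromBlocks_one, Matrix.fromBlocks_smul, Matrix.fromBlocks_inj, hqp]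
    simp only [h.sm_mul_sp, h.sp_mul_sm, smul_mul_assoc, mul_smul_comm, one_mul,
      mul_one, smul_smul, add_smul, smul_zero, mul_neg, neg_mul, QuadraticMap.polarBilin_apply_apply]
    refine ⟨by rw [mul_comm (QuadraticMap.polar q f v)], ?_, ?_, ?_⟩
    · simp
    · simp
    · rw [neg_neg, add_comm]
  · intro v
    simp only [spinExtend_apply, Matrix.fromBlocks_multiply, LinearMap.comp_apply]
    rw [← Matrix.fromBlocks_one, Matrix.fromBlocks_smul, Matrix.fromBlocks_inj, hqp]
    simp only [h.sm_mul_sp, h.sp_mul_sm, smul_mul_assoc, mul_smul_comm, one_mul,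
      mul_one, smul_smul, add_smul, smul_zero, mul_neg, neg_mul, QuadraticMap.polarBilin_apply_apply]
    refine ⟨by rw [mul_comm (QuadraticMap.polar q f v)], ?_, ?_, ?_⟩
    · simp
    · simp
    · rw [neg_neg, add_comm]
  · exact spinExtend_adjoin he hf hef i pr hpi hpe hpf hei hfi h.sm_mul_sp h.sp_mul_sm
      h.adjoin_eq_top hw₀
  · exact fromBlocks_antidiag_isUnit (hun _ h.isUnit_right) h.isUnit_left
  · exact fromBlocks_antidiag_isUnit (hun _ h.isUnit_left) h.isUnit_right
  · intro hk
    have hk' : ¬ Even k := fun h' => by simp [Nat.even_add_one, h'] at hk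
    obtain ⟨h1, h2, h3, h4⟩ := h.odd hk'
    rw [neg_one_pow_triangle, hk.neg_one_pow]
    refine ⟨fun v => ?_, fun v => ?_, ?_, ?_⟩
    · simp [spinExtend_apply, Matrix.fromBlocks_multiply, Matrix.fromBlocks_transpose, h1, h2]
    · simp [spinExtend_apply, Matrix.fromBlocks_multiply, Matrix.fromBlocks_transpose, h1, h2]
    · simp [Matrix.fromBlocks_transpose, Matrix.fromBlocks_smul, h3, h4]
    · simp [Matrix.fromBlocks_transpose, Matrix.fromBlocks_smul, h3, h4]
  · intro hk
    have hk' : Even k := by simpa [Nat.even_add_one] using hk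
    obtain ⟨h1, h2, h3, h4⟩ := h.even hk'
    rw [neg_one_pow_triangle, hk'.add_one.neg_one_pow]
    refine ⟨fun v => ?_, fun v => ?_, ?_, ?_⟩
    · simp [spinExtend_apply, Matrix.fromBlocks_multiply, Matrix.fromBlocks_transpose, h1, h2,
        Matrix.fromBlocks_neg]
    · simp [spinExtend_apply, Matrix.fromBlocks_multiply, Matrix.fromBlocks_transpose, h1, h2,
        Matrix.fromBlocks_neg]
    · simp [Matrix.fromBlocks_transpose, Matrix.fromBlocks_smul, h3, h4,
        Matrix.fromBlocks_neg]
    · simp [Matrix.fromBlocks_transpose, Matrix.fromBlocks_smul, h3, h4,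
        Matrix.fromBlocks_neg]

end Spin

/-- Over an algebraically closed field, a nondegenerate quadratic space of even dimension has
half-spin modules. -/
theorem exists_isSpinRep {K : Type u} [Field K] [IsAlgClosed K] (k : ℕ) :
    ∀ (V : Type v) [AddCommGroup V] [Module K V] [FiniteDimensional K V] (q : QuadraticForm K V),
      (∀ v, (∀ w, QuadraticMap.polar q v w = 0) → v = 0) → Module.finrank K V = 2 * (k + 1) →
      ∃ (sp sm : V →ₗ[K] Matrix (Fin (2 ^ k)) (Fin (2 ^ k)) K)
        (J J' : Matrix (Fin (2 ^ k)) (Fin (2 ^ k)) K), IsSpinRep q (k + 1) sp sm J J' := by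
  induction k with
  | zero =>
    intro V _ _ _ q hq hdim
    obtain ⟨e, f, he, hf, hef⟩ := exists_hyperbolic_pair q hq (by omega)
    have hW : Module.finrank K (planeComplement q e f) = 0 := by
      have h := (planeEquiv he hf hef).finrank_eq
      rw [Module.finrank_prod, Module.finrank_prod, Module.finrank_self, hdim] at h
      omega
    have hsub := Module.finrank_zero_iff.mp hW
    obtain ⟨sp, sm, J, J', h⟩ := exists_isSpinRep_one he hf hef fun v => by
      rw [map_eq_planeComplement he hf hef v,
        Subsingleton.elim ((planeEquiv he hf hef v).1) 0]
      simp
    exact h.reindex (Fintype.equivOfCardEq (by simp))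
  | succ k ih =>
    intro V _ _ _ q hq hdim
    obtain ⟨e, f, he, hf, hef⟩ := exists_hyperbolic_pair q hq (by omega)
    have hW : Module.finrank K (planeComplement q e f) = 2 * (k + 1) := by
      have h := (planeEquiv he hf hef).finrank_eq
      rw [Module.finrank_prod, Module.finrank_prod, Module.finrank_self, hdim] at h
      omega
    have hq' := nondegenerate_planeComplement he hf hef hq
    obtain ⟨sp, sm, J, J', h⟩ := ih (planeComplement q e f)
      (q.comp (planeComplement q e f).subtype) hq' hW
    obtain ⟨w₀, hw₀⟩ : ∃ w, (q.comp (planeComplement q e f).subtype) w ≠ 0 := by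
      by_contra! h0
      have hnt : Nontrivial (planeComplement q e f) :=
        Module.nontrivial_of_finrank_pos (R := K) (by omega)
      obtain ⟨w, hw⟩ := exists_ne (0 : planeComplement q e f)
      refine hw (hq' w fun w' => ?_)
      simp only [QuadraticMap.polar, h0, sub_zero]
    let pr : V →ₗ[K] planeComplement q e f :=
      LinearMap.fst K _ _ ∘ₗ (planeEquiv he hf hef).toLinearMap
    have hinv : ∀ p, planeEquiv he hf hef (p.1 + p.2.2 • e + p.2.1 • f) = p :=
      (planeEquiv he hf hef).apply_symm_apply
    have h' := h.extend he hf hef (planeComplement q e f).subtype pr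
      (fun w => by
        have := congrArg Prod.fst (hinv (w, (0, 0)))
        simpa [pr] using this)
      (by
        have := congrArg Prod.fst (hinv (0, (0, 1)))
        simpa [pr] using this)
      (by
        have := congrArg Prod.fst (hinv (0, (1, 0)))
        simpa [pr] using this)
      (fun w => (mem_planeComplement.mp w.2).1) (fun w => (mem_planeComplement.mp w.2).2)
      (map_eq_planeComplement he hf hef) hw₀
    exact h'.reindex (Fintype.equivOfCardEq (by simp [pow_succ, mul_two]))

/-! ### Dimension of the even Clifford algebra -/

section EvenDimension

variable {K V : Type*} [Field K] [AddCommGroup V] [Module K V] [FiniteDimensional K V]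

theorem finrank_exteriorAlgebra :
    Module.finrank K (ExteriorAlgebra K V) = 2 ^ Module.finrank K V := by
  let b := Module.finBasis K V
  rw [Module.finrank_eq_card_basis b.ExteriorAlgebra, Fintype.card_finset, Fintype.card_fin]

theorem finite_exteriorAlgebra : Module.Finite K (ExteriorAlgebra K V) :=
  Module.Finite.of_basis (Module.finBasis K V).ExteriorAlgebra

variable {q : QuadraticForm K V} {b : LinearMap.BilinForm K V} (hb : ∀ v, b v v = q v)

include hb in
omit [FiniteDimensional K V] in
-- The form `b` need not be symmetric, so there is no division by `2` and the argument covers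
-- characteristic two.
theorem nonempty_cliffordEquiv :
    Nonempty (CliffordAlgebra q ≃ₗ[K] ExteriorAlgebra K V) := by
  refine ⟨CliffordAlgebra.changeFormEquiv (B := -b) ?_⟩
  ext v
  simp [hb]

include hb in
-- Multiplication by an anisotropic vector is injective and exchanges the even and the odd part, so
-- each has half the dimension.
theorem finrank_even {w : V} (hw : q w ≠ 0) :
    Module.Finite K (CliffordAlgebra.even q) ∧
      2 * Module.finrank K (CliffordAlgebra.even q) = 2 ^ Module.finrank K V := by
  obtain ⟨E⟩ := nonempty_cliffordEquiv hb
  have := finite_exteriorAlgebra (K := K) (V := V)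
  have hfin : Module.Finite K (CliffordAlgebra q) := Module.Finite.equiv E.symm
  have hE := E.finrank_eq
  rw [finrank_exteriorAlgebra] at hE
  have hc := Submodule.finrank_add_eq_of_isCompl (CliffordAlgebra.evenOdd_isCompl (Q := q))
  have hw2 : CliffordAlgebra.ι q w * CliffordAlgebra.ι q w = algebraMap K _ (q w) :=
    CliffordAlgebra.ι_sq_scalar q w
  have hmul : ∀ x, CliffordAlgebra.ι q w * ((q w)⁻¹ • (CliffordAlgebra.ι q w * x)) = x := by
    intro x
    rw [mul_smul_comm, ← mul_assoc, hw2, ← Algebra.smul_def, smul_smul, inv_mul_cancel₀ hw,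
      one_smul]
  have hinj : Function.Injective (LinearMap.mulLeft K (CliffordAlgebra.ι q w)) := by
    intro x y h
    have h' : CliffordAlgebra.ι q w * x = CliffordAlgebra.ι q w * y := h
    rw [← hmul x, mul_smul_comm, h', ← mul_smul_comm, hmul]
  have hmap : ∀ i j : ZMod 2, 1 + i = j →
      Module.finrank K (CliffordAlgebra.evenOdd q i) ≤
        Module.finrank K (CliffordAlgebra.evenOdd q j) := by
    rintro i j rfl
    have hr : ∀ x ∈ CliffordAlgebra.evenOdd q i,
        LinearMap.mulLeft K (CliffordAlgebra.ι q w) x ∈ CliffordAlgebra.evenOdd q (1 + i) :=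
      fun x hx => SetLike.mul_mem_graded (CliffordAlgebra.ι_mem_evenOdd_one q w) hx
    refine LinearMap.finrank_le_finrank_of_injective
      (f := (LinearMap.mulLeft K (CliffordAlgebra.ι q w)).restrict hr) ?_
    intro x y h
    exact Subtype.ext (hinj (congrArg Subtype.val h))
  have h1 := hmap 0 1 (by decide)
  have h2 := hmap 1 0 (by decide)
  refine ⟨inferInstanceAs (Module.Finite K (CliffordAlgebra.evenOdd q 0)), ?_⟩
  change 2 * Module.finrank K (CliffordAlgebra.evenOdd q 0) = _
  omega

end EvenDimension

/-! ### Scalar extension and splitting of central simple algebras -/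

section Simple

variable {F K A : Type*} [Field F] [Field K] [Algebra F K] [Ring A] [Algebra F A]

/-- Shortest element argument: a nonzero ideal contains an element of minimal length along a basis
of `K`, normalised to have one coefficient equal to `1`. It commutes with `A`, hence has the form `κ
⊗ 1` and is a unit. -/
theorem isSimpleRing_tensorProduct [Algebra.IsCentral F A] [IsSimpleRing A] :
    IsSimpleRing (K ⊗[F] A) := by
  classical
  let ω := Module.Basis.ofVectorSpace F K
  let G : K ⊗[F] A ≃ₗ[F] (_ →₀ A) := TensorProduct.equivFinsuppOfBasisLeft ω
  have hGl : ∀ a x k, G ((1 ⊗ₜ a) * x) k = a * G x k := by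
    intro a x k
    induction x using TensorProduct.induction_on with
    | zero => simp
    | tmul s b =>
      rw [Algebra.TensorProduct.tmul_mul_tmul, one_mul]
      simp [G]
    | add x y hx hy => rw [mul_add, map_add, Finsupp.add_apply, hx, hy, map_add, Finsupp.add_apply,
        mul_add]
  have hGr : ∀ a x k, G (x * (1 ⊗ₜ a)) k = G x k * a := by
    intro a x k
    induction x using TensorProduct.induction_on with
    | zero => simp
    | tmul s b =>
      rw [Algebra.TensorProduct.tmul_mul_tmul, mul_one]
      simp [G]
    | add x y hx hy => rw [add_mul, map_add, Finsupp.add_apply, hx, hy, map_add, Finsupp.add_apply,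
        add_mul]
  have hnt : Nontrivial (K ⊗[F] A) := inferInstance
  refine IsSimpleRing.of_eq_bot_or_eq_top fun I => or_iff_not_imp_left.mpr fun hI => ?_
  obtain ⟨x₀, hx₀, hx₀'⟩ : ∃ x ∈ I, x ≠ 0 := by
    obtain ⟨x, h1, h2⟩ := SetLike.exists_of_lt (bot_lt_iff_ne_bot.mpr hI)
    exact ⟨x, h1, fun h => h2 (by rw [h]; exact TwoSidedIdeal.zero_mem _)⟩
  have hex : ∃ n, ∃ x ∈ I, x ≠ 0 ∧ (G x).support.card = n := ⟨_, x₀, hx₀, hx₀', rfl⟩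
  obtain ⟨x, hxI, hx0, hxc⟩ := Nat.find_spec hex
  have hmin : ∀ y ∈ I, (G y).support.card < (G x).support.card → y = 0 := by
    intro y hy hlt
    by_contra h0
    rw [hxc] at hlt
    exact Nat.find_min hex hlt ⟨y, hy, h0, rfl⟩
  obtain ⟨k₀, hk₀⟩ : (G x).support.Nonempty := by
    rw [Finsupp.support_nonempty_iff]
    simpa using hx0
  -- The coefficients at `k₀` of the elements of `I` supported in the support of `x` form a nonzero
  -- ideal of `A`, so `1` is among them.
  let J : TwoSidedIdeal A := TwoSidedIdeal.mk'
    {a | ∃ y ∈ I, (G y).support ⊆ (G x).support ∧ G y k₀ = a}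
    ⟨0, I.zero_mem, by simp, by simp⟩
    (by
      rintro _ _ ⟨y, hy, hys, rfl⟩ ⟨z, hz, hzs, rfl⟩
      refine ⟨y + z, I.add_mem hy hz, ?_, by simp⟩
      rw [map_add]
      exact Finsupp.support_add.trans (Finset.union_subset hys hzs))
    (by
      rintro _ ⟨y, hy, hys, rfl⟩
      refine ⟨-y, I.neg_mem hy, ?_, by simp⟩
      rwa [map_neg, Finsupp.support_neg])
    (by
      rintro a _ ⟨y, hy, hys, rfl⟩
      refine ⟨(1 ⊗ₜ a) * y, I.mul_mem_left _ _ hy, fun k hk => hys ?_, hGl _ _ _⟩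
      rw [Finsupp.mem_support_iff, hGl] at hk
      exact Finsupp.mem_support_iff.mpr (right_ne_zero_of_mul hk))
    (by
      rintro _ a ⟨y, hy, hys, rfl⟩
      refine ⟨y * (1 ⊗ₜ a), I.mul_mem_right _ _ hy, fun k hk => hys ?_, hGr _ _ _⟩
      rw [Finsupp.mem_support_iff, hGr] at hk
      exact Finsupp.mem_support_iff.mpr (left_ne_zero_of_mul hk))
  have h1 : (1 : A) ∈ J :=
    IsSimpleRing.one_mem_of_ne_zero_mem J (Finsupp.mem_support_iff.mp hk₀)
      ((TwoSidedIdeal.mem_mk' _ _ _ _ _ _ _).mpr ⟨x, hxI, subset_rfl, rfl⟩)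
  obtain ⟨y, hyI, hys, hy1⟩ := (TwoSidedIdeal.mem_mk' _ _ _ _ _ _ _).mp h1
  -- The coefficient `1` at `k₀` cancels in the commutator, which is therefore shorter than `x`.
  have hcomm : ∀ b : A, (1 ⊗ₜ b) * y - y * (1 ⊗ₜ b) = 0 := by
    intro b
    refine hmin _ (I.sub_mem (I.mul_mem_left _ _ hyI) (I.mul_mem_right _ _ hyI)) ?_
    refine Finset.card_lt_card ((Finset.ssubset_iff_of_subset fun k hk => ?_).mpr ⟨k₀, hk₀, ?_⟩)
    · apply hys
      rw [Finsupp.mem_support_iff] at hk ⊢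
      intro h0
      rw [map_sub, Finsupp.sub_apply, hGl, hGr, h0, mul_zero, zero_mul, sub_zero] at hk
      exact hk rfl
    · rw [Finsupp.mem_support_iff, map_sub, Finsupp.sub_apply, hGl, hGr, hy1]
      simp
  have hcen : ∀ k, ∃ c : F, algebraMap F A c = G y k := by
    intro k
    have hk : G y k ∈ Subalgebra.center F A := by
      rw [Subalgebra.mem_center_iff]
      intro b
      rw [← hGl, ← hGr, sub_eq_zero.mp (hcomm b)]
    rw [Algebra.IsCentral.center_eq_bot, Algebra.mem_bot] at hk
    exact hk
  choose c hc using hcen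
  have hy : y = (∑ k ∈ (G y).support, c k • ω k) ⊗ₜ[F] (1 : A) := by
    conv_lhs => rw [← G.symm_apply_apply y]
    rw [TensorProduct.equivFinsuppOfBasisLeft_symm_apply, Finsupp.sum, TensorProduct.sum_tmul]
    refine Finset.sum_congr rfl fun k _ => ?_
    rw [← hc, Algebra.algebraMap_eq_smul_one, TensorProduct.tmul_smul, TensorProduct.smul_tmul']
  have hκ : (∑ k ∈ (G y).support, c k • ω k) ≠ 0 := by
    intro h0
    rw [h0, TensorProduct.zero_tmul] at hy
    rw [hy, map_zero] at hy1
    exact zero_ne_one hy1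
  rw [← TwoSidedIdeal.one_mem_iff]
  have := I.mul_mem_left ((∑ k ∈ (G y).support, c k • ω k)⁻¹ ⊗ₜ[F] (1 : A)) _ hyI
  rw [hy] at this
  rwa [Algebra.TensorProduct.tmul_mul_tmul, one_mul, ← hy, inv_mul_cancel₀ hκ,
    ← Algebra.TensorProduct.one_def] at this

end Simple

section Split

variable {F A : Type*} [Field F] [Ring A] [Algebra F A]
  {K : Type*} [Field K] [Algebra F K] [IsAlgClosed K]

/-- The index set `Unit` lets the results on products of matrix algebras apply to `A` as well as to
its Clifford algebra. -/
theorem exists_split [FiniteDimensional F A] [Algebra.IsCentral F A] [IsSimpleRing A] {n : ℕ}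
    (hn : Module.finrank F A = n ^ 2) :
    Nonempty (K ⊗[F] A ≃ₐ[K] (Unit → Matrix (Fin n) (Fin n) K)) := by
  have := isSimpleRing_tensorProduct (F := F) (K := K) (A := A)
  obtain ⟨d, _, ⟨e⟩⟩ := IsSimpleRing.exists_algEquiv_matrix_of_isAlgClosed K (K ⊗[F] A)
  have h := e.toLinearEquiv.finrank_eq
  rw [Module.finrank_baseChange, Module.finrank_matrix, hn] at h
  have hd : n = d := by
    simp only [Fintype.card_fin, Module.finrank_self, mul_one] at h
    nlinarith
  subst hd
  exact ⟨e.trans (AlgEquiv.funUnique K Unit (Matrix (Fin n) (Fin n) K)).symm⟩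

end Split

/-! ### The symmetric form to which the involution of `A` is adjoint -/

section AdjointMatrix

variable {F A K : Type*} [Field F] [Ring A] [Algebra F A] [Field K] [Algebra F K] {n : ℕ}
  (e : K ⊗[F] A ≃ₐ[K] (Unit → Matrix (Fin n) (Fin n) K)) (σ : AlgInvolution F A)

theorem involution_one {B : Type*} [Ring B] [Algebra F B] (σ : AlgInvolution F B) : σ 1 = 1 := by
  have h := σ.map_mul (σ 1) 1
  rw [mul_one, σ.involutive, mul_one] at h
  exact h.symm

/-- The representation `a ↦ ρ(σ(a))ᵀ`. -/
noncomputable def transposeRep : A →ₐ[F] Matrix (Fin n) (Fin n) K :=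
  AlgHom.ofLinearMap
    ((Matrix.transposeLinearEquiv (Fin n) (Fin n) F K).toLinearMap ∘ₗ
      LinearMap.proj (R := F) (φ := fun _ : Unit => Matrix (Fin n) (Fin n) K) () ∘ₗ
      (splitRep e).toLinearMap ∘ₗ σ.toLin)
    (by
      change (splitRep e (σ 1) ()).transpose = 1
      rw [involution_one, map_one, Pi.one_apply, Matrix.transpose_one])
    (fun a b => by
      change (splitRep e (σ (a * b)) ()).transpose =
        (splitRep e (σ a) ()).transpose * (splitRep e (σ b) ()).transpose
      rw [σ.map_mul, map_mul, Pi.mul_apply, Matrix.transpose_mul])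

theorem transposeRep_apply (a : A) :
    transposeRep e σ a = (splitRep e (σ a) ()).transpose := rfl

/-- The representation `a ↦ ρ(σ(a))ᵀ` extends to an automorphism of the matrix algebra, which is
conjugation by some `P` by the Skolem–Noether theorem. The Gram matrix is `Pᵀ`. -/
theorem exists_adjoint_matrix [NeZero n] : ∃ J : Matrix (Fin n) (Fin n) K, IsUnit J.det ∧
    ∀ b, J * splitRep e (σ b) () = (splitRep e b ()).transpose * J := by
  let L : K ⊗[F] A →ₐ[K] Matrix (Fin n) (Fin n) K :=
    Algebra.TensorProduct.lift (Algebra.ofId K _) (transposeRep e σ)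
      (fun k _ => Algebra.commute_algebraMap_left k _)
  let u := AlgEquiv.funUnique K Unit (Matrix (Fin n) (Fin n) K)
  let Ψ : Matrix (Fin n) (Fin n) K →ₐ[K] Matrix (Fin n) (Fin n) K :=
    L.comp ((u.symm.trans e.symm).toAlgHom)
  have hΨ : ∀ a, Ψ (splitRep e a ()) = (splitRep e (σ a) ()).transpose := by
    intro a
    have h1 : u.symm (splitRep e a ()) = e (1 ⊗ₜ a) := by
      apply u.injective
      rw [u.apply_symm_apply]
      rfl
    change L (e.symm (u.symm (splitRep e a ()))) = _
    rw [h1, e.symm_apply_apply]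
    refine (Algebra.TensorProduct.lift_tmul _ _ _ _ _).trans ?_
    rw [map_one, one_mul, transposeRep_apply]
  have hinj : Function.Injective Ψ := Ψ.toRingHom.injective
  have hbij : Function.Bijective Ψ :=
    ⟨hinj, LinearMap.surjective_of_injective (f := Ψ.toLinearMap) hinj⟩
  let E := AlgEquiv.ofBijective Ψ hbij
  let t : Matrix (Fin n) (Fin n) K ≃ₐ[K] Module.End K (Fin n → K) := Matrix.toLinAlgEquiv'
  obtain ⟨T, hT⟩ := AlgEquiv.eq_linearEquivConjAlgEquiv ((t.symm.trans E).trans t)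
  have h1 : ∀ M, t (Ψ M) * T.toLinearMap = T.toLinearMap * t M := by
    intro M
    have h2 := congrArg (fun g => g (t M)) hT
    simp only [AlgEquiv.trans_apply, AlgEquiv.symm_apply_apply] at h2
    have h3 : t (Ψ M) = T.toLinearMap ∘ₗ t M ∘ₗ T.symm.toLinearMap := h2
    rw [h3]
    ext x
    simp
  let P : Matrix (Fin n) (Fin n) K := t.symm T.toLinearMap
  have hP : t P = T.toLinearMap := t.apply_symm_apply _
  have h2 : ∀ M, Ψ M * P = P * M := by
    intro M
    apply t.injective
    rw [map_mul, map_mul, hP, h1]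
  have hPu : IsUnit P := by
    refine IsUnit.of_mul_eq_one (t.symm T.symm.toLinearMap) ?_
    apply t.injective
    rw [map_mul, hP, t.apply_symm_apply, map_one]
    ext x
    simp
  refine ⟨P.transpose, ?_, fun b => ?_⟩
  · rw [Matrix.det_transpose]
    exact (Matrix.isUnit_iff_isUnit_det _).mp hPu
  · have h3 := congrArg Matrix.transpose (h2 (splitRep e b ()))
    rw [hΨ, Matrix.transpose_mul, Matrix.transpose_mul, Matrix.transpose_transpose] at h3
    exact h3

variable {σ} {J : Matrix (Fin n) (Fin n) K} (hJ : IsUnit J.det)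
  (hadj : ∀ b, J * splitRep e (σ b) () = (splitRep e b ()).transpose * J)
include hJ hadj

/-- Since `σ` has order two, `Jᵀ` satisfies the same equation as `J`. So `J⁻¹ Jᵀ` is central, hence
a scalar. -/
theorem exists_transpose_eq_smul [NeZero n] : ∃ d : K, d * d = 1 ∧ J.transpose = d • J := by
  have hJ0 : J ≠ 0 := by
    rintro rfl
    rw [Matrix.det_zero] at hJ
    exact not_isUnit_zero hJ
  have hadj' : ∀ b, J.transpose * splitRep e (σ b) () =
      (splitRep e b ()).transpose * J.transpose := by
    intro b
    have h := congrArg Matrix.transpose (hadj (σ b))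
    rw [Matrix.transpose_mul, Matrix.transpose_mul, Matrix.transpose_transpose,
      σ.involutive] at h
    exact h.symm
  have hc : ∀ b, splitRep e b * (fun _ => J⁻¹ * J.transpose) =
      (fun _ => J⁻¹ * J.transpose) * splitRep e b := by
    intro b
    funext _
    change splitRep e b () * (J⁻¹ * J.transpose) = J⁻¹ * J.transpose * splitRep e b ()
    have h1 := hadj (σ b)
    have h2 := hadj' (σ b)
    rw [σ.involutive] at h1 h2
    rw [Matrix.mul_assoc J⁻¹, h2, ← Matrix.mul_assoc, ← Matrix.mul_assoc]
    congr 1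
    rw [← Matrix.nonsing_inv_mul_cancel_left J (splitRep e b () * J⁻¹) hJ, ← Matrix.mul_assoc J, h1,
      Matrix.mul_assoc, Matrix.mul_nonsing_inv _ hJ, Matrix.mul_one]
  obtain ⟨d, hd⟩ : ∃ d : K, J⁻¹ * J.transpose = algebraMap K _ d :=
    ⟨_, eq_scalar_of_central e () 0 hc⟩
  have hs : J.transpose = d • J := by
    rw [← Matrix.mul_nonsing_inv_cancel_left J J.transpose hJ, hd, ← Algebra.commutes,
      ← Algebra.smul_def]
  refine ⟨d, ?_, hs⟩
  have h := congrArg Matrix.transpose hs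
  rw [Matrix.transpose_transpose, Matrix.transpose_smul, hs, smul_smul] at h
  have h2 : (d * d - 1) • J = 0 := by rw [sub_smul, one_smul, ← h, sub_self]
  exact sub_eq_zero.mp ((smul_eq_zero.mp h2).resolve_right hJ0)

/-- If `J` were skew-symmetric and `2 ≠ 0`, the symmetric elements would have dimension `n(n-1)/2`.
In characteristic two the sign is irrelevant. -/
theorem transpose_eq_self [NeZero n] (hσ : Module.finrank F σ.sym = n * (n + 1) / 2) :
    J.transpose = J := by
  obtain ⟨d, hd, hs⟩ := exists_transpose_eq_smul e hJ hadj
  have hdim := finrank_sym e (J := fun _ => J) (fun _ => hJ) (fun _ => hadj) hd (fun _ => hs)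
  rcases mul_self_eq_one_iff.mp hd with rfl | rfl
  · rw [hs, one_smul]
  · by_cases h2 : (2 : K) = 0
    · have : (-1 : K) = 1 := by linear_combination -h2
      rw [hs, this, one_smul]
    · have h3 := finrank_symMatrix_neg_one K n h2
      have hn : 0 < n := Nat.pos_of_neZero n
      simp only [Fintype.card_unit, one_mul] at hdim
      rw [← hdim, hσ] at h3
      obtain ⟨k, hk⟩ := Nat.even_mul_succ_self n
      have h4 : n * (n + 1) = n * n + n := Nat.mul_succ n n
      rw [hk] at h3 h4
      omega

end AdjointMatrix

/-! ### The trace form of `A` and the elements that determine a semi-trace -/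

section TraceForm

variable {F : Type u} {A : Type v} [Field F] [Ring A] [Algebra F A] [Algebra.IsCentral F A]
  [FiniteDimensional F A] {n : ℕ} [NeZero n]
  (e : AlgebraicClosure F ⊗[F] A ≃ₐ[AlgebraicClosure F]
    (Unit → Matrix (Fin n) (Fin n) (AlgebraicClosure F)))
  {σ : AlgInvolution F A} {J : Matrix (Fin n) (Fin n) (AlgebraicClosure F)} (hJ : IsUnit J.det)
  (hadj : ∀ b, J * splitRep e (σ b) () = (splitRep e b ()).transpose * J)
  (hs : J.transpose = J)
include hJ hadj hs

omit [FiniteDimensional F A] in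
theorem algebraMap_reducedTrace (b : A) :
    algebraMap F (AlgebraicClosure F) (reducedTrace F F A b) = (splitRep e b ()).trace := by
  have : Nontrivial A := (splitRep e).toRingHom.domain_nontrivial
  refine (reducedTrace_spec e (J := fun _ => J) (fun _ => hJ) (fun _ => hadj) (fun _ => hs)
    (χ := fun _ => Algebra.ofId F (AlgebraicClosure F)) (fun i z => ?_) (fun x hx => ?_)
    (algebraMap F A).injective).2 () b
  · rw [AlgHom.commutes]
    rfl
  · have h : x ∈ Subalgebra.center F A := Subalgebra.mem_center_iff.mpr hx
    rw [Algebra.IsCentral.center_eq_bot] at h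
    exact Algebra.mem_bot.mp h

theorem exists_reducedTrace_mul_eq (g : A →ₗ[F] F) : ∃ l : A, ∀ x, reducedTrace F F A (l * x) = g x := by
  let T : A →ₗ[F] Module.Dual F A := (LinearMap.mul F A).compr₂ (reducedTrace F F A)
  have hT : Function.Injective T := by
    rw [injective_iff_map_eq_zero]
    intro a ha
    apply splitRep_injective e
    rw [map_zero]
    have key : ∀ Y : Unit → Matrix (Fin n) (Fin n) (AlgebraicClosure F),
        (splitRep e a () * Y ()).trace = 0 := by
      intro Y
      refine splitRep_induction e (p := fun Y => (splitRep e a () * Y ()).trace = 0) Y ?_ ?_ ?_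
      · intro b
        have := LinearMap.congr_fun ha b
        change reducedTrace F F A (a * b) = 0 at this
        rw [← Pi.mul_apply, ← map_mul, ← algebraMap_reducedTrace e hJ hadj hs, this, map_zero]
      · intro x y hx hy
        rw [Pi.add_apply, mul_add, Matrix.trace_add, hx, hy, add_zero]
      · intro k x hx
        rw [Pi.smul_apply, Matrix.mul_smul, Matrix.trace_smul, hx, smul_zero]
    funext i
    refine Matrix.ext_iff_trace_mul_right.mpr fun Y => ?_
    rw [Pi.zero_apply, Matrix.zero_mul, Matrix.trace_zero]
    exact key fun _ => Y
  obtain ⟨l, hl⟩ := (LinearMap.injective_iff_surjective_of_finrank_eq_finrank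
      (Subspace.dual_finrank_eq (K := F) (V := A)).symm).mp hT g
  exact ⟨l, fun x => LinearMap.congr_fun hl x⟩

theorem exists_reducedTrace_eq_one : ∃ l : A, reducedTrace F F A l = 1 := by
  by_contra! h
  have h0 : ∀ x, reducedTrace F F A x = 0 := by
    intro x
    by_contra hx
    apply h ((reducedTrace F F A x)⁻¹ • x)
    rw [map_smul, smul_eq_mul, inv_mul_cancel₀ hx]
  have : Nontrivial A := (splitRep e).toRingHom.domain_nontrivial
  obtain ⟨g, hg⟩ := exists_ne (0 : Module.Dual F A)
  obtain ⟨l, hl⟩ := exists_reducedTrace_mul_eq e hJ hadj hs g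
  exact hg (LinearMap.ext fun x => by rw [← hl, h0]; rfl)

theorem exists_determines (f : σ.sym →ₗ[F] F) (hf : σ.IsSemitrace F f) :
    ∃ l, σ.Determines F l f := by
  obtain ⟨g, hg⟩ := LinearMap.exists_extend f
  obtain ⟨l, hl⟩ := exists_reducedTrace_mul_eq e hJ hadj hs g
  have htr : ∀ x, reducedTrace F F A (σ x) = reducedTrace F F A x := by
    intro x
    apply FaithfulSMul.algebraMap_injective F (AlgebraicClosure F)
    rw [algebraMap_reducedTrace e hJ hadj hs, algebraMap_reducedTrace e hJ hadj hs]
    exact trace_splitRep_involution e (J := fun _ => J) (fun _ => hJ) (fun _ => hadj) x ()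
  have hfl : ∀ s : σ.sym, f s = reducedTrace F F A (l * s) := by
    intro s
    rw [hl, ← hg]
    rfl
  refine ⟨l, ?_, LinearMap.ext hfl⟩
  -- The map `a ↦ Trd(a ·)` is onto, hence injective, so `l + σ(l) = 1` may be tested under the
  -- trace. There it becomes `f(x + σ(x)) = Trd(x)`.
  obtain ⟨_, hu⟩ := LinearMap.injective_iff_surjective_of_finrank_eq_finrank
    (f := ((LinearMap.mul F A).compr₂ (reducedTrace F F A) : A →ₗ[F] Module.Dual F A))
    (Subspace.dual_finrank_eq (K := F) (V := A)).symm
  have hinj := hu fun g => by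
    obtain ⟨l, hl⟩ := exists_reducedTrace_mul_eq e hJ hadj hs g
    exact ⟨l, LinearMap.ext hl⟩
  apply hinj
  refine LinearMap.ext fun x => ?_
  change reducedTrace F F A ((l + σ l) * x) = reducedTrace F F A (1 * x)
  have h1 : reducedTrace F F A (σ l * x) = reducedTrace F F A (l * σ x) := by
    rw [← htr (l * σ x), σ.map_mul, σ.involutive]
    apply FaithfulSMul.algebraMap_injective F (AlgebraicClosure F)
    rw [algebraMap_reducedTrace e hJ hadj hs, algebraMap_reducedTrace e hJ hadj hs, map_mul,
      map_mul, Pi.mul_apply, Pi.mul_apply, Matrix.trace_mul_comm]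
  rw [one_mul, ← hf x, hfl, add_mul, mul_add, map_add, map_add, h1]

end TraceForm

/-! ### Endomorphisms as tensors `v ⊗ w` -/

section Dyad

variable {K : Type*} [Field K] {n : ℕ} (J : Matrix (Fin n) (Fin n) K)
  {P : Type*}

/-- The rank one endomorphism `x ↦ v b(w, x)`, where `b` has Gram matrix `J`. -/
def dyad : (Fin n → K) →ₗ[K] (Fin n → K) →ₗ[K] Matrix (Fin n) (Fin n) K :=
  (vecMulVecBilin K K).compr₂ (LinearMap.mulRight K J)

theorem dyad_apply (v w : Fin n → K) : dyad J v w = Matrix.vecMulVec v w * J := rfl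

theorem trace_mul_dyad (M : Matrix (Fin n) (Fin n) K) (v w : Fin n → K) :
    (M * dyad J v w).trace = Matrix.toBilin' (J * M) w v := by
  rw [dyad_apply, Matrix.toBilin'_apply', ← Matrix.mul_assoc, Matrix.trace_mul_comm,
    ← Matrix.mul_assoc, Matrix.mul_vecMulVec, Matrix.trace_vecMulVec, dotProduct_comm]

/-- The quadratic form `v ↦ b(v, M v)`, where `b` has Gram matrix `J`. -/
noncomputable def matrixForm (M : Matrix (Fin n) (Fin n) K) : QuadraticForm K (Fin n → K) :=
  (Matrix.toBilin' (J * M)).toQuadraticMap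

theorem matrixForm_apply (M : Matrix (Fin n) (Fin n) K) (v : Fin n → K) :
    matrixForm J M v = (M * dyad J v v).trace := by
  rw [trace_mul_dyad]
  rfl

theorem dyad_mul_mul_dyad (M : Matrix (Fin n) (Fin n) K) (v w w' v' : Fin n → K) :
    dyad J v w * (M * dyad J w' v') = Matrix.toBilin' (J * M) w w' • dyad J v v' := by
  rw [dyad_apply, dyad_apply, dyad_apply, Matrix.toBilin'_apply', Matrix.mul_assoc,
    ← Matrix.mul_assoc J, ← Matrix.mul_assoc (J * M), Matrix.mul_vecMulVec,
    ← Matrix.mul_assoc, Matrix.vecMulVec_mul_vecMulVec,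
    Matrix.vecMulVec_smul, Matrix.smul_mul]

variable [AddCommGroup P] [Module K P]

/-- The linear map that sends `dyad J v w` to `g v w`. -/
noncomputable def dyadMap (g : (Fin n → K) →ₗ[K] (Fin n → K) →ₗ[K] P) :
    Matrix (Fin n) (Fin n) K →ₗ[K] P :=
  ∑ i, ∑ j, (LinearMap.toSpanSingleton K P (g (Pi.single i 1) (Pi.single j 1))) ∘ₗ
    (Matrix.entryLinearMap K K i j) ∘ₗ LinearMap.mulRight K J⁻¹

theorem dyadMap_apply (g : (Fin n → K) →ₗ[K] (Fin n → K) →ₗ[K] P)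
    (M : Matrix (Fin n) (Fin n) K) :
    dyadMap J g M = ∑ i, ∑ j, (M * J⁻¹) i j • g (Pi.single i 1) (Pi.single j 1) := by
  simp [dyadMap]

variable {J} (hJ : IsUnit J.det)
include hJ

theorem dyadMap_compr₂ (f : Matrix (Fin n) (Fin n) K →ₗ[K] P) :
    dyadMap J ((dyad J).compr₂ f) = f := by
  ext1 M
  have h : M = ∑ i, ∑ j, (M * J⁻¹) i j • dyad J (Pi.single i 1) (Pi.single j 1) := by
    conv_lhs => rw [← Matrix.nonsing_inv_mul_cancel_right J M hJ,
      Matrix.matrix_eq_sum_single (M * J⁻¹), Finset.sum_mul]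
    refine Finset.sum_congr rfl fun i _ => ?_
    rw [Finset.sum_mul]
    refine Finset.sum_congr rfl fun j _ => ?_
    rw [dyad_apply, ← Matrix.smul_mul]
    congr 1
    ext a b
    simp [Matrix.single_apply, Matrix.vecMulVec_apply, Pi.single_apply, eq_comm, ite_and]
    split_ifs <;> rfl
  conv_rhs => rw [h]
  simp only [dyadMap_apply, map_sum, map_smul, LinearMap.compr₂_apply]

theorem dyadMap_dyad (g : (Fin n → K) →ₗ[K] (Fin n → K) →ₗ[K] P) (v w : Fin n → K) :
    dyadMap J g (dyad J v w) = g v w := by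
  have h : (dyad J).compr₂ (dyadMap J g) = g := by
    refine (Pi.basisFun K (Fin n)).ext fun a => (Pi.basisFun K (Fin n)).ext fun b => ?_
    simp only [Pi.basisFun_apply, LinearMap.compr₂_apply, dyadMap_apply]
    rw [dyad_apply, Matrix.mul_nonsing_inv_cancel_right _ _ hJ]
    simp [Matrix.vecMulVec_apply, Pi.single_apply, ite_smul]
  exact LinearMap.congr_fun₂ h v w

theorem span_dyad : Submodule.span K (Set.range fun p : (Fin n → K) × (Fin n → K) =>
    dyad J p.1 p.2) = (⊤ : Submodule K (Matrix (Fin n) (Fin n) K)) := by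
  rw [eq_top_iff]
  intro M _
  rw [← LinearMap.id_apply (R := K) M, ← dyadMap_compr₂ hJ LinearMap.id, dyadMap_apply]
  exact Submodule.sum_mem _ fun i _ => Submodule.sum_mem _ fun j _ =>
    Submodule.smul_mem _ _ (Submodule.subset_span ⟨(_, _), rfl⟩)

variable (hs : J.transpose = J)
include hs

/-- The difference of the two maps is alternating on pairs of vectors, and pairing it with a
symmetric tensor gives zero in every characteristic. -/
theorem dyadMap_eq_of_symm {f : Matrix (Fin n) (Fin n) K →ₗ[K] P}
    {g : (Fin n → K) →ₗ[K] (Fin n → K) →ₗ[K] P} (h : ∀ v, f (dyad J v v) = g v v)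
    {M : Matrix (Fin n) (Fin n) K} (hM : (J * M).transpose = J * M) :
    dyadMap J g M = f M := by
  have hY : (M * J⁻¹).transpose = M * J⁻¹ := by
    rw [Matrix.transpose_mul, hs] at hM
    rw [Matrix.transpose_mul, Matrix.transpose_nonsing_inv, hs,
      ← Matrix.mul_nonsing_inv_cancel_right J M.transpose hJ, hM, Matrix.mul_assoc J,
      Matrix.nonsing_inv_mul_cancel_left _ _ hJ]
  have hx : ∀ v w, (f (dyad J v w) - g v w) + (f (dyad J w v) - g w v) = 0 := by
    intro v w
    have h1 := h (v + w)
    simp only [map_add, LinearMap.add_apply, h v, h w] at h1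
    rw [← sub_eq_zero] at h1
    rw [← h1]
    abel
  have h0 := sum_smul_eq_zero_of_symm_of_alt (R := K) (fun i j => (M * J⁻¹) i j)
    (fun i j => f (dyad J (Pi.single i 1) (Pi.single j 1)) - g (Pi.single i 1) (Pi.single j 1))
    (fun i j => congrFun (congrFun hY j) i) (fun i => sub_eq_zero.mpr (h _)) (fun i j => hx _ _)
  simp only [smul_sub, Finset.sum_sub_distrib] at h0
  rw [← dyadMap_compr₂ hJ f, dyadMap_apply, dyadMap_apply]
  exact (sub_eq_zero.mp h0).symm

end Dyad

/-! ### The Clifford relations in terms of vectors -/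

section EvenHom

variable {K : Type*} [Field K] {n : ℕ} {J : Matrix (Fin n) (Fin n) K} (hJ : IsUnit J.det)
  (hs : J.transpose = J) {L : Matrix (Fin n) (Fin n) K}
  {P : Type*} [Ring P] [Algebra K P] (g : CliffordAlgebra.EvenHom (matrixForm J L) P)
include hJ hs

theorem dyadMap_evenHom {M : Matrix (Fin n) (Fin n) K} (hM : (J * M).transpose = J * M) :
    dyadMap J g.bilin M = algebraMap K P (L * M).trace := by
  refine dyadMap_eq_of_symm hJ hs (f := Algebra.linearMap K P ∘ₗ
    Matrix.traceLinearMap (Fin n) K K ∘ₗ LinearMap.mulLeft K L) (fun v => ?_) hM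
  rw [g.contract, matrixForm_apply]
  rfl

omit hs in
-- The defect of the second relation is expanded with coefficients that involve `U` only through
-- `sand U`. The hypothesis on `sand U` in the relation then says that they are symmetric in `j` and
-- `k`.
theorem mulMap₂_dyadMap (g : (Fin n → K) →ₗ[K] (Fin n → K) →ₗ[K] P)
    (U : Matrix (Fin n) (Fin n) K ⊗[K] Matrix (Fin n) (Fin n) K) :
    mulMap₂ (dyadMap J g) U - dyadMap J g (sand U L) =
      ∑ i, ∑ l, ∑ j, ∑ k, (sand U (J⁻¹ * Matrix.single j k 1) * J⁻¹) i l •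
        (g (Pi.single i 1) (Pi.single j 1) * g (Pi.single k 1) (Pi.single l 1) -
          (J * L) j k • g (Pi.single i 1) (Pi.single l 1)) := by
  induction U using TensorProduct.induction_on with
  | zero => simp
  | add U U' h h' =>
    simp only [map_add, LinearMap.add_apply, Matrix.add_mul, Matrix.add_apply, add_smul,
      Finset.sum_add_distrib, ← h, ← h']
    abel
  | tmul M M' =>
    have h1 : ∀ i l j k, (sand (F := K) (M ⊗ₜ M') (J⁻¹ * Matrix.single j k 1) * J⁻¹) i l =
        (M * J⁻¹) i j * (M' * J⁻¹) k l := by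
      intro i l j k
      have : sand (F := K) (M ⊗ₜ M') (J⁻¹ * Matrix.single j k 1) * J⁻¹ =
          (M * J⁻¹) * Matrix.single j k 1 * (M' * J⁻¹) := by
        simp only [sand_tmul, Matrix.mul_assoc]
      rw [this, Matrix.mul_apply, Finset.sum_eq_single k]
      · simp
      · intro b _ hb
        simp [Matrix.mul_single_apply_of_ne, hb]
      · simp
    have h2 : ∀ i l, (M * (L * M') * J⁻¹) i l =
        ∑ j, ∑ k, (M * J⁻¹) i j * (M' * J⁻¹) k l * (J * L) j k := by
      intro i l
      have : M * (L * M') * J⁻¹ = (M * J⁻¹) * ((J * L) * (M' * J⁻¹)) := by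
        rw [Matrix.mul_assoc M J⁻¹, Matrix.mul_assoc J L,
          Matrix.nonsing_inv_mul_cancel_left _ _ hJ]
        simp only [Matrix.mul_assoc]
      rw [this, Matrix.mul_apply]
      refine Finset.sum_congr rfl fun j _ => ?_
      rw [Matrix.mul_apply (M := J * L), Finset.mul_sum]
      exact Finset.sum_congr rfl fun k _ => by ring
    have h3 : dyadMap J g M * dyadMap J g M' = ∑ i, ∑ l, ∑ j, ∑ k,
        ((M * J⁻¹) i j * (M' * J⁻¹) k l) •
          (g (Pi.single i 1) (Pi.single j 1) * g (Pi.single k 1) (Pi.single l 1)) := by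
      rw [dyadMap_apply, dyadMap_apply, Finset.sum_mul]
      refine Finset.sum_congr rfl fun i _ => ?_
      rw [Finset.sum_mul]
      refine Eq.trans ?_ Finset.sum_comm
      refine Finset.sum_congr rfl fun j _ => ?_
      rw [Finset.mul_sum]
      refine Eq.trans ?_ Finset.sum_comm
      refine Finset.sum_congr rfl fun k _ => ?_
      rw [Finset.mul_sum]
      refine Finset.sum_congr rfl fun l _ => ?_
      rw [smul_mul_smul_comm]
    simp only [h1]
    rw [mulMap₂_tmul, h3, sand_tmul, dyadMap_apply]
    simp only [h2, smul_sub, Finset.sum_sub_distrib, Finset.sum_smul, smul_smul]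

/-- The coefficients are symmetric in the two middle indices, while the relation `(uv)(vw) = q(v)
uw` makes the terms alternating in them. -/
theorem mulMap₂_dyadMap_evenHom
    {U : Matrix (Fin n) (Fin n) K ⊗[K] Matrix (Fin n) (Fin n) K}
    (hU : ∀ X, sand U (J⁻¹ * X.transpose * J) = sand U X) :
    mulMap₂ (dyadMap J g.bilin) U = dyadMap J g.bilin (sand U L) := by
  rw [← sub_eq_zero, mulMap₂_dyadMap hJ (L := L)]
  refine Finset.sum_eq_zero fun i _ => Finset.sum_eq_zero fun l _ => ?_
  have hx : ∀ v, g.bilin (Pi.single i 1) v * g.bilin v (Pi.single l 1) -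
      Matrix.toBilin' (J * L) v v • g.bilin (Pi.single i 1) (Pi.single l 1) = 0 := by
    intro v
    rw [g.contract_mid, sub_eq_zero]
    rfl
  have hb : ∀ j k, (J * L) j k = Matrix.toBilin' (J * L) (Pi.single j 1) (Pi.single k 1) :=
    fun j k => (Matrix.toBilin'_single _ j k).symm
  simp only [hb]
  refine sum_smul_eq_zero_of_symm_of_alt (R := K) _ (fun j k =>
    g.bilin (Pi.single i 1) (Pi.single j 1) * g.bilin (Pi.single k 1) (Pi.single l 1) -
      Matrix.toBilin' (J * L) (Pi.single j 1) (Pi.single k 1) •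
        g.bilin (Pi.single i 1) (Pi.single l 1)) (fun j k => ?_) (fun j => hx _) (fun j k => ?_)
  · rw [← hU]
    rw [Matrix.transpose_mul, Matrix.transpose_nonsing_inv, hs, Matrix.transpose_single,
      ← Matrix.mul_assoc, Matrix.nonsing_inv_mul_cancel_right _ _ hJ]
  · have h1 := hx (Pi.single j 1 + Pi.single k 1)
    have h2 := hx (Pi.single j 1)
    have h3 := hx (Pi.single k 1)
    simp only [map_add, LinearMap.add_apply, add_mul, mul_add, add_smul] at h1
    linear_combination (norm := abel) h1 - h2 - h3

end EvenHom

/-! ### Comparison of the Clifford algebra with the even Clifford algebra of `q` -/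

section TensorSquare

variable {F K X Xh : Type*} [Field F] [Field K] [Algebra F K]
  [AddCommGroup X] [Module F X] [AddCommGroup Xh] [Module F Xh] [Module K Xh]
  [IsScalarTower F K Xh]

theorem exists_isBaseChange_tensorSquare {i : X →ₗ[F] Xh} (hi : IsBaseChange K i) :
    ∃ j : X ⊗[F] X →ₗ[F] Xh ⊗[K] Xh, IsBaseChange K j ∧ ∀ x y, j (x ⊗ₜ y) = i x ⊗ₜ i y := by
  let E : K ⊗[F] (X ⊗[F] X) ≃ₗ[K] Xh ⊗[K] Xh :=
    (TensorProduct.AlgebraTensorModule.distribBaseChange F K X X).trans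
      (TensorProduct.congr hi.equiv hi.equiv)
  refine ⟨(E.toLinearMap.restrictScalars F) ∘ₗ TensorProduct.mk F K _ 1,
    IsBaseChange.of_equiv E fun _ => rfl, fun x y => ?_⟩
  change TensorProduct.congr hi.equiv hi.equiv
    (TensorProduct.AlgebraTensorModule.distribBaseChange F K X X (1 ⊗ₜ (x ⊗ₜ y))) = _
  rw [TensorProduct.AlgebraTensorModule.distribBaseChange_tmul, TensorProduct.congr_tmul,
    hi.equiv_tmul, hi.equiv_tmul, one_smul, one_smul]

end TensorSquare

section Clifford

variable {F : Type u} [Field F] {A : Type v} [Ring A] [Algebra F A] {n : ℕ}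
  {K : Type w} [Field K] [Algebra F K]
  {ρ : A →ₐ[F] Matrix (Fin n) (Fin n) K} (hρ : IsBaseChange K ρ.toLinearMap)
  {J : Matrix (Fin n) (Fin n) K} (hJ : IsUnit J.det) (hs : J.transpose = J)
  {Q : QuadraticPair F F A n}
  (hadj : ∀ a, J * ρ (Q.σ a) = (ρ a).transpose * J)
  (hT : ∀ a, algebraMap F K (reducedTrace F F A a) = (ρ a).trace)

theorem rep_sand {ρ₂ : A ⊗[F] A →ₗ[F] Matrix (Fin n) (Fin n) K ⊗[K] Matrix (Fin n) (Fin n) K}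
    (hρ₂ : ∀ a b, ρ₂ (a ⊗ₜ b) = ρ.toLinearMap a ⊗ₜ ρ.toLinearMap b) (u : A ⊗[F] A) (x : A) :
    ρ (sand u x) = sand (ρ₂ u) (ρ x) := by
  induction u using TensorProduct.induction_on with
  | zero => simp
  | tmul a b =>
    rw [hρ₂, sand_tmul, sand_tmul, map_mul, map_mul]
    rfl
  | add x y hx hy => simp only [map_add, LinearMap.add_apply, hx, hy]

include hJ hadj in
theorem rep_involution (a : A) : ρ (Q.σ a) = J⁻¹ * (ρ a).transpose * J := by
  rw [Matrix.mul_assoc, ← hadj, Matrix.nonsing_inv_mul_cancel_left _ _ hJ]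

include hρ hJ hadj in
theorem mem_span_rep_sym {M : Matrix (Fin n) (Fin n) K} (hM : M.transpose * J = J * M) :
    M ∈ Submodule.span K (ρ '' (Q.σ.sym : Set A)) := by
  let T : Matrix (Fin n) (Fin n) K →ₗ[K] Matrix (Fin n) (Fin n) K :=
    LinearMap.mulRight K J ∘ₗ (Matrix.transposeLinearEquiv (Fin n) (Fin n) K K).toLinearMap -
      LinearMap.mulLeft K J
  have hTa : ∀ M, J⁻¹ * T M = J⁻¹ * M.transpose * J - M := by
    intro M
    change J⁻¹ * (M.transpose * J - J * M) = _
    rw [mul_sub, Matrix.nonsing_inv_mul_cancel_left _ _ hJ, Matrix.mul_assoc]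
  have h := mem_span_of_forall_eq_zero hρ hρ (T := Unit) (fun _ => Q.σ.toLin - LinearMap.id)
    (fun _ => LinearMap.mulLeft K J⁻¹ ∘ₗ T)
    (fun _ a => by
      change J⁻¹ * T (ρ a) = ρ (Q.σ a - a)
      rw [hTa, map_sub, rep_involution hJ hadj]) (x := M)
    (fun _ => by
      change J⁻¹ * (M.transpose * J - J * M) = 0
      rw [hM, sub_self, Matrix.mul_zero])
  refine Submodule.span_mono ?_ h
  rintro _ ⟨b, hb, rfl⟩
  exact ⟨b, sub_eq_zero.mp (hb ()), rfl⟩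

include hs in
theorem transpose_dyad_self (v : Fin n → K) :
    (dyad J v v).transpose * J = J * dyad J v v := by
  rw [dyad_apply, Matrix.transpose_mul, hs, Matrix.transpose_vecMulVec, Matrix.mul_assoc]

include hρ hJ hadj hT in
theorem trace_rep_mul_eq {l l' : A} (hl : Q.σ.Determines F l Q.f)
    (hl' : Q.σ.Determines F l' Q.f) {M : Matrix (Fin n) (Fin n) K}
    (hM : M.transpose * J = J * M) : (ρ l * M).trace = (ρ l' * M).trace := by
  have h := mem_span_rep_sym hρ hJ hadj hM
  clear hM
  induction h using Submodule.span_induction with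
  | mem x hx =>
    obtain ⟨s, hs, rfl⟩ := hx
    rw [← map_mul, ← map_mul, ← hT, ← hT]
    have h1 := LinearMap.congr_fun hl.2 ⟨s, hs⟩
    have h2 := LinearMap.congr_fun hl'.2 ⟨s, hs⟩
    exact congrArg _ (h1.symm.trans h2)
  | zero => simp
  | add x y _ _ hx hy => rw [mul_add, mul_add, Matrix.trace_add, Matrix.trace_add, hx, hy]
  | smul k x _ hx => rw [Matrix.mul_smul, Matrix.mul_smul, Matrix.trace_smul, Matrix.trace_smul, hx]

include hρ hJ hs hadj hT in
-- The relations of the Clifford algebra involve every `l` that determines the semi-trace, so one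
-- quadratic form has to serve them all.
theorem matrixForm_rep_eq {l l' : A} (hl : Q.σ.Determines F l Q.f)
    (hl' : Q.σ.Determines F l' Q.f) : matrixForm J (ρ l) = matrixForm J (ρ l') := by
  ext v
  rw [matrixForm_apply, matrixForm_apply]
  exact trace_rep_mul_eq hρ hJ hadj hT hl hl' (transpose_dyad_self hs v)

variable {l : A} (hl : Q.σ.Determines F l Q.f)

section Lift

variable {P : Type*} [Ring P] [Algebra K P] [Algebra F P] [IsScalarTower F K P]
  (g : CliffordAlgebra.EvenHom (matrixForm J (ρ l)) P)

include hρ hJ hs hadj hT hl in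
theorem exists_clifford_lift : ∃ φ : Q.Clifford →ₐ[F] P, ∀ a, φ (Q.c a) = dyadMap J g.bilin (ρ a) := by
  let γ : A →ₗ[F] P := (dyadMap J g.bilin).restrictScalars F ∘ₗ ρ.toLinearMap
  obtain ⟨ρ₂, hρ₂, hρ₂'⟩ := exists_isBaseChange_tensorSquare hρ
  have hmul : ∀ u, mulMap₂ γ u = mulMap₂ (dyadMap J g.bilin) (ρ₂ u) := by
    intro u
    induction u using TensorProduct.induction_on with
    | zero => simp
    | tmul a b =>
      rw [hρ₂', mulMap₂_tmul, mulMap₂_tmul]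
      rfl
    | add x y hx hy => simp only [map_add, hx, hy]
  have hsand := rep_sand hρ₂'
  have hlift : ∀ u, TensorAlgebra.lift F γ (mulMap₂ (TensorAlgebra.ι F) u) = mulMap₂ γ u := by
    intro u
    induction u using TensorProduct.induction_on with
    | zero => simp
    | tmul a b => simp
    | add x y hx hy => simp only [map_add, hx, hy]
  have hrel : ∀ ⦃x y⦄, Q.CliffordRel x y → TensorAlgebra.lift F γ x = TensorAlgebra.lift F γ y := by
    intro x y hxy
    cases hxy with
    | sym s =>
      rw [TensorAlgebra.lift_ι_apply, AlgHom.commutes, IsScalarTower.algebraMap_apply F K P]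
      have h1 : Q.f s = reducedTrace F F A (l * s) := LinearMap.congr_fun hl.2 s
      rw [h1, hT, map_mul]
      refine dyadMap_evenHom hJ hs g ?_
      have h2 : Q.σ (s : A) = s := s.2
      change (J * ρ s).transpose = J * ρ s
      rw [Matrix.transpose_mul, hs, ← hadj, h2]
    | sand u hu l' hl' =>
      rw [hlift, hmul, TensorAlgebra.lift_ι_apply]
      change _ = dyadMap J g.bilin (ρ (sand u l'))
      rw [hsand]
      have hq := matrixForm_rep_eq hρ hJ hs hadj hT hl hl'
      -- The type of `g` depends on the quadratic form, so the form is made a variable before `l` is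
      -- replaced by `l'`.
      have key : ∀ (q : QuadraticForm K (Fin n → K)) (g : CliffordAlgebra.EvenHom q P),
          q = matrixForm J (ρ l') → mulMap₂ (dyadMap J g.bilin) (ρ₂ u) =
            dyadMap J g.bilin (sand (ρ₂ u) (ρ l')) := by
        rintro q g rfl
        refine mulMap₂_dyadMap_evenHom hJ hs g fun X => ?_
        have hX : X ∈ Submodule.span K (Set.range ρ.toLinearMap) := by
          rw [span_range_eq_top_of_isBaseChange hρ]
          exact Submodule.mem_top
        induction hX using Submodule.span_induction with
        | mem x hx =>
          obtain ⟨a, rfl⟩ := hx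
          change sand (ρ₂ u) (J⁻¹ * (ρ a).transpose * J) = sand (ρ₂ u) (ρ a)
          rw [← rep_involution hJ hadj, ← hsand, ← hsand, hu]
        | zero => simp
        | add x y _ _ hx hy => rw [Matrix.transpose_add, mul_add, add_mul, map_add, map_add, hx, hy]
        | smul k x _ hx =>
          rw [Matrix.transpose_smul, Matrix.mul_smul, Matrix.smul_mul, map_smul, map_smul, hx]
      exact key _ g hq
  refine ⟨RingQuot.liftAlgHom F ⟨TensorAlgebra.lift F γ, hrel⟩, fun a => ?_⟩
  refine (RingQuot.liftAlgHom_mkAlgHom_apply F (TensorAlgebra.lift F γ) hrel _).trans ?_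
  rw [TensorAlgebra.lift_ι_apply]
  rfl

end Lift

include hρ hJ hs hadj hT hl in
theorem exists_evenHom : ∃ g : CliffordAlgebra.EvenHom (matrixForm J (ρ l)) (K ⊗[F] Q.Clifford),
    ∀ a, dyadMap J g.bilin (ρ a) = 1 ⊗ₜ Q.c a := by
  let c' : A →ₗ[F] K ⊗[F] Q.Clifford := TensorProduct.mk F K Q.Clifford 1 ∘ₗ Q.c
  let cK : Matrix (Fin n) (Fin n) K →ₗ[K] K ⊗[F] Q.Clifford := hρ.lift c'
  have hcK : ∀ a, cK (ρ a) = 1 ⊗ₜ Q.c a := fun a => hρ.lift_eq c' a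
  obtain ⟨ρ₂, hρ₂, hρ₂'⟩ := exists_isBaseChange_tensorSquare hρ
  have hsand := rep_sand hρ₂'
  have hmul : ∀ u, mulMap₂ cK (ρ₂ u) = 1 ⊗ₜ mulMap₂ Q.c u := by
    intro u
    induction u using TensorProduct.induction_on with
    | zero => simp
    | tmul a b =>
      rw [hρ₂', mulMap₂_tmul, mulMap₂_tmul]
      change cK (ρ a) * cK (ρ b) = _
      rw [hcK, hcK, Algebra.TensorProduct.tmul_mul_tmul, one_mul]
    | add x y hx hy => simp only [map_add, TensorProduct.tmul_add, hx, hy]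
  have hsym : ∀ M, M.transpose * J = J * M → cK M = algebraMap K _ (ρ l * M).trace := by
    intro M hM
    have h := mem_span_rep_sym hρ hJ hadj hM
    clear hM
    induction h using Submodule.span_induction with
    | mem x hx =>
      obtain ⟨s, hs, rfl⟩ := hx
      have h1 : Q.f ⟨s, hs⟩ = reducedTrace F F A (l * s) := LinearMap.congr_fun hl.2 ⟨s, hs⟩
      have h2 := Q.c_sym ⟨s, hs⟩
      rw [hcK, ← map_mul, ← hT, ← h1]
      refine (congrArg (fun y => (1 : K) ⊗ₜ[F] y) h2).trans ?_
      rw [Algebra.algebraMap_eq_smul_one, TensorProduct.tmul_smul, ← Algebra.TensorProduct.one_def,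
        ← Algebra.algebraMap_eq_smul_one, ← IsScalarTower.algebraMap_apply]
    | zero => simp
    | add x y _ _ hx hy => rw [mul_add, Matrix.trace_add, map_add, map_add, hx, hy]
    | smul k x _ hx =>
      rw [Matrix.mul_smul, Matrix.trace_smul, map_smul, hx, smul_eq_mul, map_mul, Algebra.smul_def]
  have hmid : ∀ v₁ v₂ v₃, cK (dyad J v₁ v₂) * cK (dyad J v₂ v₃) =
      matrixForm J (ρ l) v₂ • cK (dyad J v₁ v₃) := by
    intro v₁ v₂ v₃
    -- The tensor `(v₁ ⊗ v₂)(v₂ ⊗ v₃)` satisfies the symmetry condition over `K` because `b(v₂, σ(t)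
    -- v₂) = b(v₂, t v₂)`. So it is a `K`-combination of tensors over `F` to which the Clifford
    -- relation applies.
    have hU := mem_span_of_forall_eq_zero hρ₂ hρ
      (fun t => (sand (F := F) (A := A)).flip (Q.σ t) - (sand (F := F) (A := A)).flip t)
      (fun t => (sand (F := K) (A := Matrix (Fin n) (Fin n) K)).flip (ρ (Q.σ t)) -
        (sand (F := K) (A := Matrix (Fin n) (Fin n) K)).flip (ρ t))
      (fun t u => by
        change sand (ρ₂ u) (ρ (Q.σ t)) - sand (ρ₂ u) (ρ t) = ρ (sand u (Q.σ t) - sand u t)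
        rw [map_sub, hsand, hsand])
      (x := dyad J v₁ v₂ ⊗ₜ dyad J v₂ v₃) (fun t => by
        change sand (F := K) (dyad J v₁ v₂ ⊗ₜ dyad J v₂ v₃) (ρ (Q.σ t)) -
          sand (F := K) (dyad J v₁ v₂ ⊗ₜ dyad J v₂ v₃) (ρ t) = 0
        rw [sand_tmul, sand_tmul, dyad_mul_mul_dyad, dyad_mul_mul_dyad, hadj, ← sub_smul,
          Matrix.toBilin'_apply', Matrix.toBilin'_apply']
        have h1 : (ρ t).transpose * J = (J * ρ t).transpose := by rw [Matrix.transpose_mul, hs]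
        rw [h1, Matrix.mulVec_transpose, dotProduct_comm, ← Matrix.dotProduct_mulVec, sub_self,
          zero_smul])
    have key : ∀ U ∈ Submodule.span K (ρ₂ '' {u | ∀ t, ((sand (F := F) (A := A)).flip (Q.σ t) -
        (sand (F := F) (A := A)).flip t) u = 0}), mulMap₂ cK U = cK (sand U (ρ l)) := by
      intro U hU
      induction hU using Submodule.span_induction with
      | mem x hx =>
        obtain ⟨u, hu, rfl⟩ := hx
        rw [hmul, ← hsand, hcK, Q.c_sand u (fun x => sub_eq_zero.mp (hu x)) l hl]
      | zero => simp
      | add x y _ _ hx hy => rw [map_add, map_add, LinearMap.add_apply, map_add, hx, hy]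
      | smul k x _ hx => rw [map_smul, map_smul, LinearMap.smul_apply, map_smul, hx]
    have h := key _ hU
    rw [mulMap₂_tmul, sand_tmul, dyad_mul_mul_dyad, map_smul] at h
    exact h
  refine ⟨⟨(dyad J).compr₂ cK, fun v => ?_, hmid⟩, fun a => ?_⟩
  · rw [matrixForm_apply]
    exact hsym _ (transpose_dyad_self hs v)
  · change dyadMap J ((dyad J).compr₂ cK) (ρ a) = _
    rw [dyadMap_compr₂ hJ, hcK]

end Clifford

/-! ### The quadratic form `q` and the action of its half-spin modules -/

section MatrixForm

variable {K : Type*} [Field K] {n : ℕ} {J L : Matrix (Fin n) (Fin n) K}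

theorem polar_matrixForm (hL : J * L + (J * L).transpose = J) (v w : Fin n → K) :
    QuadraticMap.polar (matrixForm J L) v w = Matrix.toBilin' J v w := by
  have h : QuadraticMap.polar (matrixForm J L) v w =
      Matrix.toBilin' (J * L) v w + Matrix.toBilin' (J * L) w v :=
    LinearMap.BilinMap.polar_toQuadraticMap _ _
  have h2 : Matrix.toBilin' (J * L) w v = Matrix.toBilin' (J * L).transpose v w := by
    rw [Matrix.toBilin'_apply', Matrix.toBilin'_apply', Matrix.mulVec_transpose,
      Matrix.dotProduct_mulVec, dotProduct_comm]
  rw [h, h2, ← LinearMap.add_apply, ← LinearMap.add_apply, ← map_add, hL]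

theorem nondegenerate_matrixForm (hJ : IsUnit J.det) (hL : J * L + (J * L).transpose = J)
    {v : Fin n → K} (hv : ∀ w, QuadraticMap.polar (matrixForm J L) v w = 0) : v = 0 := by
  simp only [polar_matrixForm hL] at hv
  exact (LinearMap.BilinForm.nondegenerate_toBilin'_of_det_ne_zero' _ hJ.ne_zero).1 v hv

theorem exists_matrixForm_ne_zero [NeZero n] (hJ : IsUnit J.det)
    (hL : J * L + (J * L).transpose = J) : ∃ w, matrixForm J L w ≠ 0 := by
  by_contra! h
  have h1 := nondegenerate_matrixForm hJ hL (v := Pi.single 0 1)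
    (fun w => by simp [QuadraticMap.polar, h])
  simpa using congrFun h1 0

end MatrixForm

section AdjointEvenHom

variable {K : Type*} [Field K] {n N : ℕ} {I : Type*} {J : Matrix (Fin n) (Fin n) K}

/-- On dyads the involution exchanges `v` and `w`, and dyads span the matrix algebra. -/
theorem dyadMap_adjoint (hJ : IsUnit J.det) (hs : J.transpose = J)
    {g : (Fin n → K) →ₗ[K] (Fin n → K) →ₗ[K] (I → Matrix (Fin N) (Fin N) K)}
    {H : I → Matrix (Fin N) (Fin N) K}
    (hH : ∀ i v w, H i * g v w i = (g w v i).transpose * H i)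
    (i : I) (M : Matrix (Fin n) (Fin n) K) :
    H i * dyadMap J g (J⁻¹ * M.transpose * J) i = (dyadMap J g M i).transpose * H i := by
  have hM : M ∈ Submodule.span K (Set.range fun p : (Fin n → K) × (Fin n → K) =>
    dyad J p.1 p.2) := by
    rw [span_dyad hJ]
    exact Submodule.mem_top
  induction hM using Submodule.span_induction with
  | mem x hx =>
    obtain ⟨⟨v, w⟩, rfl⟩ := hx
    have h1 : J⁻¹ * (dyad J v w).transpose * J = dyad J w v := by
      rw [dyad_apply, Matrix.transpose_mul, hs, Matrix.transpose_vecMulVec,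
        Matrix.nonsing_inv_mul_cancel_left _ _ hJ, dyad_apply]
    rw [h1, dyadMap_dyad hJ, dyadMap_dyad hJ, hH]
  | zero => simp
  | add x y _ _ hx hy =>
    rw [Matrix.transpose_add, mul_add, add_mul, map_add, map_add, Pi.add_apply, Pi.add_apply,
      mul_add, hx, hy, Matrix.transpose_add, add_mul]
  | smul k x _ hx =>
    rw [Matrix.transpose_smul, Matrix.mul_smul, Matrix.smul_mul, map_smul, map_smul, Pi.smul_apply,
      Pi.smul_apply, Matrix.mul_smul, hx, Matrix.transpose_smul, Matrix.smul_mul]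

end AdjointEvenHom

section SpinEvenHom

variable {K V : Type*} [Field K] [AddCommGroup V] [Module K V] {q : QuadraticForm K V} {N k : ℕ}
  {sp sm : V →ₗ[K] Matrix (Fin N) (Fin N) K} {J J' : Matrix (Fin N) (Fin N) K}

/-- The representations of the even Clifford algebra on the half-spin modules. -/
def IsSpinRep.evenHom (h : IsSpinRep q k sp sm J J') :
    CliffordAlgebra.EvenHom q (Matrix (Fin N) (Fin N) K × Matrix (Fin N) (Fin N) K) where
  bilin := LinearMap.mk₂ K (fun v w => (sm v * sp w, sp v * sm w))
    (fun v v' w => by simp only [map_add, add_mul, Prod.mk_add_mk])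
    (fun c v w => by simp only [map_smul, smul_mul_assoc, Prod.smul_mk])
    (fun v w w' => by simp only [map_add, mul_add, Prod.mk_add_mk])
    (fun c v w => by simp only [map_smul, mul_smul_comm, Prod.smul_mk])
  contract v := by
    simp only [LinearMap.mk₂_apply, h.sm_mul_sp, h.sp_mul_sm]
    rw [← Prod.smul_mk, ← Prod.one_eq_mk, ← Algebra.algebraMap_eq_smul_one]
  contract_mid u v w := by
    simp only [LinearMap.mk₂_apply, Prod.mk_mul_mk, Prod.smul_mk]
    congr 1
    · rw [mul_assoc, ← mul_assoc (sp v), h.sp_mul_sm, smul_mul_assoc, one_mul, mul_smul_comm]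
    · rw [mul_assoc, ← mul_assoc (sm v), h.sm_mul_sp, smul_mul_assoc, one_mul, mul_smul_comm]

/-- Pairs as functions on a set with two elements. -/
def pairEquiv (K R : Type*) [CommSemiring K] [Semiring R] [Algebra K R] :
    (R × R) ≃ₐ[K] (Fin 2 → R) :=
  AlgEquiv.ofRingEquiv (f := (RingEquiv.piFinTwo fun _ => R).symm) fun c => by
    ext i
    fin_cases i <;> rfl

theorem IsSpinRep.exists_evenHom (h : IsSpinRep q k sp sm J J') :
    ∃ (g : CliffordAlgebra.EvenHom q (Fin 2 → Matrix (Fin N) (Fin N) K))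
      (H : Fin 2 → Matrix (Fin N) (Fin N) K),
      Algebra.adjoin K (Set.range fun p : V × V => g.bilin p.1 p.2) = ⊤ ∧
      (∀ i, IsUnit (H i).det) ∧
      (Even k → (∀ i v w, H i * g.bilin v w i = (g.bilin w v i).transpose * H i) ∧
        ∀ i, (H i).transpose = (-1 : K) ^ (k * (k + 1) / 2) • H i) := by
  let E := pairEquiv K (Matrix (Fin N) (Fin N) K)
  have h0 : ∀ x, E x 0 = x.1 := fun x => rfl
  have h1 : ∀ x, E x 1 = x.2 := fun x => rfl
  refine ⟨h.evenHom.compr₂ E, ![J, J'], ?_, ?_, fun hk => ⟨?_, ?_⟩⟩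
  · have h2 := congrArg (Subalgebra.map E.toAlgHom) h.adjoin_eq_top
    rw [AlgHom.map_adjoin, ← Set.range_comp, Algebra.map_top,
      (AlgHom.range_eq_top _).mpr E.surjective] at h2
    exact h2
  · intro i
    fin_cases i
    · exact (Matrix.isUnit_iff_isUnit_det _).mp h.isUnit_left
    · exact (Matrix.isUnit_iff_isUnit_det _).mp h.isUnit_right
  · obtain ⟨hsm, hsp, -, -⟩ := h.even hk
    intro i v w
    fin_cases i
    · change J * (sm v * sp w) = (sm w * sp v).transpose * J
      rw [← mul_assoc, hsm, mul_assoc, hsp, Matrix.transpose_mul, mul_assoc]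
    · change J' * (sp v * sm w) = (sp w * sm v).transpose * J'
      rw [← mul_assoc, hsp, mul_assoc, hsm, Matrix.transpose_mul, mul_assoc]
  · obtain ⟨-, -, hJ, hJ'⟩ := h.even hk
    intro i
    fin_cases i
    · exact hJ
    · exact hJ'

end SpinEvenHom

/-! ### Splitting of the Clifford algebra and its canonical involution -/

section CliffordSplit

variable {F : Type u} [Field F] {A : Type v} [Ring A] [Algebra F A] {n : ℕ}
  {K : Type w} [Field K] [Algebra F K]

theorem adjoin_range_c (Q : QuadraticPair F F A n) :
    Algebra.adjoin F (Set.range Q.c) = ⊤ := by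
  have h := congrArg (Subalgebra.map Q.cliffordProj) (TensorAlgebra.adjoin_range_ι (R := F) (M := A))
  rw [AlgHom.map_adjoin, ← Set.range_comp, Algebra.map_top,
    (AlgHom.range_eq_top _).mpr Q.cliffordProj_surjective] at h
  exact h

theorem subalgebra_eq_top_of_c (Q : QuadraticPair F F A n) (S : Subalgebra K (K ⊗[F] Q.Clifford))
    (hS : ∀ a, 1 ⊗ₜ Q.c a ∈ S) : S = ⊤ := by
  rw [eq_top_iff]
  have h1 : ∀ x : Q.Clifford, (1 : K) ⊗ₜ[F] x ∈ S := by
    intro x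
    have hx : x ∈ Algebra.adjoin F (Set.range Q.c) := by
      rw [adjoin_range_c]
      exact Algebra.mem_top
    have h2 : Algebra.adjoin F (Set.range Q.c) ≤ (S.restrictScalars F).comap
        (Algebra.TensorProduct.includeRight : Q.Clifford →ₐ[F] K ⊗[F] Q.Clifford) := by
      refine Algebra.adjoin_le ?_
      rintro _ ⟨a, rfl⟩
      exact hS a
    exact h2 hx
  intro x _
  induction x using TensorProduct.induction_on with
  | zero => exact S.zero_mem
  | tmul k x =>
    have h2 := S.smul_mem (h1 x) k
    rwa [TensorProduct.smul_tmul', smul_eq_mul, mul_one] at h2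
  | add x y hx hy => exact S.add_mem (hx trivial) (hy trivial)

variable {ρ : A →ₐ[F] Matrix (Fin n) (Fin n) K} (hρ : IsBaseChange K ρ.toLinearMap)
  {J : Matrix (Fin n) (Fin n) K} (hJ : IsUnit J.det) (hs : J.transpose = J)
  {Q : QuadraticPair F F A n}
  (hadj : ∀ a, J * ρ (Q.σ a) = (ρ a).transpose * J)
  (hT : ∀ a, algebraMap F K (reducedTrace F F A a) = (ρ a).trace)
  {l : A} (hl : Q.σ.Determines F l Q.f)

include hs hadj hl in
theorem mul_rep_add_transpose : J * ρ l + (J * ρ l).transpose = J := by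
  rw [Matrix.transpose_mul, hs, ← hadj, ← mul_add, ← map_add, hl.1, map_one, mul_one]

include hρ hJ hs hadj hT hl in
-- The even Clifford algebra of `q`, of dimension `2^(n-1)`, maps onto `K ⊗ C`, since the image
-- contains the generators.
theorem finrank_baseChange_clifford_le [NeZero n] :
    Module.Finite K (K ⊗[F] Q.Clifford) ∧ 2 * Module.finrank K (K ⊗[F] Q.Clifford) ≤ 2 ^ n := by
  obtain ⟨g, hg⟩ := exists_evenHom hρ hJ hs hadj hT hl
  let φ := CliffordAlgebra.even.lift _ g
  have hφ : Function.Surjective φ := by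
    rw [← AlgHom.range_eq_top]
    refine subalgebra_eq_top_of_c Q _ fun a => ?_
    rw [← hg, dyadMap_apply]
    refine Subalgebra.sum_mem _ fun i _ => Subalgebra.sum_mem _ fun j _ =>
      Subalgebra.smul_mem _ ?_ _
    exact ⟨(CliffordAlgebra.even.ι _).bilin (Pi.single i 1) (Pi.single j 1),
      CliffordAlgebra.even.lift_ι _ _ _ _⟩
  obtain ⟨w, hw⟩ := exists_matrixForm_ne_zero hJ (mul_rep_add_transpose hs hadj hl)
  obtain ⟨hfin, hdim⟩ := finrank_even (q := matrixForm J (ρ l))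
    (b := Matrix.toBilin' (J * ρ l)) (fun _ => rfl) hw
  refine ⟨Module.Finite.of_surjective φ.toLinearMap hφ, ?_⟩
  rw [Module.finrank_fin_fun] at hdim
  rw [← hdim]
  exact Nat.mul_le_mul_left 2 (LinearMap.finrank_le_finrank_of_surjective (f := φ.toLinearMap) hφ)

include hρ hJ hs hadj hT hl in
-- The induced map is onto because the half-spin action generates both factors. The target has
-- dimension `2 · 4^k = 2^(n-1)`, which is the upper bound for the source.
theorem exists_clifford_split {k : ℕ} (hn : n = 2 * (k + 1))
    {g : CliffordAlgebra.EvenHom (matrixForm J (ρ l)) (Fin 2 → Matrix (Fin (2 ^ k)) (Fin (2 ^ k)) K)}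
    (hg : Algebra.adjoin K (Set.range fun p : (Fin n → K) × (Fin n → K) =>
      g.bilin p.1 p.2) = ⊤) :
    ∃ e : K ⊗[F] Q.Clifford ≃ₐ[K] (Fin 2 → Matrix (Fin (2 ^ k)) (Fin (2 ^ k)) K),
      ∀ a, splitRep e (Q.c a) = dyadMap J g.bilin (ρ a) := by
  have : NeZero n := ⟨by omega⟩
  obtain ⟨φ, hφ⟩ := exists_clifford_lift hρ hJ hs hadj hT hl g
  let Φ : K ⊗[F] Q.Clifford →ₐ[K] (Fin 2 → Matrix (Fin (2 ^ k)) (Fin (2 ^ k)) K) :=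
    Algebra.TensorProduct.lift (Algebra.ofId K _) φ (fun k _ => Algebra.commute_algebraMap_left k _)
  have hΦ : ∀ x, Φ (1 ⊗ₜ x) = φ x := by
    intro x
    refine (Algebra.TensorProduct.lift_tmul _ _ _ _ _).trans ?_
    rw [map_one, one_mul]
  have hsurj : Function.Surjective Φ := by
    rw [← AlgHom.range_eq_top, eq_top_iff, ← hg]
    refine Algebra.adjoin_le ?_
    rintro _ ⟨⟨v, w⟩, rfl⟩
    have h1 : ∀ M : Matrix (Fin n) (Fin n) K, dyadMap J g.bilin M ∈ Φ.range := by
      intro M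
      have hM : M ∈ Submodule.span K (Set.range ρ.toLinearMap) := by
        rw [span_range_eq_top_of_isBaseChange hρ]
        exact Submodule.mem_top
      induction hM using Submodule.span_induction with
      | mem x hx =>
        obtain ⟨a, rfl⟩ := hx
        exact ⟨1 ⊗ₜ Q.c a, (hΦ _).trans (hφ a)⟩
      | zero => rw [map_zero]; exact Subalgebra.zero_mem _
      | add x y _ _ hx hy => rw [map_add]; exact Subalgebra.add_mem _ hx hy
      | smul k x _ hx => rw [map_smul]; exact Subalgebra.smul_mem _ hx _
    have h2 := h1 (dyad J v w)
    rwa [dyadMap_dyad hJ] at h2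
  obtain ⟨hfin, hdim⟩ := finrank_baseChange_clifford_le hρ hJ hs hadj hT hl
  have hdim' : Module.finrank K (K ⊗[F] Q.Clifford) =
      Module.finrank K (Fin 2 → Matrix (Fin (2 ^ k)) (Fin (2 ^ k)) K) := by
    refine le_antisymm ?_ (LinearMap.finrank_le_finrank_of_surjective (f := Φ.toLinearMap) hsurj)
    have h1 : Module.finrank K (Fin 2 → Matrix (Fin (2 ^ k)) (Fin (2 ^ k)) K) =
        2 * (2 ^ k * 2 ^ k) := by
      rw [Module.finrank_pi_fintype]
      simp [Module.finrank_matrix]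
    have h2 : 2 ^ n = 2 * (2 * (2 ^ k * 2 ^ k)) := by
      rw [hn]
      ring
    rw [h1]
    omega
  have hbij : Function.Bijective Φ :=
    ⟨(LinearMap.injective_iff_surjective_of_finrank_eq_finrank (f := Φ.toLinearMap) hdim').mpr
      hsurj, hsurj⟩
  exact ⟨AlgEquiv.ofBijective Φ hbij, fun a => (hΦ _).trans (hφ a)⟩

include hJ hs hadj in
theorem splitRep_canonicalInvolution {I : Type*} {N : ℕ}
    {e : K ⊗[F] Q.Clifford ≃ₐ[K] (I → Matrix (Fin N) (Fin N) K)}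
    {g : (Fin n → K) →ₗ[K] (Fin n → K) →ₗ[K] (I → Matrix (Fin N) (Fin N) K)}
    (he : ∀ a, splitRep e (Q.c a) = dyadMap J g (ρ a))
    {H : I → Matrix (Fin N) (Fin N) K}
    (hH : ∀ i v w, H i * g v w i = (g w v i).transpose * H i) (i : I) (x : Q.Clifford) :
    H i * splitRep e (Q.canonicalInvolution x) i = (splitRep e x i).transpose * H i := by
  have hx : x ∈ Algebra.adjoin F (Set.range Q.c) := by
    rw [adjoin_range_c]
    exact Algebra.mem_top
  induction hx using Algebra.adjoin_induction with
  | mem x hx =>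
    obtain ⟨a, rfl⟩ := hx
    rw [Q.canonicalInvolution_c, he, he, rep_involution hJ hadj, dyadMap_adjoint hJ hs hH]
  | algebraMap r =>
    have h1 : Q.canonicalInvolution (algebraMap F _ r) = algebraMap F _ r := by
      rw [Algebra.algebraMap_eq_smul_one, map_smul, involution_one]
    rw [h1, AlgHom.commutes, Pi.algebraMap_apply, Algebra.algebraMap_eq_smul_one,
      Matrix.transpose_smul, Matrix.transpose_one, Matrix.mul_smul, Matrix.smul_mul, mul_one,
      one_mul]
  | add x y _ _ hx hy =>
    rw [map_add, map_add, map_add, Pi.add_apply, Pi.add_apply, mul_add, hx, hy,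
      Matrix.transpose_add, add_mul]
  | mul x y _ _ hx hy =>
    rw [Q.canonicalInvolution.map_mul, map_mul, map_mul, Pi.mul_apply, Pi.mul_apply,
      ← Matrix.mul_assoc, hy, Matrix.mul_assoc, hx, Matrix.transpose_mul, Matrix.mul_assoc]

end CliffordSplit

/-! ### Independence of the choice of `λ` -/

section TraceZero

variable {K : Type*} [Field K] {n : ℕ}

theorem eq_zero_of_trace_eq_zero {ψ : Matrix (Fin n) (Fin n) K →ₗ[K] K}
    (h : ∀ v w, v ⬝ᵥ w = 0 → ψ (Matrix.vecMulVec v w) = 0) {M : Matrix (Fin n) (Fin n) K}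
    (hM : M.trace = 0) : ψ M = 0 := by
  have h1 : ∀ i j, i ≠ j → ψ (Matrix.single i j 1) = 0 := by
    intro i j hij
    have h2 := h (Pi.single i 1) (Pi.single j 1) (by simp [hij])
    rwa [← Matrix.single_eq_single_vecMulVec_single] at h2
  have h2 : ∀ i j, ψ (Matrix.single i i 1) = ψ (Matrix.single j j 1) := by
    intro i j
    by_cases hij : i = j
    · rw [hij]
    -- This rank one matrix of trace zero is the difference of two diagonal units up to off-diagonal
    -- ones.
    have h3 := h (Pi.single i 1 + Pi.single j 1) (Pi.single i 1 - Pi.single j 1)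
      (by simp [hij, Ne.symm hij])
    rw [Matrix.add_vecMulVec, Matrix.vecMulVec_sub, Matrix.vecMulVec_sub] at h3
    simp only [← Matrix.single_eq_single_vecMulVec_single, map_add, map_sub, h1 i j hij,
      h1 j i (Ne.symm hij)] at h3
    linear_combination h3
  have h3 : ∀ i j, ψ (Matrix.single i j (M i j)) = M i j * ψ (Matrix.single i j 1) := by
    intro i j
    rw [← smul_eq_mul, ← map_smul, Matrix.smul_single, smul_eq_mul, mul_one]
  rw [Matrix.matrix_eq_sum_single M]
  simp only [map_sum, h3]
  rcases isEmpty_or_nonempty (Fin n) with _ | ⟨⟨i₀⟩⟩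
  · simp
  have h4 : ∀ i, ∑ j, M i j * ψ (Matrix.single i j 1) = M i i * ψ (Matrix.single i₀ i₀ 1) := by
    intro i
    rw [Finset.sum_eq_single i, h2 i i₀]
    · intro j _ hj
      rw [h1 i j (Ne.symm hj), mul_zero]
    · simp
  simp only [h4, ← Finset.sum_mul]
  change M.trace * _ = 0
  rw [hM, zero_mul]

end TraceZero

section Orthogonal

variable {K V : Type*} [Field K] [AddCommGroup V] [Module K V] [FiniteDimensional K V]

/-- The orthogonal complement of `v` and `w` has dimension at least `3` and its own complement has
dimension at most `2`, so `b` does not vanish on it. -/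
theorem exists_orthogonal_pair {b : LinearMap.BilinForm K V} (hb : b.Nondegenerate)
    (hsym : b.IsSymm) (hdim : 5 ≤ Module.finrank K V) (v w : V) :
    ∃ x y, b x y = 1 ∧ b x v = 0 ∧ b x w = 0 ∧ b y v = 0 ∧ b y w = 0 := by
  classical
  let S : Submodule K V := Submodule.span K {v, w}
  have hS : Module.finrank K S ≤ 2 := by
    refine (finrank_span_le_card ({v, w} : Set V)).trans ?_
    rw [Set.toFinset_insert, Set.toFinset_singleton]
    exact Finset.card_le_two
  have hv : v ∈ S := Submodule.subset_span (by simp)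
  have hw : w ∈ S := Submodule.subset_span (by simp)
  have h1 := LinearMap.BilinForm.finrank_orthogonal hb S
  have h2 := LinearMap.BilinForm.finrank_orthogonal hb (b.orthogonal S)
  have h3 : ¬ b.orthogonal S ≤ b.orthogonal (b.orthogonal S) := by
    intro h
    have := Submodule.finrank_mono h
    omega
  obtain ⟨x, hx, hx'⟩ := SetLike.not_le_iff_exists.mp h3
  rw [LinearMap.BilinForm.mem_orthogonal_iff] at hx hx'
  simp only [not_forall] at hx'
  obtain ⟨y, hy, hyx⟩ := hx'
  have hyx' : b y x ≠ 0 := hyx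
  rw [LinearMap.BilinForm.mem_orthogonal_iff] at hy
  have e : ∀ z t, b z t = b t z := fun z t => hsym.eq z t
  refine ⟨(b y x)⁻¹ • y, x, ?_, ?_, ?_, ?_, ?_⟩
  · rw [map_smul, LinearMap.smul_apply, smul_eq_mul, inv_mul_cancel₀ hyx']
  · rw [map_smul, LinearMap.smul_apply, e y v, hy v hv, smul_zero]
  · rw [map_smul, LinearMap.smul_apply, e y w, hy w hw, smul_zero]
  · rw [e]; exact hx v hv
  · rw [e]; exact hx w hw

end Orthogonal

section EvenHomRelations

variable {K V P : Type*} [Field K] [AddCommGroup V] [Module K V] [Ring P] [Algebra K P]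
  {q : QuadraticForm K V} (g : CliffordAlgebra.EvenHom q P)

theorem evenHom_add_swap (v w : V) :
    g.bilin v w + g.bilin w v = algebraMap K P (QuadraticMap.polar q v w) := by
  have h := g.contract (v + w)
  simp only [map_add, LinearMap.add_apply, g.contract] at h
  rw [QuadraticMap.polar, map_sub, map_sub, ← h]
  abel

theorem evenHom_mid_add_swap (x v w y : V) :
    g.bilin x v * g.bilin w y + g.bilin x w * g.bilin v y =
      QuadraticMap.polar q v w • g.bilin x y := by
  have h := g.contract_mid x (v + w) y
  simp only [map_add, LinearMap.add_apply, add_mul, mul_add, g.contract_mid] at h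
  rw [QuadraticMap.polar, sub_smul, sub_smul, ← h]
  abel

/-- Orthogonal vectors anticommute, and moving `xy` past `vw` takes four exchanges. -/
theorem evenHom_commute {x y v w : V} (hxv : QuadraticMap.polar q x v = 0)
    (hyv : QuadraticMap.polar q y v = 0) (hyw : QuadraticMap.polar q y w = 0)
    (hxw : QuadraticMap.polar q x w = 0) :
    g.bilin x y * g.bilin v w = g.bilin v w * g.bilin x y := by
  have h1 := evenHom_mid_add_swap g x y v w
  have h2 := evenHom_mid_add_swap g v w x y
  have h3 := evenHom_add_swap g x v
  have h4 := evenHom_add_swap g y w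
  rw [hyv, zero_smul] at h1
  rw [QuadraticMap.polar_comm, hxw, zero_smul] at h2
  rw [hxv, map_zero] at h3
  rw [hyw, map_zero] at h4
  rw [eq_neg_of_add_eq_zero_left h1, eq_neg_of_add_eq_zero_left h2,
    eq_neg_of_add_eq_zero_left h3, eq_neg_of_add_eq_zero_left h4, neg_mul_neg]

end EvenHomRelations

section Independence

variable {K : Type*} [Field K] {n N : ℕ} {I : Type*} {J L : Matrix (Fin n) (Fin n) K}
  (hJ : IsUnit J.det) (hs : J.transpose = J) (hL : J * L + (J * L).transpose = J) (hn : 5 ≤ n)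
  {g : CliffordAlgebra.EvenHom (matrixForm J L) (I → Matrix (Fin N) (Fin N) K)}
  {H : I → Matrix (Fin N) (Fin N) K} (hHu : ∀ i, IsUnit (H i).det)
  (hH : ∀ i v w, H i * g.bilin v w i = (g.bilin w v i).transpose * H i)
  {i : I} {S : Matrix (Fin N) (Fin N) K} (hS : H i * S = S.transpose * H i)
include hJ hs hL hn hHu hH hS

/-- With `x`, `y` orthogonal to `v`, `w` and `b(x, y) = 1`, one has `yx = 1 - xy` and `wv = -vw`,
and `xy` commutes with `vw`. So `vw = (xy)(vw) - (wv)(yx)`, a difference of conjugate elements,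
which have equal traces against a symmetric `S`. -/
theorem trace_evenHom_mul_eq_zero {v w : Fin n → K} (hvw : Matrix.toBilin' J v w = 0) :
    (g.bilin v w i * S).trace = 0 := by
  have hsym : (Matrix.toBilin' J).IsSymm := ⟨fun v w => by
    rw [Matrix.toBilin'_apply', Matrix.toBilin'_apply', Matrix.dotProduct_mulVec,
      ← Matrix.mulVec_transpose, hs, dotProduct_comm]⟩
  obtain ⟨x, y, hxy, hxv, hxw, hyv, hyw⟩ := exists_orthogonal_pair
    (LinearMap.BilinForm.nondegenerate_toBilin'_of_det_ne_zero' _ hJ.ne_zero) hsym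
    (by rwa [Module.finrank_fin_fun]) v w
  simp only [← polar_matrixForm hL] at hxy hxv hxw hyv hyw hvw
  let G := g.bilin x y i * g.bilin v w i
  let G' := g.bilin w v i * g.bilin y x i
  have hG : H i * G = G'.transpose * H i := by
    rw [← mul_assoc, hH, mul_assoc, hH, ← mul_assoc, Matrix.transpose_mul]
  have h1 : g.bilin v w i = G - G' := by
    have h2 := evenHom_add_swap g v w
    have h3 := evenHom_add_swap g x y
    have h4 := congrFun (evenHom_commute g hxv hyv hyw hxw) i
    rw [hvw, map_zero] at h2
    rw [hxy, map_one] at h3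
    have h5 : g.bilin w v = -g.bilin v w := eq_neg_of_add_eq_zero_right h2
    have h6 : g.bilin y x = 1 - g.bilin x y := by rw [← h3]; abel
    change _ = g.bilin x y i * g.bilin v w i - g.bilin w v i * g.bilin y x i
    rw [Pi.mul_apply, Pi.mul_apply] at h4
    rw [h4, h5, h6, Pi.neg_apply, Pi.sub_apply, Pi.one_apply, neg_mul, mul_sub, mul_one]
    abel
  have h2 : (G * S).trace = (G' * S).trace := by
    have h3 : H i * (G * S) = (S * G').transpose * H i := by
      rw [← mul_assoc, hG, mul_assoc, hS, ← mul_assoc, Matrix.transpose_mul S]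
    have h4 : G * S = (H i)⁻¹ * ((S * G').transpose * H i) := by
      rw [← h3, Matrix.nonsing_inv_mul_cancel_left _ _ (hHu i)]
    rw [h4, Matrix.trace_mul_comm, mul_assoc, Matrix.mul_nonsing_inv _ (hHu i), mul_one,
      Matrix.trace_transpose, Matrix.trace_mul_comm]
  rw [h1, sub_mul, Matrix.trace_sub, h2, sub_self]

theorem trace_dyadMap_mul_eq_zero {M : Matrix (Fin n) (Fin n) K} (hM : M.trace = 0) :
    (dyadMap J g.bilin M i * S).trace = 0 := by
  let ψ : Matrix (Fin n) (Fin n) K →ₗ[K] K :=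
    Matrix.traceLinearMap (Fin N) K K ∘ₗ LinearMap.mulRight K S ∘ₗ
      LinearMap.proj (R := K) (φ := fun _ : I => Matrix (Fin N) (Fin N) K) i ∘ₗ dyadMap J g.bilin
  refine eq_zero_of_trace_eq_zero (ψ := ψ) (fun v w hvw => ?_) hM
  have h1 : Matrix.vecMulVec v w = dyad J v (Matrix.vecMul w J⁻¹) := by
    rw [dyad_apply, Matrix.vecMulVec_mul, Matrix.vecMul_vecMul, Matrix.nonsing_inv_mul _ hJ,
      Matrix.vecMul_one]
  change (dyadMap J g.bilin (Matrix.vecMulVec v w) i * S).trace = 0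
  rw [h1, dyadMap_dyad hJ]
  refine trace_evenHom_mul_eq_zero hJ hs hL hn hHu hH hS ?_
  rw [Matrix.toBilin'_apply', ← Matrix.mulVec_transpose, Matrix.transpose_nonsing_inv, hs,
    Matrix.mulVec_mulVec, Matrix.mul_nonsing_inv _ hJ, Matrix.one_mulVec, hvw]

end Independence

/-! ### Assembly of the proof -/

section Data

variable {F : Type u} [Field F] {A : Type v} [Ring A] [Algebra F A]

theorem isBaseChange_evalRep {K : Type*} [Field K] [Algebra F K] {n : ℕ}
    (e : K ⊗[F] A ≃ₐ[K] (Unit → Matrix (Fin n) (Fin n) K)) :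
    IsBaseChange K ((Pi.evalAlgHom F (fun _ : Unit => Matrix (Fin n) (Fin n) K) ()).comp
      (splitRep e)).toLinearMap :=
  IsBaseChange.of_equiv
    (e.toLinearEquiv.trans (LinearEquiv.funUnique Unit K (Matrix (Fin n) (Fin n) K)))
    fun _ => rfl

/-- After extension of scalars to an algebraic closure, an algebra with quadratic pair becomes a
matrix algebra with the adjoint involution of a symmetric form `J`. -/
theorem exists_rep [FiniteDimensional F A] [Algebra.IsCentral F A] [IsSimpleRing A] {n : ℕ}
    [NeZero n] (Q : QuadraticPair F F A n) :
    ∃ (ρ : A →ₐ[F] Matrix (Fin n) (Fin n) (AlgebraicClosure F))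
      (J : Matrix (Fin n) (Fin n) (AlgebraicClosure F)),
      IsBaseChange (AlgebraicClosure F) ρ.toLinearMap ∧ IsUnit J.det ∧ J.transpose = J ∧
      (∀ a, J * ρ (Q.σ a) = (ρ a).transpose * J) ∧
      (∀ a, algebraMap F (AlgebraicClosure F) (reducedTrace F F A a) = (ρ a).trace) ∧
      (∃ l, Q.σ.Determines F l Q.f) ∧ ∃ l, reducedTrace F F A l = 1 := by
  obtain ⟨e⟩ := exists_split (K := AlgebraicClosure F) (n := n)
    (Q.finrank_eq.trans (by rw [Module.finrank_self, one_mul]))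
  obtain ⟨J, hJ, hadj⟩ := exists_adjoint_matrix e Q.σ
  have hs := transpose_eq_self e hJ hadj
    (Q.finrank_sym.trans (by rw [Module.finrank_self, one_mul]))
  exact ⟨_, J, isBaseChange_evalRep e, hJ, hs, hadj, algebraMap_reducedTrace e hJ hadj hs,
    exists_determines e hJ hadj hs Q.f Q.isSemitrace, exists_reducedTrace_eq_one e hJ hadj hs⟩

theorem c_add_canonicalInvolution {n : ℕ} (Q : QuadraticPair F F A n) {l : A}
    (hl : reducedTrace F F A l = 1) : Q.c l + Q.canonicalInvolution (Q.c l) = 1 := by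
  rw [Q.canonicalInvolution_c, ← map_add]
  refine (Q.c_sym ⟨l + Q.σ l, Q.σ.add_self_mem_sym l⟩).trans ?_
  rw [Q.isSemitrace, hl, map_one]

end Data

theorem neg_one_pow_half_eq_one {K : Type*} [CommRing K] {k : ℕ}
    (h : (2 : K) = 0 ∨ k ≡ 0 [MOD 4]) : (-1 : K) ^ (k * (k + 1) / 2) = 1 := by
  rcases h with h | h
  · rw [show (-1 : K) = 1 by linear_combination -h, one_pow]
  · obtain ⟨t, rfl⟩ := (Nat.modEq_zero_iff_dvd).mp h
    refine Even.neg_one_pow ⟨t * (4 * t + 1), ?_⟩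
    have : 4 * t * (4 * t + 1) = 2 * (t * (4 * t + 1) + t * (4 * t + 1)) := by ring
    rw [this, Nat.mul_div_cancel_left _ two_pos]

end CliffordQP

open CliffordQP in
theorem mainTheorem4 {F : Type u} [Field F] {A : Type v} [Ring A] [Algebra F A]
    [FiniteDimensional F A] [Algebra.IsCentral F A] [IsSimpleRing A]
    (m : ℕ) (hm : 8 ≤ 2 * m) (hm2 : Even m) (hm4 : ringChar F ≠ 2 → m ≡ 0 [MOD 4])
    (Q : QuadraticPair F F A (2 * m)) :
    IsReducedTrace F Q.cliffordCenter Q.Clifford (reducedTrace F Q.cliffordCenter Q.Clifford) ∧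
    ∃ τ : AlgInvolution Q.cliffordCenter Q.Clifford,
      (∀ x : Q.Clifford, τ x = Q.canonicalInvolution x) ∧
      (ringChar F = 2 → τ.IsSymplectic F) ∧
      (ringChar F ≠ 2 → τ.IsOrthogonal F) ∧
      (∀ l : A, reducedTrace F F A l = 1 →
        τ.IsSemitrace F (τ.traceForm F (Q.c l)) ∧
          τ.Determines F (Q.c l) (τ.traceForm F (Q.c l))) ∧
      (∀ l l' : A, reducedTrace F F A l = 1 → reducedTrace F F A l' = 1 →
        τ.traceForm F (Q.c l) = τ.traceForm F (Q.c l')) ∧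
      ∃! P : QuadraticPair F Q.cliffordCenter Q.Clifford (2 ^ (m - 1)),
        P.σ = τ ∧ ∀ l : A, reducedTrace F F A l = 1 → P.f = P.σ.traceForm F (Q.c l) := by
  obtain ⟨k, rfl⟩ : ∃ k, m = k + 1 := ⟨m - 1, by omega⟩
  rw [Nat.add_sub_cancel]
  have : NeZero (2 * (k + 1)) := ⟨by omega⟩
  have : NeZero (2 ^ k) := ⟨by positivity⟩
  obtain ⟨ρ, J, hρ, hJ, hs, hadj, hT, ⟨l₀, hl₀⟩, l₁, hl₁⟩ := exists_rep Q
  have hL := mul_rep_add_transpose hs hadj hl₀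
  -- The half-spin modules have dimension `2^k = 2^(m-1)`, the degree of the Clifford algebra over
  -- its centre.
  obtain ⟨sp, sm, J₁, J₂, hspin⟩ := exists_isSpinRep k _ (matrixForm J (ρ l₀))
    (fun v hv => nondegenerate_matrixForm hJ hL hv) (Module.finrank_fin_fun _)
  obtain ⟨g, H, hgen, hHu, hH⟩ := hspin.exists_evenHom
  obtain ⟨hH, hHs⟩ := hH hm2
  obtain ⟨e, he⟩ := exists_clifford_split hρ hJ hs hadj hT hl₀ rfl hgen
  have h2 : ringChar F = 2 → (2 : AlgebraicClosure F) = 0 := by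
    intro h
    have h0 : (2 : F) = 0 := (ringChar.spec F 2).mpr h.dvd
    rw [← map_ofNat (algebraMap F (AlgebraicClosure F)), h0, map_zero]
  have h2' : ringChar F ≠ 2 → (2 : AlgebraicClosure F) ≠ 0 := by
    intro h h0
    apply Ring.two_ne_zero h
    apply FaithfulSMul.algebraMap_injective F (AlgebraicClosure F)
    rwa [map_ofNat, map_zero]
  -- Here the congruence modulo `4` enters: for `m ≡ 2` modulo `4` the symmetry sign would be `-1`.
  have hHs' : ∀ i, (H i).transpose = H i := by
    intro i
    rw [hHs, neg_one_pow_half_eq_one, one_smul]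
    by_cases h : ringChar F = 2
    · exact Or.inl (h2 h)
    · exact Or.inr (hm4 h)
  have hadjC := splitRep_canonicalInvolution hJ hs hadj he hH
  have hZ : ∀ x : Q.Clifford, (∀ y, y * x = x * y) →
      ∃ z : Q.cliffordCenter, algebraMap Q.cliffordCenter Q.Clifford z = x :=
    fun x hx => ⟨⟨x, Subalgebra.mem_center_iff.mpr hx⟩, rfl⟩
  have hinj : Function.Injective (algebraMap Q.cliffordCenter Q.Clifford) :=
    Subtype.val_injective
  obtain ⟨χ, hχ⟩ := exists_characters e (Z := Q.cliffordCenter)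
  obtain ⟨hred, hχT⟩ := reducedTrace_spec e hHu hadjC hHs' hχ hZ hinj
  obtain ⟨τ, hτ⟩ := exists_centerInvolution e hHu hadjC hχ
  have hone : ∀ l, reducedTrace F F A l = 1 → Q.c l + Q.canonicalInvolution (Q.c l) = 1 :=
    fun l hl => c_add_canonicalInvolution Q hl
  have hsemi : ∀ l, reducedTrace F F A l = 1 → τ.IsSemitrace F (τ.traceForm F (Q.c l)) :=
    fun l hl => isSemitrace_traceForm e hHu hadjC hHs' hχ hZ hinj hτ (hone l hl)
  have hindep : ∀ l l' : A, reducedTrace F F A l = 1 → reducedTrace F F A l' = 1 →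
      τ.traceForm F (Q.c l) = τ.traceForm F (Q.c l') := by
    intro l l' hl hl'
    refine LinearMap.ext fun s => ?_
    change reducedTrace F Q.cliffordCenter Q.Clifford (Q.c l * s) =
      reducedTrace F Q.cliffordCenter Q.Clifford (Q.c l' * s)
    refine characters_separate e hχ hinj fun i => ?_
    rw [hχT, hχT, ← sub_eq_zero, ← Matrix.trace_sub, map_mul, map_mul, Pi.mul_apply, Pi.mul_apply,
      ← sub_mul, ← Pi.sub_apply, ← map_sub, ← map_sub, he]
    -- The difference `l - l'` has reduced trace zero. The bound `5 ≤ 2m` follows from `8 ≤ 2m`.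
    refine trace_dyadMap_mul_eq_zero hJ hs hL (by omega) hHu hH ?_ ?_
    · have h : Q.canonicalInvolution (s : Q.Clifford) = s := (hτ s).symm.trans s.2
      rw [← hadjC, h]
    · rw [← hT, map_sub, hl, hl', sub_self, map_zero]
  refine ⟨hred, τ, hτ, fun h => ?_, fun h => ?_, fun l hl => ⟨hsemi l hl, ?_, rfl⟩, hindep, ?_⟩
  · exact isSymplectic_of_char_two e hHu hadjC hHs' hχ hZ hinj hτ (h2 h) (hone l₁ hl₁)
  · exact isOrthogonal_of_char_ne_two e hHu hadjC hHs' hχ hZ hinj hτ (h2' h)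
  · rw [hτ, hone l hl]
  · have hdim := finrank_center e hχ hZ hinj
    refine ⟨⟨τ, τ.traceForm F (Q.c l₁), ?_, ?_, hsemi l₁ hl₁⟩, ⟨rfl, fun l hl =>
      hindep l₁ l hl₁ hl⟩, ?_⟩
    · rw [hdim, finrank_splitRep e]
    · rw [hdim, finrank_centerInvolution_sym e hHu hadjC hHs' hτ]
    -- An element of reduced trace `1` exists, so the formula for the semi-trace is not vacuous and
    -- determines it.
    · rintro ⟨σ', f', h1, h2, h3⟩ ⟨hσ', hf⟩
      obtain rfl : σ' = τ := hσ'
      obtain rfl : f' = σ'.traceForm F (Q.c l₁) := hf l₁ hl₁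
      rfl
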